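/- Let $u=\tfrac12(1,1,1)$ and let $\Gamma\subset\mathbb{R}^3$ be one of the three cubic lattices $\Gamma_{\mathsf{pc}}=\mathbb{Z}^3$, $\Gamma_{\mathsf{bcc}}=\mathbb{Z}^3\cup(u+\mathbb{Z}^3)$, $\Gamma_{\mathsf{fcc}}=\Gamma_{\mathsf{bcc}}^{*}=\{x\in\mathbb{R}^3:\langle x,y\rangle\in\mathbb{Z}\text{ for all }y\in\Gamma_{\mathsf{bcc}}\}$. Definitions. For $R\in\mathrm{O}(3,\mathbb{R})$ put $\Gamma(R)=\Gamma\cap R\Gamma$. Let $\mathrm{OC}(\Gamma)$ be the set of all $R\in\mathrm{O}(3,\mathbb{R})$ such that $\Gamma(R)$ has finite index in both $\Gamma$ and $R\Gamma$, and $\mathrm{OS}(\Gamma)$ the set of all $R\in\mathrm{O}(3,\mathbb{R})$ such that $\alpha R\Gamma\subseteq\Gamma$ for some real $\alpha>0$. For $R\in\mathrm{OC}(\Gamma)$ the lattice $\Gamma(R)$ is called a coincidence site lattice (CSL) of $\Gamma$, and $\Sigma_\Gamma(R)=[\Gamma:\Gamma(R)]$ is its coincidence index. For $R\in\mathrm{OS}(\Gamma)$,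 $\mathrm{den}_\Gamma(R)$ is the smallest $\alpha>0$ with $\alpha R\Gamma\subseteq\Gamma$. Let $c_\Gamma(n)$ be the number of CSLs of $\Gamma$ of index $n$, and $c^{\mathsf{iso}}_\Gamma(n)$ the number of cosets $R\,\mathrm{O}(\Gamma)$ with $R\in\mathrm{OC}(\Gamma)$ and $\Sigma_\Gamma(R)=n$, where $\mathrm{O}(\Gamma)=\{S\in\mathrm{O}(3,\mathbb{R}):S\Gamma=\Gamma\}$. Put $\Psi_\Gamma(s)=\sum_{m\ge1}c_\Gamma(m)m^{-s}$ and $\Psi^{\mathsf{iso}}_\Gamma(s)=\sum_{m\ge1}c^{\mathsf{iso}}_\Gamma(m)m^{-s}$. Let $\mathbb{J}$ be the ring of Hurwitz quaternions (real quaternions whose components are all in $\mathbb{Z}$ or all in $\tfrac12+\mathbb{Z}$); $q\in\mathbb{J}$ is primitive if $\tfrac1n q\in\mathbb{J}$ with a positive integer $n$ implies $n=1$. For $q\ne0$ let $R(q)$ be the rotation $x\mapsto q x\bar q/|q|^2$ of $\mathbb{R}^3=\mathrm{Im}\,\mathbb{H}$. Let $\zeta_{\mathbb{J}}(s)=\sum_{I}[\mathbb{J}:I]^{-s}$,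 summed over all nonzero left ideals $I$ of $\mathbb{J}$. Theorem. (1) $\mathrm{OC}(\Gamma)=\mathrm{OS}(\Gamma)=\mathrm{OC}(\Gamma_{\mathsf{bcc}})=\mathrm{O}(3,\mathbb{Q})$. (2) If $q$ is a primitive Hurwitz quaternion and $\ell$ is the maximal exponent such that $2^\ell$ divides the positive integer $|q|^2$, then $R(q)\in\mathrm{OC}(\Gamma)$ and $$\Sigma_\Gamma(R(q))=\Sigma_{\Gamma_{\mathsf{bcc}}}(R(q))=\mathrm{den}_\Gamma(R(q))=\frac{|q|^2}{2^\ell}.$$ (3) All the numbers $c_\Gamma(n)$ and $c^{\mathsf{iso}}_\Gamma(n)$ are finite, and $c_\Gamma(n)=c^{\mathsf{iso}}_\Gamma(n)=c_{\Gamma_{\mathsf{bcc}}}(n)$ for every $n$. The function $c_\Gamma$ is multiplicative with $c_\Gamma(1)=1$, $c_\Gamma(2^r)=0$ and $c_\Gamma(p^r)=(p+1)p^{r-1}$ for all odd primes $p$ and all $r\ge1$; moreover $c_\Gamma(n)\neq0$ if and only if $n$ is odd. (4) For every complex $s$ with $\mathrm{Re}(s)>2$, the series $\Psi_\Gamma(s)$,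 $\Psi^{\mathsf{iso}}_\Gamma(s)$, $\Psi_{\Gamma_{\mathsf{bcc}}}(s)$ and $\zeta_{\mathbb{J}}(s/2)$ converge absolutely, and $$\Psi_\Gamma(s)=\Psi^{\mathsf{iso}}_\Gamma(s)=\Psi_{\Gamma_{\mathsf{bcc}}}(s)=\prod_{p\ne2}\frac{1+p^{-s}}{1-p^{1-s}}=\frac{1}{1+2^{-s}}\,\frac{\zeta_{\mathbb{J}}(s/2)}{\zeta(2s)}=\frac{1-2^{1-s}}{1+2^{-s}}\,\frac{\zeta(s)\,\zeta(s-1)}{\zeta(2s)},$$ where the product runs over all odd primes $p$ and converges unconditionally, and $\zeta$ is Riemann's zeta function. The expansion begins $$1+\tfrac{4}{3^s}+\tfrac{6}{5^s}+\tfrac{8}{7^s}+\tfrac{12}{9^s}+\tfrac{12}{11^s}+\tfrac{14}{13^s}+\tfrac{24}{15^s}+\tfrac{18}{17^s}+\tfrac{20}{19^s}+\tfrac{32}{21^s}+\cdots .$$ -/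

import Mathlib

open scoped Quaternion Matrix

noncomputable section

namespace CSL

/-! ### Coincidence and similarity isometries of subgroups of `ℝᵈ` -/

variable {d : ℕ}

/-- The image `A Γ` of a subgroup `Γ ⊆ ℝᵈ` under a real matrix `A`. -/
def image (A : Matrix (Fin d) (Fin d) ℝ) (Γ : AddSubgroup (Fin d → ℝ)) :
    AddSubgroup (Fin d → ℝ) :=
  Γ.map (Matrix.mulVecLin A).toAddMonoidHom

theorem image_one (Γ : AddSubgroup (Fin d → ℝ)) : image 1 Γ = Γ := by
  ext x
  simp [image, AddSubgroup.mem_map]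

theorem image_mul (A B : Matrix (Fin d) (Fin d) ℝ) (Γ : AddSubgroup (Fin d → ℝ)) :
    image (A * B) Γ = image A (image B Γ) := by
  ext x
  simp [image, AddSubgroup.mem_map, Matrix.mulVec_mulVec]

/-- The set `OC(Γ)` of coincidence isometries: all `R ∈ O(d, ℝ)` such that `Γ` and `R Γ` are
commensurate, that is, such that `Γ ∩ R Γ` has finite index in both. -/
def OC (Γ : AddSubgroup (Fin d → ℝ)) : Set (Matrix.orthogonalGroup (Fin d) ℝ) :=
  {R | AddSubgroup.Commensurable Γ (image R.1 Γ)}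

/-- The set `OS(Γ)` of similarity isometries. -/
def OS (Γ : AddSubgroup (Fin d → ℝ)) : Set (Matrix.orthogonalGroup (Fin d) ℝ) :=
  {R | ∃ α : ℝ, 0 < α ∧ image (α • R.1) Γ ≤ Γ}

/-- The set `O(d, ℚ)` of rational orthogonal matrices, inside `O(d, ℝ)`. -/
def rationalOrthogonal (d : ℕ) : Set (Matrix.orthogonalGroup (Fin d) ℝ) :=
  {R | ∃ M ∈ Matrix.orthogonalGroup (Fin d) ℚ, R.1 = M.map (fun x : ℚ => (x : ℝ))}

/-- `Γ(R) = Γ ∩ R Γ`, which is the coincidence site lattice when `R ∈ OC(Γ)`. -/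
def csl (Γ : AddSubgroup (Fin d → ℝ)) (R : Matrix.orthogonalGroup (Fin d) ℝ) :
    AddSubgroup (Fin d → ℝ) :=
  Γ ⊓ image R.1 Γ

/-- The coincidence index `Σ_Γ(R) = [Γ : Γ(R)]`. -/
def coincidenceIndex (Γ : AddSubgroup (Fin d → ℝ)) (R : Matrix.orthogonalGroup (Fin d) ℝ) : ℕ :=
  (csl Γ R).relIndex Γ

/-- The set `Scal_Γ(R)` of all real `α` with `α R Γ ⊆ Γ`. -/
def Scal (Γ : AddSubgroup (Fin d → ℝ)) (R : Matrix.orthogonalGroup (Fin d) ℝ) : Set ℝ :=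
  {α | image (α • R.1) Γ ≤ Γ}

/-- `δ` is the denominator `den_Γ(R)`, the smallest positive element of `Scal_Γ(R)`. -/
def IsDen (Γ : AddSubgroup (Fin d → ℝ)) (R : Matrix.orthogonalGroup (Fin d) ℝ) (δ : ℝ) : Prop :=
  IsLeast {α | α ∈ Scal Γ R ∧ 0 < α} δ

/-- The symmetry group `O(Γ)` of all `R ∈ O(d, ℝ)` with `R Γ = Γ`. -/
def symmetryGroup (Γ : AddSubgroup (Fin d → ℝ)) :
    Subgroup (Matrix.orthogonalGroup (Fin d) ℝ) where
  carrier := {R | image R.1 Γ = Γ}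
  one_mem' := image_one Γ
  mul_mem' := by
    intro R S hR hS
    change image (R.1 * S.1) Γ = Γ
    rw [image_mul, show image S.1 Γ = Γ from hS, show image R.1 Γ = Γ from hR]
  inv_mem' := by
    intro R hR
    change image (R⁻¹).1 Γ = Γ
    have h : (R⁻¹).1 * R.1 = 1 := congrArg Subtype.val (inv_mul_cancel R)
    calc image (R⁻¹).1 Γ = image (R⁻¹).1 (image R.1 Γ) := by rw [show image R.1 Γ = Γ from hR]
      _ = Γ := by rw [← image_mul, h, image_one]

/-- The set of all CSLs of `Γ` of index `n`. -/
def cslsOfIndex (Γ : AddSubgroup (Fin d → ℝ)) (n : ℕ) : Set (AddSubgroup (Fin d → ℝ)) :=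
  {Λ | (∃ R ∈ OC Γ, Λ = csl Γ R) ∧ Λ.relIndex Γ = n}

/-- The classes `R O(Γ)` of coincidence isometries of index `n` modulo the symmetry group. -/
def isosOfIndex (Γ : AddSubgroup (Fin d → ℝ)) (n : ℕ) :
    Set (Matrix.orthogonalGroup (Fin d) ℝ ⧸ symmetryGroup Γ) :=
  QuotientGroup.mk '' {R | R ∈ OC Γ ∧ coincidenceIndex Γ R = n}

/-- `c_Γ(n)`, the number of CSLs of `Γ` of index `n`. -/
def c (Γ : AddSubgroup (Fin d → ℝ)) (n : ℕ) : ℕ := (cslsOfIndex Γ n).ncard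

/-- `c^iso_Γ(n)`, the number of coincidence isometries of index `n`, counted modulo the symmetry
group. -/
def cIso (Γ : AddSubgroup (Fin d → ℝ)) (n : ℕ) : ℕ := (isosOfIndex Γ n).ncard

/-- The dual `Γ* = {x | ⟨x, y⟩ ∈ ℤ for all y ∈ Γ}`. -/
def dual (Γ : AddSubgroup (Fin d → ℝ)) : AddSubgroup (Fin d → ℝ) where
  carrier := {x | ∀ y ∈ Γ, ∃ k : ℤ, x ⬝ᵥ y = k}
  zero_mem' := fun y _ => ⟨0, by simp⟩
  add_mem' := by
    intro a b ha hb y hy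
    obtain ⟨k, hk⟩ := ha y hy
    obtain ⟨l, hl⟩ := hb y hy
    exact ⟨k + l, by rw [add_dotProduct, hk, hl]; push_cast; rfl⟩
  neg_mem' := by
    intro a ha y hy
    obtain ⟨k, hk⟩ := ha y hy
    exact ⟨-k, by rw [neg_dotProduct, hk]; push_cast; rfl⟩

/-! ### The three cubic lattices -/

/-- The primitive cubic lattice `ℤ³`. -/
def pc : AddSubgroup (Fin 3 → ℝ) where
  carrier := {x | ∃ a : Fin 3 → ℤ, ∀ i, x i = a i}
  zero_mem' := ⟨0, by simp⟩
  add_mem' := by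
    rintro x y ⟨a, ha⟩ ⟨b, hb⟩
    exact ⟨a + b, fun i => by simp [ha, hb]⟩
  neg_mem' := by
    rintro x ⟨a, ha⟩
    exact ⟨-a, fun i => by simp [ha]⟩

/-- The body-centred cubic lattice `ℤ³ ∪ (u + ℤ³)` with `u = (1/2, 1/2, 1/2)`. -/
def bcc : AddSubgroup (Fin 3 → ℝ) where
  carrier := {x | (∃ a : Fin 3 → ℤ, ∀ i, x i = a i) ∨ (∃ a : Fin 3 → ℤ, ∀ i, x i = 1 / 2 + a i)}
  zero_mem' := Or.inl ⟨0, by simp⟩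
  add_mem' := by
    rintro x y (⟨a, ha⟩ | ⟨a, ha⟩) (⟨b, hb⟩ | ⟨b, hb⟩)
    · exact Or.inl ⟨a + b, fun i => by simp [ha, hb]⟩
    · exact Or.inr ⟨a + b, fun i => by simp [ha, hb]; ring⟩
    · exact Or.inr ⟨a + b, fun i => by simp [ha, hb]; ring⟩
    · exact Or.inl ⟨a + b + 1, fun i => by simp [ha, hb]; ring⟩
  neg_mem' := by
    rintro x (⟨a, ha⟩ | ⟨a, ha⟩)
    · exact Or.inl ⟨-a, fun i => by simp [ha]⟩
    · exact Or.inr ⟨-a - 1, fun i => by simp [ha]; ring⟩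

/-- The face-centred cubic lattice, the dual of the body-centred one. -/
def fcc : AddSubgroup (Fin 3 → ℝ) := dual bcc

/-! ### Hurwitz quaternions -/

/-- The ring of Hurwitz quaternions: all components integers, or all components half-integers. -/
def hurwitz : Subring ℍ[ℝ] where
  carrier := {q |
    (∃ a b e f : ℤ, q.re = a ∧ q.imI = b ∧ q.imJ = e ∧ q.imK = f) ∨
    (∃ a b e f : ℤ, q.re = 1 / 2 + a ∧ q.imI = 1 / 2 + b ∧ q.imJ = 1 / 2 + e ∧ q.imK = 1 / 2 + f)}
  zero_mem' := Or.inl ⟨0, 0, 0, 0, by simp⟩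
  one_mem' := Or.inl ⟨1, 0, 0, 0, by simp⟩
  add_mem' := by
    rintro x y (⟨a, b, e, f, h0, h1, h2, h3⟩ | ⟨a, b, e, f, h0, h1, h2, h3⟩)
      (⟨a', b', e', f', k0, k1, k2, k3⟩ | ⟨a', b', e', f', k0, k1, k2, k3⟩)
    · refine Or.inl ⟨a + a', b + b', e + e', f + f', ?_, ?_, ?_, ?_⟩ <;>
        simp [h0, h1, h2, h3, k0, k1, k2, k3]
    · refine Or.inr ⟨a + a', b + b', e + e', f + f', ?_, ?_, ?_, ?_⟩ <;>
        simp [h0, h1, h2, h3, k0, k1, k2, k3] <;> ring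
    · refine Or.inr ⟨a + a', b + b', e + e', f + f', ?_, ?_, ?_, ?_⟩ <;>
        simp [h0, h1, h2, h3, k0, k1, k2, k3] <;> ring
    · refine Or.inl ⟨a + a' + 1, b + b' + 1, e + e' + 1, f + f' + 1, ?_, ?_, ?_, ?_⟩ <;>
        simp [h0, h1, h2, h3, k0, k1, k2, k3] <;> ring
  neg_mem' := by
    rintro x (⟨a, b, e, f, h0, h1, h2, h3⟩ | ⟨a, b, e, f, h0, h1, h2, h3⟩)
    · refine Or.inl ⟨-a, -b, -e, -f, ?_, ?_, ?_, ?_⟩ <;> simp [h0, h1, h2, h3]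
    · refine Or.inr ⟨-a - 1, -b - 1, -e - 1, -f - 1, ?_, ?_, ?_, ?_⟩ <;>
        simp [h0, h1, h2, h3] <;> ring
  mul_mem' := by
    rintro x y (⟨a, b, e, f, h0, h1, h2, h3⟩ | ⟨a, b, e, f, h0, h1, h2, h3⟩)
      (⟨a', b', e', f', k0, k1, k2, k3⟩ | ⟨a', b', e', f', k0, k1, k2, k3⟩)
    · refine Or.inl ⟨a * a' - b * b' - e * e' - f * f', a * b' + b * a' + e * f' - f * e',
        a * e' - b * f' + e * a' + f * b', a * f' + b * e' - e * b' + f * a', ?_, ?_, ?_, ?_⟩ <;>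
        simp [h0, h1, h2, h3, k0, k1, k2, k3]
    · obtain ⟨k, hk | hk⟩ := Int.even_or_odd' (a + b + e + f)
      · replace hk := congrArg (Int.cast (R := ℝ)) hk
        push_cast at hk
        refine Or.inl ⟨a * a' - b * b' - e * e' - f * f' + k - b - e - f,
          a * b' + b * a' + e * f' - f * e' + k - f,
          a * e' - b * f' + e * a' + f * b' + k - b,
          a * f' + b * e' - e * b' + f * a' + k - e, ?_, ?_, ?_, ?_⟩ <;>
          simp [h0, h1, h2, h3, k0, k1, k2, k3] <;> linear_combination (1 / 2) * hk
      · replace hk := congrArg (Int.cast (R := ℝ)) hk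
        push_cast at hk
        refine Or.inr ⟨a * a' - b * b' - e * e' - f * f' + k - b - e - f,
          a * b' + b * a' + e * f' - f * e' + k - f,
          a * e' - b * f' + e * a' + f * b' + k - b,
          a * f' + b * e' - e * b' + f * a' + k - e, ?_, ?_, ?_, ?_⟩ <;>
          simp [h0, h1, h2, h3, k0, k1, k2, k3] <;> linear_combination (1 / 2) * hk
    · obtain ⟨k, hk | hk⟩ := Int.even_or_odd' (a' + b' + e' + f')
      · replace hk := congrArg (Int.cast (R := ℝ)) hk
        push_cast at hk
        refine Or.inl ⟨a * a' - b * b' - e * e' - f * f' + k - b' - e' - f',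
          a * b' + b * a' + e * f' - f * e' + k - e',
          a * e' - b * f' + e * a' + f * b' + k - f',
          a * f' + b * e' - e * b' + f * a' + k - b', ?_, ?_, ?_, ?_⟩ <;>
          simp [h0, h1, h2, h3, k0, k1, k2, k3] <;> linear_combination (1 / 2) * hk
      · replace hk := congrArg (Int.cast (R := ℝ)) hk
        push_cast at hk
        refine Or.inr ⟨a * a' - b * b' - e * e' - f * f' + k - b' - e' - f',
          a * b' + b * a' + e * f' - f * e' + k - e',
          a * e' - b * f' + e * a' + f * b' + k - f',
          a * f' + b * e' - e * b' + f * a' + k - b', ?_, ?_, ?_, ?_⟩ <;>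
          simp [h0, h1, h2, h3, k0, k1, k2, k3] <;> linear_combination (1 / 2) * hk
    · obtain ⟨k, hk | hk⟩ := Int.even_or_odd' (a + b + e + f + a' + b' + e' + f')
      · replace hk := congrArg (Int.cast (R := ℝ)) hk
        push_cast at hk
        refine Or.inr ⟨a * a' - b * b' - e * e' - f * f' + k - b - b' - e - e' - f - f' - 1,
          a * b' + b * a' + e * f' - f * e' + k - f - e',
          a * e' - b * f' + e * a' + f * b' + k - b - f',
          a * f' + b * e' - e * b' + f * a' + k - e - b', ?_, ?_, ?_, ?_⟩ <;>
          simp [h0, h1, h2, h3, k0, k1, k2, k3] <;> linear_combination (1 / 2) * hk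
      · replace hk := congrArg (Int.cast (R := ℝ)) hk
        push_cast at hk
        refine Or.inl ⟨a * a' - b * b' - e * e' - f * f' + k - b - b' - e - e' - f - f',
          a * b' + b * a' + e * f' - f * e' + k + 1 - f - e',
          a * e' - b * f' + e * a' + f * b' + k + 1 - b - f',
          a * f' + b * e' - e * b' + f * a' + k + 1 - e - b', ?_, ?_, ?_, ?_⟩ <;>
          simp [h0, h1, h2, h3, k0, k1, k2, k3] <;> linear_combination (1 / 2) * hk

/-- A Hurwitz quaternion `q` is primitive if `q / n` is a Hurwitz quaternion, for a positive
integer `n`, only when `n = 1`. -/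
def IsPrimitive (q : ℍ[ℝ]) : Prop :=
  q ∈ hurwitz ∧ ∀ n : ℕ, 0 < n → ((n : ℝ)⁻¹ • q) ∈ hurwitz → n = 1

theorem IsPrimitive.ne_zero {q : ℍ[ℝ]} (hq : IsPrimitive q) : q ≠ 0 := by
  rintro rfl
  have := hq.2 2 (by norm_num) (by rw [smul_zero]; exact hurwitz.zero_mem)
  omega

/-- The matrix of Cayley's parametrisation, that is, of `x ↦ q x q̄ / |q|²` on `Im ℍ = ℝ³`. -/
def cayleyMatrix (q : ℍ[ℝ]) : Matrix (Fin 3) (Fin 3) ℝ :=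
  (Quaternion.normSq q)⁻¹ •
    !![q.re ^ 2 + q.imI ^ 2 - q.imJ ^ 2 - q.imK ^ 2,
        -2 * q.re * q.imK + 2 * q.imI * q.imJ,
        2 * q.re * q.imJ + 2 * q.imI * q.imK;
      2 * q.re * q.imK + 2 * q.imI * q.imJ,
        q.re ^ 2 - q.imI ^ 2 + q.imJ ^ 2 - q.imK ^ 2,
        -2 * q.re * q.imI + 2 * q.imJ * q.imK;
      -2 * q.re * q.imJ + 2 * q.imI * q.imK,
        2 * q.re * q.imI + 2 * q.imJ * q.imK,
        q.re ^ 2 - q.imI ^ 2 - q.imJ ^ 2 + q.imK ^ 2]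

theorem cayleyMatrix_mem {q : ℍ[ℝ]} (hq : q ≠ 0) :
    cayleyMatrix q ∈ Matrix.orthogonalGroup (Fin 3) ℝ := by
  have h0 : Quaternion.normSq q ≠ 0 := by simpa using hq
  rw [Matrix.mem_orthogonalGroup_iff]
  have h1 := Quaternion.normSq_def' q
  ext i j
  fin_cases i <;> fin_cases j <;>
    simp [cayleyMatrix, Matrix.mul_apply, Fin.sum_univ_three] <;>
    field_simp <;> rw [h1] <;> ring

/-- The rotation `R(q)` of `ℝ³` given by a nonzero quaternion `q`. -/
def rotation (q : ℍ[ℝ]) (hq : q ≠ 0) : Matrix.orthogonalGroup (Fin 3) ℝ :=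
  ⟨cayleyMatrix q, cayleyMatrix_mem hq⟩

/-- The term `[J : I]^(-s)` of a nonzero left ideal `I` in the zeta function of the Hurwitz
ring `J`. -/
def zetaHurwitzTerm (s : ℂ) (I : {I : Submodule hurwitz hurwitz // I ≠ ⊥}) : ℂ :=
  (I.1.toAddSubgroup.index : ℂ) ^ (-s)

/-- The zeta function `ζ_J(s) = ∑ [J : I]^(-s)` of the Hurwitz ring `J`, summed over the nonzero
left ideals `I` of `J`. -/
def zetaHurwitz (s : ℂ) : ℂ := ∑' I, zetaHurwitzTerm s I

end CSL

end

noncomputable section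

namespace CSL

/-! Everything is read off from quaternions. A rational rotation is R(q) for some primitive Hurwitz
quaternion q (`exists_primitive_of_special`). Since -1 and the quarter turn R(1 + i) preserve all
three lattices, q may be taken of odd norm n (`exists_rotation_of_rational`). About Γ only the
properties collected in `IsCubic` are used: Γ is stable under x ↦ q x q̄ and agrees with ℤ³ up to
factors of 2, which are invisible modulo the odd number n. This is why the three lattices have the
same answers.

The key is that the right ideals qJ, with q primitive of odd norm n, are the points over ℤ/n of the
conic x² + y² + z² = 0: one has qJ = vJ + nJ for an integer vector v that is isotropic and
unimodular modulo n (`Conic.exists_generates`, `IsPrimitive.exists_conic`). In terms of v the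
coincidence condition is linear: Γ ∩ R(q)Γ consists of the x in Γ for which n divides ⟨v, 2x⟩
(`Generates.csl_eq`). Hence the index is n (`relIndex_conicLattice`). Conversely the CSL determines
v up to a unit modulo n, hence qJ, hence q up to a unit on the right, whose rotation is a symmetry
(`IsCubic.inv_mul_mem_of_csl_eq`). So CSLs, classes of isometries and projective points of the conic
are the same thing.

There are c(n)φ(n) vectors v modulo n (`IsCubic.card_conicPoint`). The Chinese remainder theorem
makes their number multiplicative. Modulo an odd prime power the conic is equivalent to xz = y²,
whose points are counted directly in a local ring (`card_conePoint`).

The Euler product follows from the values at prime powers, with c ≤ σ for convergence. For the zeta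
function of J, each nonzero left ideal is Jx for exactly one x = (2k + 1) q̄ (1 + i)^ℓ, where q runs
through one representative for each CSL of ℤ³, and its index is |x|⁴. Thus ζ_J(s/2) is the product
of a geometric series, the odd part of ζ(2s) and the series of c (`summable_zetaHurwitzTerm`). -/

/-! ### Integrality of Hurwitz quaternions and of their norms -/

theorem star_mem_hurwitz {q : ℍ[ℝ]} (hq : q ∈ hurwitz) : star q ∈ hurwitz := by
  rcases hq with ⟨a, b, e, f, h0, h1, h2, h3⟩ | ⟨a, b, e, f, h0, h1, h2, h3⟩
  · exact Or.inl ⟨a, -b, -e, -f, by simp [h0, h1, h2, h3]⟩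
  · refine Or.inr ⟨a, -b - 1, -e - 1, -f - 1, ?_, ?_, ?_, ?_⟩ <;> simp [h0, h1, h2, h3] <;> ring

theorem star_mem_hurwitz_iff {q : ℍ[ℝ]} : star q ∈ hurwitz ↔ q ∈ hurwitz :=
  ⟨fun h => by simpa using star_mem_hurwitz h, star_mem_hurwitz⟩

theorem intCast_smul_mem_hurwitz (n : ℤ) {q : ℍ[ℝ]} (hq : q ∈ hurwitz) :
    (n : ℝ) • q ∈ hurwitz := by
  have h := hurwitz.toAddSubgroup.zsmul_mem hq n
  rwa [← Int.cast_smul_eq_zsmul ℝ] at h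

theorem natCast_smul_mem_hurwitz (n : ℕ) {q : ℍ[ℝ]} (hq : q ∈ hurwitz) :
    (n : ℝ) • q ∈ hurwitz := by
  exact_mod_cast intCast_smul_mem_hurwitz n hq

/-- Twice the components of a Hurwitz quaternion are integers. -/
theorem exists_two_mul_components {q : ℍ[ℝ]} (hq : q ∈ hurwitz) : ∃ a b e f : ℤ,
    2 * q.re = a ∧ 2 * q.imI = b ∧ 2 * q.imJ = e ∧ 2 * q.imK = f := by
  rcases hq with ⟨a, b, e, f, h0, h1, h2, h3⟩ | ⟨a, b, e, f, h0, h1, h2, h3⟩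
  · exact ⟨2 * a, 2 * b, 2 * e, 2 * f, by simp [h0, h1, h2, h3]⟩
  · refine ⟨2 * a + 1, 2 * b + 1, 2 * e + 1, 2 * f + 1, ?_, ?_, ?_, ?_⟩ <;>
      simp [h0, h1, h2, h3] <;> ring

theorem mem_hurwitz_of_components {q : ℍ[ℝ]} {a b e f : ℤ} (h0 : q.re = a) (h1 : q.imI = b)
    (h2 : q.imJ = e) (h3 : q.imK = f) : q ∈ hurwitz :=
  Or.inl ⟨a, b, e, f, h0, h1, h2, h3⟩

/-- The norm of a half-integral Hurwitz quaternion is odd. -/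
theorem exists_normSq_of_half {q : ℍ[ℝ]} {a b e f : ℤ} (h0 : q.re = 1 / 2 + a)
    (h1 : q.imI = 1 / 2 + b) (h2 : q.imJ = 1 / 2 + e) (h3 : q.imK = 1 / 2 + f) :
    ∃ k : ℤ, Quaternion.normSq q = ((2 * k + 1 : ℤ) : ℝ) := by
  -- (1/2 + a)² = 1/4 + a(a + 1), and a(a + 1) is even; the four quarters add up to 1.
  obtain ⟨x, hx⟩ := Int.even_mul_succ_self a
  obtain ⟨y, hy⟩ := Int.even_mul_succ_self b
  obtain ⟨z, hz⟩ := Int.even_mul_succ_self e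
  obtain ⟨w, hw⟩ := Int.even_mul_succ_self f
  have hx' := congrArg (Int.cast (R := ℝ)) hx
  have hy' := congrArg (Int.cast (R := ℝ)) hy
  have hz' := congrArg (Int.cast (R := ℝ)) hz
  have hw' := congrArg (Int.cast (R := ℝ)) hw
  push_cast at hx' hy' hz' hw'
  refine ⟨x + y + z + w, ?_⟩
  rw [Quaternion.normSq_def', h0, h1, h2, h3]
  push_cast
  linear_combination hx' + hy' + hz' + hw'

theorem exists_normSq_eq_natCast {q : ℍ[ℝ]} (hq : q ∈ hurwitz) :
    ∃ N : ℕ, Quaternion.normSq q = N := by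
  have key : ∃ k : ℤ, Quaternion.normSq q = k := by
    rcases hq with ⟨a, b, e, f, h0, h1, h2, h3⟩ | ⟨a, b, e, f, h0, h1, h2, h3⟩
    · exact ⟨a ^ 2 + b ^ 2 + e ^ 2 + f ^ 2, by
        rw [Quaternion.normSq_def', h0, h1, h2, h3]; push_cast; ring⟩
    · obtain ⟨k, hk⟩ := exists_normSq_of_half h0 h1 h2 h3
      exact ⟨_, hk⟩
  obtain ⟨k, hk⟩ := key
  have h0 : (0 : ℝ) ≤ k := hk ▸ Quaternion.normSq_nonneg
  lift k to ℕ using by exact_mod_cast h0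
  exact ⟨k, by exact_mod_cast hk⟩

/-! ### Pure quaternions, and the lattices pc and bcc inside the Hurwitz ring -/

/-- The pure quaternion with a given imaginary part. -/
def pureQ (x : Fin 3 → ℝ) : ℍ[ℝ] := ⟨0, x 0, x 1, x 2⟩

@[simp] theorem pureQ_re (x : Fin 3 → ℝ) : (pureQ x).re = 0 := rfl
@[simp] theorem pureQ_imI (x : Fin 3 → ℝ) : (pureQ x).imI = x 0 := rfl
@[simp] theorem pureQ_imJ (x : Fin 3 → ℝ) : (pureQ x).imJ = x 1 := rfl
@[simp] theorem pureQ_imK (x : Fin 3 → ℝ) : (pureQ x).imK = x 2 := rfl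

theorem pureQ_smul (r : ℝ) (x : Fin 3 → ℝ) : pureQ (r • x) = r • pureQ x := by
  ext <;> simp

theorem pureQ_injective : Function.Injective pureQ := by
  intro x y h
  ext i
  fin_cases i
  · exact congrArg QuaternionAlgebra.imI h
  · exact congrArg QuaternionAlgebra.imJ h
  · exact congrArg QuaternionAlgebra.imK h

theorem star_pureQ (x : Fin 3 → ℝ) : star (pureQ x) = -pureQ x := by
  ext <;> simp

theorem exists_pureQ_eq {q : ℍ[ℝ]} (h : q.re = 0) : ∃ x, q = pureQ x :=
  ⟨![q.imI, q.imJ, q.imK], by ext <;> simp [h]⟩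

theorem pureQ_mem_hurwitz_iff {x : Fin 3 → ℝ} : pureQ x ∈ hurwitz ↔ x ∈ pc := by
  constructor
  · rintro (⟨a, b, e, f, h0, h1, h2, h3⟩ | ⟨a, b, e, f, h0, h1, h2, h3⟩)
    · refine ⟨![b, e, f], fun i => ?_⟩
      fin_cases i
      exacts [h1, h2, h3]
    · exfalso
      simp only [pureQ_re] at h0
      have : (2 * a + 1 : ℤ) = 0 := by
        have : ((2 * a + 1 : ℤ) : ℝ) = 0 := by push_cast; linarith
        exact_mod_cast this
      omega
  · rintro ⟨a, ha⟩
    exact Or.inl ⟨0, a 0, a 1, a 2, by simp [ha]⟩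

/-- Lets x ↦ q x q̄ act on bcc through the ring J, because this map commutes with taking imaginary
parts. -/
theorem mem_bcc_iff {x : Fin 3 → ℝ} : x ∈ bcc ↔ ∃ q ∈ hurwitz, q.im = pureQ x := by
  constructor
  · rintro (⟨a, ha⟩ | ⟨a, ha⟩)
    · exact ⟨pureQ x, pureQ_mem_hurwitz_iff.2 ⟨a, ha⟩, by ext <;> simp⟩
    · exact ⟨⟨1 / 2, x 0, x 1, x 2⟩, Or.inr ⟨0, a 0, a 1, a 2, by simp [ha]⟩,
      Quaternion.ext _ _ rfl rfl rfl rfl⟩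
  · rintro ⟨q, ⟨a, b, e, f, h0, h1, h2, h3⟩ | ⟨a, b, e, f, h0, h1, h2, h3⟩, h⟩
    all_goals
      have k1 := congrArg QuaternionAlgebra.imI h
      have k2 := congrArg QuaternionAlgebra.imJ h
      have k3 := congrArg QuaternionAlgebra.imK h
      simp only [Quaternion.imI_im, Quaternion.imJ_im, Quaternion.imK_im, pureQ_imI, pureQ_imJ,
        pureQ_imK] at k1 k2 k3
    · refine Or.inl ⟨![b, e, f], fun i => ?_⟩
      fin_cases i <;> simp [← k1, ← k2, ← k3, h1, h2, h3]
    · refine Or.inr ⟨![b, e, f], fun i => ?_⟩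
      fin_cases i <;> simp [← k1, ← k2, ← k3, h1, h2, h3]

/-! ### The Cayley parametrisation -/

/-- The matrix of `x ↦ q x q̄` on `Im ℍ = ℝ³`. -/
def conjMatrix (q : ℍ[ℝ]) : Matrix (Fin 3) (Fin 3) ℝ :=
  Quaternion.normSq q • cayleyMatrix q

theorem conjMatrix_eq (q : ℍ[ℝ]) : conjMatrix q =
    !![q.re ^ 2 + q.imI ^ 2 - q.imJ ^ 2 - q.imK ^ 2,
        -2 * q.re * q.imK + 2 * q.imI * q.imJ,
        2 * q.re * q.imJ + 2 * q.imI * q.imK;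
      2 * q.re * q.imK + 2 * q.imI * q.imJ,
        q.re ^ 2 - q.imI ^ 2 + q.imJ ^ 2 - q.imK ^ 2,
        -2 * q.re * q.imI + 2 * q.imJ * q.imK;
      -2 * q.re * q.imJ + 2 * q.imI * q.imK,
        2 * q.re * q.imI + 2 * q.imJ * q.imK,
        q.re ^ 2 - q.imI ^ 2 - q.imJ ^ 2 + q.imK ^ 2] := by
  by_cases hq : q = 0
  · subst hq
    ext i j
    fin_cases i <;> fin_cases j <;> simp [conjMatrix]
  · have h0 : Quaternion.normSq q ≠ 0 := by simpa using hq
    rw [conjMatrix, cayleyMatrix, smul_smul, mul_inv_cancel₀ h0, one_smul]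

theorem pureQ_conjMatrix (q : ℍ[ℝ]) (x : Fin 3 → ℝ) :
    pureQ (conjMatrix q *ᵥ x) = q * pureQ x * star q := by
  ext <;> simp [conjMatrix_eq, dotProduct, Fin.sum_univ_three] <;> ring

theorem conjMatrix_mul (q r : ℍ[ℝ]) : conjMatrix (q * r) = conjMatrix q * conjMatrix r := by
  apply Matrix.toLin'.injective
  apply LinearMap.ext
  intro x
  apply pureQ_injective
  rw [Matrix.toLin'_apply, Matrix.toLin'_apply, ← Matrix.mulVec_mulVec, pureQ_conjMatrix,
    pureQ_conjMatrix, pureQ_conjMatrix, star_mul]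
  simp only [mul_assoc]

theorem cayleyMatrix_eq (q : ℍ[ℝ]) :
    cayleyMatrix q = (Quaternion.normSq q)⁻¹ • conjMatrix q := by
  rw [conjMatrix_eq, cayleyMatrix]

theorem cayleyMatrix_mul (q r : ℍ[ℝ]) :
    cayleyMatrix (q * r) = cayleyMatrix q * cayleyMatrix r := by
  rw [cayleyMatrix_eq, cayleyMatrix_eq q, cayleyMatrix_eq r, conjMatrix_mul, map_mul, mul_inv,
    Matrix.smul_mul, Matrix.mul_smul, smul_smul]

theorem conjMatrix_star (q : ℍ[ℝ]) : conjMatrix (star q) = (conjMatrix q)ᵀ := by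
  rw [conjMatrix_eq, conjMatrix_eq]
  ext i j
  fin_cases i <;> fin_cases j <;> simp

theorem cayleyMatrix_star (q : ℍ[ℝ]) : cayleyMatrix (star q) = (cayleyMatrix q)ᵀ := by
  rw [cayleyMatrix_eq, cayleyMatrix_eq, conjMatrix_star, Quaternion.normSq_star,
    Matrix.transpose_smul]

theorem cayleyMatrix_smul {r : ℝ} (hr : r ≠ 0) (q : ℍ[ℝ]) :
    cayleyMatrix (r • q) = cayleyMatrix q := by
  rw [cayleyMatrix_eq, cayleyMatrix_eq, Quaternion.normSq_smul, conjMatrix_eq, conjMatrix_eq,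
    mul_inv, mul_comm, ← smul_smul]
  congr 1
  have h : r ^ 2 ≠ 0 := pow_ne_zero 2 hr
  rw [inv_smul_eq_iff₀ h]
  ext i j
  fin_cases i <;> fin_cases j <;> simp <;> ring

/-! ### Images of lattices -/

theorem image_le_iff {d : ℕ} {A : Matrix (Fin d) (Fin d) ℝ} {Γ Λ : AddSubgroup (Fin d → ℝ)} :
    image A Γ ≤ Λ ↔ ∀ x ∈ Γ, A *ᵥ x ∈ Λ :=
  ⟨fun h _ hx => h ⟨_, hx, rfl⟩, by rintro h _ ⟨x, hx, rfl⟩; exact h x hx⟩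

theorem transpose_mul_self {d : ℕ} (R : Matrix.orthogonalGroup (Fin d) ℝ) : R.1ᵀ * R.1 = 1 :=
  (Matrix.mem_orthogonalGroup_iff' (Fin d) ℝ).1 R.2

theorem mul_transpose_self {d : ℕ} (R : Matrix.orthogonalGroup (Fin d) ℝ) : R.1 * R.1ᵀ = 1 :=
  (Matrix.mem_orthogonalGroup_iff (Fin d) ℝ).1 R.2

theorem inv_val_eq_transpose {d : ℕ} (R : Matrix.orthogonalGroup (Fin d) ℝ) :
    (R⁻¹).1 = R.1ᵀ := rfl

theorem mem_image_orthogonal_iff {d : ℕ} {R : Matrix.orthogonalGroup (Fin d) ℝ}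
    {Γ : AddSubgroup (Fin d → ℝ)} {x : Fin d → ℝ} :
    x ∈ image R.1 Γ ↔ R.1ᵀ *ᵥ x ∈ Γ := by
  constructor
  · rintro ⟨y, hy, rfl⟩
    change R.1ᵀ *ᵥ (R.1 *ᵥ y) ∈ Γ
    rwa [Matrix.mulVec_mulVec, transpose_mul_self, Matrix.one_mulVec]
  · intro h
    exact ⟨_, h, by
      change R.1 *ᵥ (R.1ᵀ *ᵥ x) = x
      rw [Matrix.mulVec_mulVec, mul_transpose_self, Matrix.one_mulVec]⟩

theorem mem_symmetryGroup_of_le {d : ℕ} {R : Matrix.orthogonalGroup (Fin d) ℝ}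
    {Γ : AddSubgroup (Fin d → ℝ)} (h : ∀ x ∈ Γ, R.1 *ᵥ x ∈ Γ) (h' : ∀ x ∈ Γ, R.1ᵀ *ᵥ x ∈ Γ) :
    R ∈ symmetryGroup Γ := by
  change image R.1 Γ = Γ
  apply le_antisymm (image_le_iff.2 h)
  intro x hx
  exact mem_image_orthogonal_iff.2 (h' x hx)

theorem image_mul_symmetry {d : ℕ} {R S : Matrix.orthogonalGroup (Fin d) ℝ}
    {Γ : AddSubgroup (Fin d → ℝ)} (hS : S ∈ symmetryGroup Γ) :
    image (R * S).1 Γ = image R.1 Γ := by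
  have h : image S.1 Γ = Γ := hS
  rw [show (R * S).1 = R.1 * S.1 from rfl, image_mul, h]

/-! ### Cubic lattices -/

/-- The quaternion `1 + i`, whose rotation is a quarter turn. -/
def oneAddI : ℍ[ℝ] := ⟨1, 1, 0, 0⟩

@[simp] theorem oneAddI_re : oneAddI.re = 1 := rfl
@[simp] theorem oneAddI_imI : oneAddI.imI = 1 := rfl
@[simp] theorem oneAddI_imJ : oneAddI.imJ = 0 := rfl
@[simp] theorem oneAddI_imK : oneAddI.imK = 0 := rfl

theorem normSq_oneAddI : Quaternion.normSq oneAddI = 2 := by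
  norm_num [Quaternion.normSq_def']

theorem oneAddI_ne_zero : oneAddI ≠ 0 := by
  rw [← Quaternion.normSq_ne_zero, normSq_oneAddI]
  norm_num

theorem oneAddI_mem_hurwitz : oneAddI ∈ hurwitz :=
  Or.inl ⟨1, 1, 0, 0, by simp⟩

theorem cayleyMatrix_oneAddI : cayleyMatrix oneAddI = !![1, 0, 0; 0, 0, -1; 0, 1, 0] := by
  rw [cayleyMatrix_eq, conjMatrix_eq, normSq_oneAddI]
  ext i j
  fin_cases i <;> fin_cases j <;> norm_num

theorem quarterTurn_mulVec (x : Fin 3 → ℝ) :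
    cayleyMatrix oneAddI *ᵥ x = ![x 0, -x 2, x 1] := by
  rw [cayleyMatrix_oneAddI]
  ext i
  fin_cases i <;> simp [dotProduct, Fin.sum_univ_three]

/-- The properties shared by the three cubic lattices from which the theory is developed. -/
structure IsCubic (Γ : AddSubgroup (Fin 3 → ℝ)) : Prop where
  two_smul_mem : ∀ x ∈ pc, (2 : ℝ) • x ∈ Γ
  two_smul_mem_pc : ∀ x ∈ Γ, (2 : ℝ) • x ∈ pc
  conjMatrix_mem : ∀ q ∈ hurwitz, ∀ x ∈ Γ, conjMatrix q *ᵥ x ∈ Γ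
  -- Not a case of the preceding field: 1 + i has norm 2, so its `conjMatrix` is only twice the
  -- quarter turn.
  quarterTurn_mem : ∀ x ∈ Γ, cayleyMatrix oneAddI *ᵥ x ∈ Γ
  -- Serves the lower bound for the denominator.
  exists_int_of_smul : ∀ s : ℝ, (∀ x ∈ Γ, s • x ∈ Γ) → ∃ k : ℤ, s = k

theorem conjMatrix_mem_pc {q : ℍ[ℝ]} (hq : q ∈ hurwitz) {x : Fin 3 → ℝ} (hx : x ∈ pc) :
    conjMatrix q *ᵥ x ∈ pc := by
  rw [← pureQ_mem_hurwitz_iff, pureQ_conjMatrix]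
  exact mul_mem (mul_mem hq (pureQ_mem_hurwitz_iff.2 hx)) (star_mem_hurwitz hq)

theorem conjMatrix_mem_bcc {q : ℍ[ℝ]} (hq : q ∈ hurwitz) {x : Fin 3 → ℝ} (hx : x ∈ bcc) :
    conjMatrix q *ᵥ x ∈ bcc := by
  obtain ⟨r, hr, hx⟩ := mem_bcc_iff.1 hx
  refine mem_bcc_iff.2 ⟨q * r * star q, mul_mem (mul_mem hq hr) (star_mem_hurwitz hq), ?_⟩
  rw [pureQ_conjMatrix, ← hx]
  ext <;> simp <;> ring

theorem quarterTurn_mem_bcc {x : Fin 3 → ℝ} (hx : x ∈ bcc) :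
    cayleyMatrix oneAddI *ᵥ x ∈ bcc := by
  rw [quarterTurn_mulVec]
  rcases hx with ⟨a, ha⟩ | ⟨a, ha⟩
  · refine Or.inl ⟨![a 0, -a 2, a 1], fun i => ?_⟩
    fin_cases i <;> simp [ha]
  · refine Or.inr ⟨![a 0, -a 2 - 1, a 1], fun i => ?_⟩
    fin_cases i <;> simp [ha]
    ring

theorem isCubic_pc : IsCubic pc where
  two_smul_mem := by
    rintro x ⟨a, ha⟩
    exact ⟨2 * a, fun i => by simp [ha]⟩
  two_smul_mem_pc := by
    rintro x ⟨a, ha⟩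
    exact ⟨2 * a, fun i => by simp [ha]⟩
  conjMatrix_mem q hq x hx := conjMatrix_mem_pc hq hx
  quarterTurn_mem := by
    rintro x ⟨a, ha⟩
    rw [quarterTurn_mulVec]
    refine ⟨![a 0, -a 2, a 1], fun i => ?_⟩
    fin_cases i <;> simp [ha]
  exists_int_of_smul := by
    intro s hs
    obtain ⟨a, ha⟩ := hs ![1, 0, 0] ⟨![1, 0, 0], fun i => by fin_cases i <;> simp⟩
    exact ⟨a 0, by simpa using ha 0⟩

theorem isCubic_bcc : IsCubic bcc where
  two_smul_mem := by
    rintro x ⟨a, ha⟩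
    exact Or.inl ⟨2 * a, fun i => by simp [ha]⟩
  two_smul_mem_pc := by
    rintro x (⟨a, ha⟩ | ⟨a, ha⟩)
    · exact ⟨2 * a, fun i => by simp [ha]⟩
    · exact ⟨2 * a + 1, fun i => by simp [ha]; ring⟩
  conjMatrix_mem q hq x hx := conjMatrix_mem_bcc hq hx
  quarterTurn_mem x hx := quarterTurn_mem_bcc hx
  exists_int_of_smul := by
    intro s hs
    obtain ⟨a, ha⟩ | ⟨a, ha⟩ :=
      hs ![1, 0, 0] (Or.inl ⟨![1, 0, 0], fun i => by fin_cases i <;> simp⟩)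
    · exact ⟨a 0, by simpa using ha 0⟩
    · exfalso
      have h1 := ha 1
      simp only [Pi.smul_apply, Matrix.cons_val_one, Matrix.cons_val_zero, smul_zero] at h1
      have : (2 * a 1 + 1 : ℤ) = 0 := by
        have : ((2 * a 1 + 1 : ℤ) : ℝ) = 0 := by push_cast; linarith
        exact_mod_cast this
      omega

theorem fcc_le_pc : fcc ≤ pc := by
  intro x hx
  have key : ∀ i, ∃ k : ℤ, x i = k := by
    intro i
    obtain ⟨k, hk⟩ := hx (Pi.single i 1) (Or.inl ⟨Pi.single i 1, fun j => by
      by_cases h : j = i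
      · subst h; simp
      · simp [h]⟩)
    exact ⟨k, by simpa using hk⟩
  choose a ha using key
  exact ⟨a, ha⟩

/-- The quarter turn has order four, so its inverse is its cube; a lattice stable under the turn is
then stable under the inverse. -/
theorem transpose_quarterTurn :
    (cayleyMatrix oneAddI)ᵀ =
      cayleyMatrix oneAddI * (cayleyMatrix oneAddI * cayleyMatrix oneAddI) := by
  rw [cayleyMatrix_oneAddI]
  ext i j
  fin_cases i <;> fin_cases j <;> simp [Matrix.mul_apply, Fin.sum_univ_three]

theorem transpose_quarterTurn_mem {Γ : AddSubgroup (Fin 3 → ℝ)} (hΓ : ∀ x ∈ Γ,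
    cayleyMatrix oneAddI *ᵥ x ∈ Γ) {x : Fin 3 → ℝ} (hx : x ∈ Γ) :
    (cayleyMatrix oneAddI)ᵀ *ᵥ x ∈ Γ := by
  rw [transpose_quarterTurn, ← Matrix.mulVec_mulVec, ← Matrix.mulVec_mulVec]
  exact hΓ _ (hΓ _ (hΓ _ hx))

/-- Adjointness: ⟨Ax, y⟩ = ⟨x, Aᵀy⟩, so stability passes to the dual lattice under the transpose. -/
theorem mulVec_mem_fcc {A : Matrix (Fin 3) (Fin 3) ℝ} (hA : ∀ y ∈ bcc, Aᵀ *ᵥ y ∈ bcc)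
    {x : Fin 3 → ℝ} (hx : x ∈ fcc) : A *ᵥ x ∈ fcc := by
  intro y hy
  obtain ⟨k, hk⟩ := hx _ (hA y hy)
  exact ⟨k, by rw [← hk, Matrix.mulVec_transpose, dotProduct_comm, Matrix.dotProduct_mulVec,
    dotProduct_comm]⟩

theorem isCubic_fcc : IsCubic fcc where
  two_smul_mem := by
    rintro x ⟨a, ha⟩ y hy
    obtain ⟨b, hb⟩ := isCubic_bcc.two_smul_mem_pc y hy
    refine ⟨a ⬝ᵥ b, ?_⟩
    rw [smul_dotProduct, ← dotProduct_smul]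
    simp [dotProduct, Fin.sum_univ_three, ha, ← hb]
  two_smul_mem_pc x hx := isCubic_pc.two_smul_mem x (fcc_le_pc hx)
  conjMatrix_mem q hq x hx := by
    apply mulVec_mem_fcc _ hx
    rw [← conjMatrix_star]
    exact fun y hy => conjMatrix_mem_bcc (star_mem_hurwitz hq) hy
  quarterTurn_mem x hx :=
    mulVec_mem_fcc (fun y hy => transpose_quarterTurn_mem (fun _ => quarterTurn_mem_bcc) hy) hx
  exists_int_of_smul := by
    intro s hs
    -- The unit vectors are not in fcc, but this vector also has a coordinate 1, from which s can be
    -- read off.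
    have h : ![1, 1, 0] ∈ fcc := by
      rintro y (⟨a, ha⟩ | ⟨a, ha⟩)
      · exact ⟨a 0 + a 1, by simp [dotProduct, Fin.sum_univ_three, ha]⟩
      · exact ⟨a 0 + a 1 + 1, by simp [dotProduct, Fin.sum_univ_three, ha]; ring⟩
    obtain ⟨a, ha⟩ := fcc_le_pc (hs _ h)
    exact ⟨a 0, by simpa using ha 0⟩

/-- The real quaternion with given components. -/
def quat (a b c d : ℝ) : ℍ[ℝ] := ⟨a, b, c, d⟩

@[simp] theorem quat_re (a b c d : ℝ) : (quat a b c d).re = a := rfl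
@[simp] theorem quat_imI (a b c d : ℝ) : (quat a b c d).imI = b := rfl
@[simp] theorem quat_imJ (a b c d : ℝ) : (quat a b c d).imJ = c := rfl
@[simp] theorem quat_imK (a b c d : ℝ) : (quat a b c d).imK = d := rfl

/-! ### Arithmetic of the Hurwitz ring -/

/-- Rounding each component leaves an error of square at most 1/4. The sum can reach 1 only if all
four components are half-integers, and then a is itself a Hurwitz quaternion. This makes J
Euclidean. -/
theorem exists_hurwitz_normSq_sub_lt_one (a : ℍ[ℝ]) :
    ∃ h ∈ hurwitz, Quaternion.normSq (a - h) < 1 := by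
  have hr : ∀ x : ℝ, (x - round x) ^ 2 ≤ 1 / 4 := fun x => by
    have := abs_sub_round x
    rw [← sq_abs]
    nlinarith [abs_nonneg (x - round x)]
  have key : ∀ x : ℝ, 1 / 4 ≤ (x - round x) ^ 2 → ∃ k : ℤ, x = 1 / 2 + k := fun x hx => by
    have h : (x - round x - 1 / 2) * (x - round x + 1 / 2) = 0 := by linarith [hr x]
    rcases mul_eq_zero.1 h with h | h
    · exact ⟨round x, by linarith⟩
    · exact ⟨round x - 1, by push_cast; linarith⟩
  let h : ℍ[ℝ] := quat (round a.re) (round a.imI) (round a.imJ) (round a.imK)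
  have hh : Quaternion.normSq (a - h) = (a.re - round a.re) ^ 2 + (a.imI - round a.imI) ^ 2 +
      (a.imJ - round a.imJ) ^ 2 + (a.imK - round a.imK) ^ 2 := Quaternion.normSq_def' _
  by_cases hlt : Quaternion.normSq (a - h) < 1
  · exact ⟨h, mem_hurwitz_of_components rfl rfl rfl rfl, hlt⟩
  · rw [hh, not_lt] at hlt
    have h0 := hr a.re
    have h1 := hr a.imI
    have h2 := hr a.imJ
    have h3 := hr a.imK
    obtain ⟨k0, k0h⟩ := key a.re (by linarith)
    obtain ⟨k1, k1h⟩ := key a.imI (by linarith)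
    obtain ⟨k2, k2h⟩ := key a.imJ (by linarith)
    obtain ⟨k3, k3h⟩ := key a.imK (by linarith)
    exact ⟨a, Or.inr ⟨k0, k1, k2, k3, k0h, k1h, k2h, k3h⟩, by simp⟩

/-- Every nonzero right ideal of the Hurwitz ring is principal. -/
theorem exists_generator_of_right_ideal (I : AddSubgroup ℍ[ℝ]) (hI : ∀ x ∈ I, x ∈ hurwitz)
    (hmul : ∀ x ∈ I, ∀ y ∈ hurwitz, x * y ∈ I) (hne : ∃ x ∈ I, x ≠ 0) :
    ∃ q ∈ I, q ≠ 0 ∧ ∀ x ∈ I, ∃ y ∈ hurwitz, x = q * y := by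
  classical
  have hex : ∃ N : ℕ, ∃ x ∈ I, x ≠ 0 ∧ Quaternion.normSq x = N := by
    obtain ⟨x, hx, h0⟩ := hne
    obtain ⟨N, hN⟩ := exists_normSq_eq_natCast (hI x hx)
    exact ⟨N, x, hx, h0, hN⟩
  obtain ⟨q, hq, hq0, hqN⟩ := Nat.find_spec hex
  refine ⟨q, hq, hq0, fun x hx => ?_⟩
  -- Division with remainder: a nonzero remainder x - q h lies in I and has smaller norm than the
  -- minimal q.
  obtain ⟨h, hh, hlt⟩ := exists_hurwitz_normSq_sub_lt_one (q⁻¹ * x)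
  refine ⟨h, hh, ?_⟩
  by_contra hne'
  have hmem : x - q * h ∈ I := I.sub_mem hx (hmul q hq h hh)
  have hne'' : x - q * h ≠ 0 := sub_ne_zero.2 hne'
  obtain ⟨N, hN⟩ := exists_normSq_eq_natCast (hI _ hmem)
  have hmin := Nat.find_min' hex ⟨_, hmem, hne'', hN⟩
  have hfac : x - q * h = q * (q⁻¹ * x - h) := by
    rw [mul_sub, mul_inv_cancel_left₀ hq0]
  have hpos : 0 < Quaternion.normSq q :=
    lt_of_le_of_ne Quaternion.normSq_nonneg (Quaternion.normSq_ne_zero.2 hq0).symm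
  have : Quaternion.normSq (x - q * h) < Quaternion.normSq q := by
    rw [hfac, map_mul]
    nlinarith
  rw [hN, hqN] at this
  exact absurd hmin (not_le.2 (by exact_mod_cast this))

/-- The quotient is h(1 - i)/2. A half-integral h has odd norm, so h has integer components a, b, e,
f. The even sum of squares gives a + b and e + f the same parity, and the quotient is integral or
half-integral accordingly. -/
theorem exists_eq_mul_oneAddI {h : ℍ[ℝ]} (hh : h ∈ hurwitz) {N : ℕ}
    (hN : Quaternion.normSq h = N) (heven : Even N) : ∃ r ∈ hurwitz, h = r * oneAddI := by
  rcases hh with ⟨a, b, e, f, h0, h1, h2, h3⟩ | ⟨a, b, e, f, h0, h1, h2, h3⟩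
  · have hZ : (N : ℤ) = a ^ 2 + b ^ 2 + e ^ 2 + f ^ 2 := by
      have : ((N : ℤ) : ℝ) = ((a ^ 2 + b ^ 2 + e ^ 2 + f ^ 2 : ℤ) : ℝ) := by
        push_cast
        rw [← hN, Quaternion.normSq_def', h0, h1, h2, h3]
      exact_mod_cast this
    have hev : Even (a ^ 2 + b ^ 2 + e ^ 2 + f ^ 2) := hZ ▸ (by exact_mod_cast heven)
    refine ⟨quat ((a + b) / 2) ((b - a) / 2) ((e - f) / 2) ((e + f) / 2), ?_, ?_⟩
    · obtain ⟨k, hk | hk⟩ := Int.even_or_odd' (a + b)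
      · obtain ⟨l, hl⟩ : ∃ l, e + f = 2 * l := by
          have : Even (e + f) := by
            have hab : Even (a + b) := ⟨k, by omega⟩
            revert hev hab
            simp only [Int.even_add, Int.even_pow]
            tauto
          obtain ⟨l, hl⟩ := this
          exact ⟨l, by omega⟩
        have hk' := congrArg (Int.cast (R := ℝ)) hk
        have hl' := congrArg (Int.cast (R := ℝ)) hl
        push_cast at hk' hl'
        refine Or.inl ⟨k, k - a, l - f, l, ?_, ?_, ?_, ?_⟩ <;> push_cast <;>
          simp only [quat_re, quat_imI, quat_imJ, quat_imK] <;> linarith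
      · obtain ⟨l, hl⟩ : ∃ l, e + f = 2 * l + 1 := by
          have : Odd (e + f) := by
            have hab : ¬ Even (a + b) := by rw [Int.not_even_iff_odd]; exact ⟨k, hk⟩
            rw [← Int.not_even_iff_odd]
            revert hev hab
            simp only [Int.even_add, Int.even_pow]
            tauto
          exact this
        have hk' := congrArg (Int.cast (R := ℝ)) hk
        have hl' := congrArg (Int.cast (R := ℝ)) hl
        push_cast at hk' hl'
        refine Or.inr ⟨k, k - a, l - f, l, ?_, ?_, ?_, ?_⟩ <;> push_cast <;>
          simp only [quat_re, quat_imI, quat_imJ, quat_imK] <;> linarith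
    · ext <;> simp [h0, h1, h2, h3] <;> ring
  · exfalso
    obtain ⟨k, hk⟩ := exists_normSq_of_half h0 h1 h2 h3
    rw [hN] at hk
    have hk' : (N : ℤ) = 2 * k + 1 := by exact_mod_cast hk
    obtain ⟨m, hm⟩ := heven
    omega

theorem normSq_pos_of_ne_zero {q : ℍ[ℝ]} (hq : q ≠ 0) : 0 < Quaternion.normSq q :=
  lt_of_le_of_ne Quaternion.normSq_nonneg (Quaternion.normSq_ne_zero.2 hq).symm

theorem pos_of_normSq_eq {q : ℍ[ℝ]} (hq : q ≠ 0) {N : ℕ} (hN : Quaternion.normSq q = N) :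
    0 < N := by
  have h := normSq_pos_of_ne_zero hq
  rw [hN] at h
  exact_mod_cast h

theorem exists_odd_mul_oneAddI_pow {h : ℍ[ℝ]} (hh : h ∈ hurwitz) (h0 : h ≠ 0) :
    ∃ (ℓ : ℕ) (r : ℍ[ℝ]) (n : ℕ), r ∈ hurwitz ∧ h = r * oneAddI ^ ℓ ∧
      Quaternion.normSq r = n ∧ Odd n := by
  obtain ⟨N, hN⟩ := exists_normSq_eq_natCast hh
  induction N using Nat.strong_induction_on generalizing h with
  | _ N ih =>
    rcases Nat.even_or_odd N with hev | hodd
    · obtain ⟨r, hr, rfl⟩ := exists_eq_mul_oneAddI hh hN hev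
      obtain ⟨M, hM⟩ := exists_normSq_eq_natCast hr
      have hr0 : r ≠ 0 := left_ne_zero_of_mul h0
      have hMN : M * 2 = N := by
        rw [map_mul, hM, normSq_oneAddI] at hN
        exact_mod_cast hN
      have hMpos : 0 < M := pos_of_normSq_eq hr0 hM
      obtain ⟨ℓ, s, n, hs, hrs, hn, hodd⟩ := ih M (by omega) hr hr0 hM
      exact ⟨ℓ + 1, s, n, hs, by rw [hrs, pow_succ, mul_assoc], hn, hodd⟩
    · exact ⟨0, h, N, hh, by simp, hN, hodd⟩

theorem inv_smul_mul (k : ℕ) (q r : ℍ[ℝ]) : (k : ℝ)⁻¹ • (q * r) = ((k : ℝ)⁻¹ • q) * r :=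
  (smul_mul_assoc _ _ _).symm

theorem IsPrimitive.of_mul_right {q r : ℍ[ℝ]} (h : IsPrimitive (q * r)) (hq : q ∈ hurwitz)
    (hr : r ∈ hurwitz) : IsPrimitive q :=
  ⟨hq, fun k hk hkq => h.2 k hk (by rw [inv_smul_mul]; exact mul_mem hkq hr)⟩

theorem exists_primitive_smul {h : ℍ[ℝ]} (hh : h ∈ hurwitz) (h0 : h ≠ 0) :
    ∃ (d : ℕ) (q : ℍ[ℝ]), 0 < d ∧ IsPrimitive q ∧ h = (d : ℝ) • q := by
  obtain ⟨N, hN⟩ := exists_normSq_eq_natCast hh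
  induction N using Nat.strong_induction_on generalizing h with
  | _ N ih =>
    by_cases hp : IsPrimitive h
    · exact ⟨1, h, one_pos, hp, by simp⟩
    · have : ∃ n : ℕ, 0 < n ∧ ((n : ℝ)⁻¹ • h) ∈ hurwitz ∧ n ≠ 1 := by
        by_contra hcon
        push Not at hcon
        exact hp ⟨hh, hcon⟩
      obtain ⟨n, hn, hmem, hn1⟩ := this
      have hnR : (n : ℝ) ≠ 0 := by positivity
      have h0' : (n : ℝ)⁻¹ • h ≠ 0 := smul_ne_zero (inv_ne_zero hnR) h0
      obtain ⟨M, hM⟩ := exists_normSq_eq_natCast hmem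
      have hMpos := pos_of_normSq_eq h0' hM
      have hMN : N = n ^ 2 * M := by
        have : (N : ℝ) = (n : ℝ) ^ 2 * M := by
          rw [← hM, Quaternion.normSq_smul, hN]
          field_simp
        exact_mod_cast this
      have hlt : M < N := by
        rw [hMN]
        have h4 : 2 ^ 2 ≤ n ^ 2 := Nat.pow_le_pow_left (by omega) 2
        nlinarith
      obtain ⟨d, q, hd, hq, hdq⟩ := ih M hlt hmem h0' hM
      refine ⟨n * d, q, by positivity, hq, ?_⟩
      rw [Nat.cast_mul, mul_smul, ← hdq, smul_inv_smul₀ hnR]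

theorem mul_star_of_normSq_eq {q : ℍ[ℝ]} {n : ℕ} (hn : Quaternion.normSq q = n) (x : ℍ[ℝ]) :
    q * (star q * x) = (n : ℝ) • x := by
  rw [← mul_assoc, Quaternion.self_mul_star, hn, Quaternion.coe_mul_eq_smul]

theorem star_mul_of_normSq_eq {q : ℍ[ℝ]} {n : ℕ} (hn : Quaternion.normSq q = n) (x : ℍ[ℝ]) :
    star q * (q * x) = (n : ℝ) • x := by
  rw [← mul_assoc, Quaternion.star_mul_self, hn, Quaternion.coe_mul_eq_smul]

/-! ### Rotations that are symmetries of every cubic lattice -/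

theorem rotation_mul {q r : ℍ[ℝ]} (hq : q ≠ 0) (hr : r ≠ 0) :
    rotation (q * r) (mul_ne_zero hq hr) = rotation q hq * rotation r hr :=
  Subtype.ext (cayleyMatrix_mul q r)

theorem IsCubic.rotation_oneAddI_mem {Γ : AddSubgroup (Fin 3 → ℝ)} (hΓ : IsCubic Γ) :
    rotation oneAddI oneAddI_ne_zero ∈ symmetryGroup Γ :=
  mem_symmetryGroup_of_le hΓ.quarterTurn_mem
    fun _ hx => transpose_quarterTurn_mem hΓ.quarterTurn_mem hx

theorem cayleyMatrix_oneAddI_pow (ℓ : ℕ) :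
    cayleyMatrix (oneAddI ^ ℓ) = (rotation oneAddI oneAddI_ne_zero ^ ℓ).1 := by
  induction ℓ with
  | zero =>
    change cayleyMatrix (oneAddI ^ 0) = 1
    rw [pow_zero, cayleyMatrix_eq, conjMatrix_eq]
    ext i j
    fin_cases i <;> fin_cases j <;> simp
  | succ ℓ ih =>
    rw [pow_succ, cayleyMatrix_mul, ih, pow_succ]
    rfl

theorem rotation_mul_oneAddI_pow {q : ℍ[ℝ]} (hq : q ≠ 0) (ℓ : ℕ)
    (h : q * oneAddI ^ ℓ ≠ 0) : rotation (q * oneAddI ^ ℓ) h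
      = rotation q hq * rotation oneAddI oneAddI_ne_zero ^ ℓ := by
  apply Subtype.ext
  change cayleyMatrix (q * oneAddI ^ ℓ) = cayleyMatrix q * _
  rw [cayleyMatrix_mul, cayleyMatrix_oneAddI_pow]

theorem neg_one_mem_symmetryGroup {Γ : AddSubgroup (Fin 3 → ℝ)} :
    (-1 : Matrix.orthogonalGroup (Fin 3) ℝ) ∈ symmetryGroup Γ :=
  mem_symmetryGroup_of_le
    (fun x hx => by
      change (-1 : Matrix (Fin 3) (Fin 3) ℝ) *ᵥ x ∈ Γ
      simpa [Matrix.neg_mulVec] using hx)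
    (fun x hx => by
      change (-1 : Matrix (Fin 3) (Fin 3) ℝ)ᵀ *ᵥ x ∈ Γ
      simpa [Matrix.neg_mulVec] using hx)

theorem conjMatrix_of_normSq_eq_one {u : ℍ[ℝ]} (hu : Quaternion.normSq u = 1) :
    conjMatrix u = cayleyMatrix u := by
  rw [conjMatrix, hu, one_smul]

theorem IsCubic.rotation_unit_mem {Γ : AddSubgroup (Fin 3 → ℝ)} (hΓ : IsCubic Γ) {u : ℍ[ℝ]}
    (hu : u ∈ hurwitz) (hN : Quaternion.normSq u = 1) (h0 : u ≠ 0) :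
    rotation u h0 ∈ symmetryGroup Γ := by
  refine mem_symmetryGroup_of_le (fun x hx => ?_) (fun x hx => ?_)
  · change cayleyMatrix u *ᵥ x ∈ Γ
    rw [← conjMatrix_of_normSq_eq_one hN]
    exact hΓ.conjMatrix_mem u hu x hx
  · change (cayleyMatrix u)ᵀ *ᵥ x ∈ Γ
    rw [← conjMatrix_of_normSq_eq_one hN, ← conjMatrix_star]
    exact hΓ.conjMatrix_mem _ (star_mem_hurwitz hu) x hx

/-! ### Rational rotations come from Hurwitz quaternions -/

/-- The symmetric matrix, linear in `M`, that equals `4 q qᵀ` if `M` is the rotation given by the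
unit quaternion `q`. -/
def davenportMatrix (M : Matrix (Fin 3) (Fin 3) ℚ) : Matrix (Fin 4) (Fin 4) ℚ :=
  !![1 + M 0 0 + M 1 1 + M 2 2, M 2 1 - M 1 2, M 0 2 - M 2 0, M 1 0 - M 0 1;
    M 2 1 - M 1 2, 1 + M 0 0 - M 1 1 - M 2 2, M 0 1 + M 1 0, M 0 2 + M 2 0;
    M 0 2 - M 2 0, M 0 1 + M 1 0, 1 - M 0 0 + M 1 1 - M 2 2, M 1 2 + M 2 1;
    M 1 0 - M 0 1, M 0 2 + M 2 0, M 1 2 + M 2 1, 1 - M 0 0 - M 1 1 + M 2 2]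

/-- Expresses that the matrix has rank at most one, as 4qqᵀ has. Each identity is a linear
combination of entries of MMᵀ = 1, MᵀM = 1 and adj M = Mᵀ; the last one encodes det M = 1. -/
theorem davenportMatrix_mul_apply {M : Matrix (Fin 3) (Fin 3) ℚ} (h1 : M * Mᵀ = 1)
    (h2 : Mᵀ * M = 1) (h3 : M.adjugate = Mᵀ) (i j k : Fin 4) :
    davenportMatrix M i k * davenportMatrix M j k
      = davenportMatrix M k k * davenportMatrix M i j := by
  have e1 : ∀ i j, (M * Mᵀ) i j = (1 : Matrix (Fin 3) (Fin 3) ℚ) i j := fun i j => by rw [h1]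
  have e2 : ∀ i j, (Mᵀ * M) i j = (1 : Matrix (Fin 3) (Fin 3) ℚ) i j := fun i j => by rw [h2]
  have e3 : ∀ i j, M.adjugate i j = Mᵀ i j := fun i j => by rw [h3]
  rw [Matrix.adjugate_fin_three] at e3
  simp only [Matrix.mul_apply, Fin.sum_univ_three, Matrix.transpose_apply, Matrix.one_apply]
    at e1 e2
  have a00 := e1 0 0; have a01 := e1 0 1; have a02 := e1 0 2
  have a11 := e1 1 1; have a12 := e1 1 2; have a22 := e1 2 2
  have b00 := e2 0 0; have b01 := e2 0 1; have b02 := e2 0 2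
  have b11 := e2 1 1; have b12 := e2 1 2; have b22 := e2 2 2
  have c00 := e3 0 0; have c01 := e3 0 1; have c02 := e3 0 2
  have c10 := e3 1 0; have c11 := e3 1 1; have c12 := e3 1 2
  have c20 := e3 2 0; have c21 := e3 2 1; have c22 := e3 2 2
  clear e1 e2 e3
  simp at a00 a01 a02 a11 a12 a22 b00 b01 b02 b11 b12 b22 c00 c01 c02 c10 c11 c12 c20 c21 c22
  fin_cases i <;> fin_cases j <;> fin_cases k <;> simp [davenportMatrix] <;> linarith

/-- The trace of the Davenport matrix K is 4, so some diagonal entry K k k is nonzero. By the rank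
one relations the k-th column is then a multiple of the quaternion sought, with norm 4 K k k. -/
theorem exists_quaternion_of_special {M : Matrix (Fin 3) (Fin 3) ℚ} (h1 : M * Mᵀ = 1)
    (h2 : Mᵀ * M = 1) (hdet : M.det = 1) :
    ∃ a b c d : ℚ, quat a b c d ≠ 0 ∧
      cayleyMatrix (quat a b c d) = M.map (fun x : ℚ => (x : ℝ)) := by
  have h3 : M.adjugate = Mᵀ := by
    have h := Matrix.mul_adjugate M
    rw [hdet, one_smul] at h
    calc M.adjugate = (Mᵀ * M) * M.adjugate := by rw [h2, one_mul]
      _ = Mᵀ := by rw [Matrix.mul_assoc, h, mul_one]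
  have key := davenportMatrix_mul_apply h1 h2 h3
  obtain ⟨k, hk⟩ : ∃ k, davenportMatrix M k k ≠ 0 := by
    by_contra hcon
    push Not at hcon
    have := hcon 0; have := hcon 1; have := hcon 2; have := hcon 3
    simp [davenportMatrix] at *
    linarith
  set K := davenportMatrix M with hK
  have hKk : (K k k : ℝ) ≠ 0 := by exact_mod_cast hk
  have keyR : ∀ i j, (K i k : ℝ) * K j k = K k k * K i j := fun i j => by exact_mod_cast key i j k
  let q : ℍ[ℝ] := quat (K 0 k) (K 1 k) (K 2 k) (K 3 k)
  have htr : (K 0 0 + K 1 1 + K 2 2 + K 3 3 : ℝ) = 4 := by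
    have : K 0 0 + K 1 1 + K 2 2 + K 3 3 = 4 := by
      simp [hK, davenportMatrix]
      ring
    exact_mod_cast this
  have hN : Quaternion.normSq q = 4 * K k k := by
    have : Quaternion.normSq q = K 0 k ^ 2 + K 1 k ^ 2 + K 2 k ^ 2 + K 3 k ^ 2 :=
      Quaternion.normSq_def' _
    rw [this, ← htr]
    linear_combination keyR 0 0 + keyR 1 1 + keyR 2 2 + keyR 3 3
  have hN0 : Quaternion.normSq q ≠ 0 := by
    rw [hN]
    exact mul_ne_zero four_ne_zero hKk
  refine ⟨K 0 k, K 1 k, K 2 k, K 3 k, Quaternion.normSq_ne_zero.1 hN0, ?_⟩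
  change cayleyMatrix q = _
  rw [cayleyMatrix_eq, inv_smul_eq_iff₀ hN0, hN, conjMatrix_eq]
  have r0 : q.re = K 0 k := rfl
  have r1 : q.imI = K 1 k := rfl
  have r2 : q.imJ = K 2 k := rfl
  have r3 : q.imK = K 3 k := rfl
  rw [r0, r1, r2, r3]
  have k00 := keyR 0 0; have k01 := keyR 0 1; have k02 := keyR 0 2; have k03 := keyR 0 3
  have k11 := keyR 1 1; have k12 := keyR 1 2; have k13 := keyR 1 3
  have k22 := keyR 2 2; have k23 := keyR 2 3; have k33 := keyR 3 3
  have l00 : (K 0 0 : ℝ) = 1 + M 0 0 + M 1 1 + M 2 2 := by simp [hK, davenportMatrix]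
  have l01 : (K 0 1 : ℝ) = M 2 1 - M 1 2 := by simp [hK, davenportMatrix]
  have l02 : (K 0 2 : ℝ) = M 0 2 - M 2 0 := by simp [hK, davenportMatrix]
  have l03 : (K 0 3 : ℝ) = M 1 0 - M 0 1 := by simp [hK, davenportMatrix]
  have l11 : (K 1 1 : ℝ) = 1 + M 0 0 - M 1 1 - M 2 2 := by simp [hK, davenportMatrix]
  have l12 : (K 1 2 : ℝ) = M 0 1 + M 1 0 := by simp [hK, davenportMatrix]
  have l13 : (K 1 3 : ℝ) = M 0 2 + M 2 0 := by simp [hK, davenportMatrix]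
  have l22 : (K 2 2 : ℝ) = 1 - M 0 0 + M 1 1 - M 2 2 := by simp [hK, davenportMatrix]
  have l23 : (K 2 3 : ℝ) = M 1 2 + M 2 1 := by simp [hK, davenportMatrix]
  have l33 : (K 3 3 : ℝ) = 1 - M 0 0 - M 1 1 + M 2 2 := by simp [hK, davenportMatrix]
  rw [l00] at k00; rw [l01] at k01; rw [l02] at k02; rw [l03] at k03; rw [l11] at k11
  rw [l12] at k12; rw [l13] at k13; rw [l22] at k22; rw [l23] at k23; rw [l33] at k33
  ext i j
  fin_cases i <;> fin_cases j <;> simp <;> linarith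

theorem mul_prod_den_eq_int (a b c d : ℚ) : ∃ D : ℕ, 0 < D ∧ ∃ a' b' c' d' : ℤ,
    (D : ℝ) * a = a' ∧ (D : ℝ) * b = b' ∧ (D : ℝ) * c = c' ∧ (D : ℝ) * d = d' := by
  have h : ∀ x : ℚ, (x.den : ℝ) * x = x.num := fun x => by exact_mod_cast Rat.den_mul_eq_num x
  refine ⟨a.den * b.den * c.den * d.den, by positivity, a.num * b.den * c.den * d.den,
    b.num * a.den * c.den * d.den, c.num * a.den * b.den * d.den, d.num * a.den * b.den * c.den,
    ?_, ?_, ?_, ?_⟩ <;> push_cast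
  · rw [← h a]; ring
  · rw [← h b]; ring
  · rw [← h c]; ring
  · rw [← h d]; ring

theorem exists_primitive_of_special {M : Matrix (Fin 3) (Fin 3) ℚ} (h1 : M * Mᵀ = 1)
    (h2 : Mᵀ * M = 1) (hdet : M.det = 1) : ∃ q : ℍ[ℝ], IsPrimitive q ∧
      cayleyMatrix q = M.map (fun x : ℚ => (x : ℝ)) := by
  obtain ⟨a, b, c, d, h0, hM⟩ := exists_quaternion_of_special h1 h2 hdet
  obtain ⟨D, hD, a', b', c', d', ha, hb, hc, hd⟩ := mul_prod_den_eq_int a b c d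
  have hDR : (D : ℝ) ≠ 0 := by positivity
  obtain ⟨e, q, he, hq, heq⟩ := exists_primitive_smul (h := (D : ℝ) • quat a b c d)
    (mem_hurwitz_of_components ha hb hc hd) (smul_ne_zero hDR h0)
  refine ⟨q, hq, ?_⟩
  rw [← hM, ← cayleyMatrix_smul hDR (quat a b c d), heq, cayleyMatrix_smul (by positivity)]

/-- A primitive Hurwitz quaternion is, up to a symmetry of all cubic lattices, one of odd norm. -/
theorem IsPrimitive.exists_odd {q : ℍ[ℝ]} (hq : IsPrimitive q) :
    ∃ (r : ℍ[ℝ]) (hr : IsPrimitive r) (n ℓ : ℕ), Quaternion.normSq r = n ∧ Odd n ∧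
      Quaternion.normSq q = (n * 2 ^ ℓ : ℕ) ∧
      ∃ S : Matrix.orthogonalGroup (Fin 3) ℝ, (∀ Γ, IsCubic Γ → S ∈ symmetryGroup Γ) ∧
        rotation q hq.ne_zero = rotation r hr.ne_zero * S := by
  obtain ⟨ℓ, r, n, hr, rfl, hn, hodd⟩ := exists_odd_mul_oneAddI_pow hq.1 hq.ne_zero
  have hr' : IsPrimitive r := hq.of_mul_right hr (pow_mem oneAddI_mem_hurwitz ℓ)
  refine ⟨r, hr', n, ℓ, hn, hodd, ?_, _, fun Γ hΓ => pow_mem hΓ.rotation_oneAddI_mem ℓ,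
    rotation_mul_oneAddI_pow hr'.ne_zero ℓ _⟩
  rw [map_mul, map_pow, hn, normSq_oneAddI]
  push_cast
  rfl

/-- A determinant -1 is absorbed by the central symmetry, and the factors 1 + i of q by quarter
turns. The same S serves all cubic lattices. -/
theorem exists_rotation_of_rational {R : Matrix.orthogonalGroup (Fin 3) ℝ}
    (hR : R ∈ rationalOrthogonal 3) :
    ∃ (q : ℍ[ℝ]) (hq : IsPrimitive q) (n : ℕ), Quaternion.normSq q = n ∧ Odd n ∧
      ∃ S : Matrix.orthogonalGroup (Fin 3) ℝ, (∀ Γ, IsCubic Γ → S ∈ symmetryGroup Γ) ∧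
        R = rotation q hq.ne_zero * S := by
  obtain ⟨M, hM, hRM⟩ := hR
  have h1 : M * Mᵀ = 1 := (Matrix.mem_orthogonalGroup_iff (Fin 3) ℚ).1 hM
  have h2 : Mᵀ * M = 1 := (Matrix.mem_orthogonalGroup_iff' (Fin 3) ℚ).1 hM
  have hdet : M.det * M.det = 1 := by
    have := congrArg Matrix.det h1
    rwa [Matrix.det_mul, Matrix.det_transpose, Matrix.det_one] at this
  have main : ∃ (q : ℍ[ℝ]) (hq : IsPrimitive q) (S : Matrix.orthogonalGroup (Fin 3) ℝ),
      (∀ Γ, IsCubic Γ → S ∈ symmetryGroup Γ) ∧ R = rotation q hq.ne_zero * S := by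
    rcases mul_self_eq_one_iff.1 hdet with h | h
    · obtain ⟨q, hq, hqM⟩ := exists_primitive_of_special h1 h2 h
      exact ⟨q, hq, 1, fun Γ _ => one_mem _, by
        rw [mul_one]
        exact Subtype.ext (hRM.trans hqM.symm)⟩
    · obtain ⟨q, hq, hqM⟩ := exists_primitive_of_special (M := -M)
        (by rw [Matrix.transpose_neg, neg_mul_neg, h1]) (by rw [Matrix.transpose_neg, neg_mul_neg, h2])
        (by rw [Matrix.det_neg, h]; norm_num)
      refine ⟨q, hq, -1, fun Γ _ => neg_one_mem_symmetryGroup, Subtype.ext ?_⟩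
      change R.1 = cayleyMatrix q * (-1)
      rw [hqM, hRM]
      ext i j
      simp
  obtain ⟨q, hq, S, hS, hRq⟩ := main
  obtain ⟨r, hr, n, ℓ, hn, hodd, -, T, hT, hqr⟩ := hq.exists_odd
  exact ⟨r, hr, n, hn, hodd, T * S, fun Γ hΓ => mul_mem (hT Γ hΓ) (hS Γ hΓ), by
    rw [hRq, hqr, mul_assoc]⟩

/-! ### Isotropic vectors modulo `n` -/

/-- The real vector of an integer vector. -/
def toReal (v : Fin 3 → ℤ) : Fin 3 → ℝ := fun i => (v i : ℝ)

@[simp] theorem toReal_apply (v : Fin 3 → ℤ) (i : Fin 3) : toReal v i = v i := rfl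

theorem toReal_mem_pc (v : Fin 3 → ℤ) : toReal v ∈ pc := ⟨v, fun _ => rfl⟩

theorem exists_toReal_eq {x : Fin 3 → ℝ} (hx : x ∈ pc) : ∃ v, x = toReal v := by
  obtain ⟨a, ha⟩ := hx
  exact ⟨a, funext ha⟩

theorem toReal_dotProduct (v w : Fin 3 → ℤ) : toReal v ⬝ᵥ toReal w = ((v ⬝ᵥ w : ℤ) : ℝ) := by
  simp [dotProduct]

theorem pureQ_toReal_mem (v : Fin 3 → ℤ) : pureQ (toReal v) ∈ hurwitz :=
  pureQ_mem_hurwitz_iff.2 (toReal_mem_pc v)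

/-- Integer vectors that represent a point over `ℤ/n` of the conic `x² + y² + z² = 0`. -/
structure Conic (n : ℕ) (v : Fin 3 → ℤ) : Prop where
  isotropic : (n : ℤ) ∣ v ⬝ᵥ v
  unimodular : ∃ u : Fin 3 → ℤ, (n : ℤ) ∣ u ⬝ᵥ v - 1

/-- The pure quaternion `v` and `n` generate the right ideal `q J`, where `q` has norm `n`. -/
structure Generates (q : ℍ[ℝ]) (n : ℕ) (v : Fin 3 → ℤ) : Prop where
  mem : q ∈ hurwitz
  normSq_eq : Quaternion.normSq q = n
  exists_eq : ∃ b ∈ hurwitz, pureQ (toReal v) = q * b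
  exists_comb : ∃ s ∈ hurwitz, ∃ t ∈ hurwitz, q = pureQ (toReal v) * s + (n : ℝ) • t

theorem normSq_pureQ (x : Fin 3 → ℝ) : Quaternion.normSq (pureQ x) = x ⬝ᵥ x := by
  simp [Quaternion.normSq_def', dotProduct, Fin.sum_univ_three]
  ring

/-- Modulo n, for isotropic v, only the term with ⟨v, x⟩ survives; this turns a quaternion condition
into a linear congruence. -/
theorem pureQ_mul_pureQ_mul_pureQ (v x : Fin 3 → ℝ) : pureQ v * pureQ x * pureQ v
    = (v ⬝ᵥ v) • pureQ x - (2 * (v ⬝ᵥ x)) • pureQ v := by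
  ext <;> simp [dotProduct, Fin.sum_univ_three] <;> ring

theorem pureQ_mul_comm (v x : Fin 3 → ℝ) :
    pureQ x * pureQ v = -(pureQ v * pureQ x) - ((2 * (v ⬝ᵥ x) : ℝ) : ℍ[ℝ]) := by
  ext <;> simp [dotProduct, Fin.sum_univ_three] <;> ring

theorem exists_toReal_of_smul {x : Fin 3 → ℝ} {r : ℝ} (hr : r ≠ 0) {z : ℍ[ℝ]} (hz : z ∈ hurwitz)
    (h : pureQ x = r • z) : ∃ w, z = pureQ (toReal w) ∧ x = r • toReal w := by
  have hre : z.re = 0 := by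
    have := congrArg QuaternionAlgebra.re h
    simpa [hr] using this.symm
  obtain ⟨y, rfl⟩ := exists_pureQ_eq hre
  obtain ⟨w, rfl⟩ := exists_toReal_eq (pureQ_mem_hurwitz_iff.1 hz)
  exact ⟨w, rfl, pureQ_injective (by rw [h, pureQ_smul])⟩

/-- A common factor of v and n would divide both u ⬝ᵥ v and u ⬝ᵥ v - 1. -/
theorem Conic.eq_one_of_dvd {n : ℕ} {v : Fin 3 → ℤ} (hv : Conic n v) {m : ℕ} (hm : 0 < m)
    (hmn : m ∣ n) {z : ℍ[ℝ]} (hz : z ∈ hurwitz) (h : pureQ (toReal v) = (m : ℝ) • z) : m = 1 := by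
  obtain ⟨w, -, hw⟩ := exists_toReal_of_smul (by positivity) hz h
  have hvw : v = (m : ℤ) • w := by
    ext i
    have := congrFun hw i
    simp only [toReal_apply, Pi.smul_apply, smul_eq_mul] at this ⊢
    exact_mod_cast this
  obtain ⟨u, hu⟩ := hv.unimodular
  have h1 : (m : ℤ) ∣ u ⬝ᵥ v - 1 := (Int.natCast_dvd_natCast.2 hmn).trans hu
  have h2 : (m : ℤ) ∣ u ⬝ᵥ v := by
    rw [hvw, dotProduct_smul, smul_eq_mul]
    exact dvd_mul_right _ _
  have h3 : (m : ℤ) ∣ 1 := by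
    have := dvd_sub h2 h1
    rwa [sub_sub_cancel] at this
  have := Int.natCast_dvd_natCast.1 (by exact_mod_cast h3 : ((m : ℕ) : ℤ) ∣ ((1 : ℕ) : ℤ))
  exact Nat.dvd_one.1 this

theorem exists_int_two_mul_re {q : ℍ[ℝ]} (hq : q ∈ hurwitz) : ∃ k : ℤ, 2 * q.re = k := by
  obtain ⟨a, _, _, _, h, -⟩ := exists_two_mul_components hq
  exact ⟨a, h⟩

theorem Conic.exists_natCast {n : ℕ} {v : Fin 3 → ℤ} (hv : Conic n v) :
    ∃ c : ℤ, Quaternion.normSq (pureQ (toReal v)) = n * c := by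
  obtain ⟨c, hc⟩ := hv.isotropic
  exact ⟨c, by rw [normSq_pureQ, toReal_dotProduct, hc]; push_cast; rfl⟩

/-- The right ideal vJ + nJ is principal, say qJ. Isotropy of v makes the norm of q a multiple n m
of n, and unimodularity forces m = 1 and q primitive. -/
theorem Conic.exists_generates {n : ℕ} (hn : 0 < n) {v : Fin 3 → ℤ} (hv : Conic n v) :
    ∃ q, IsPrimitive q ∧ Generates q n v := by
  set V := pureQ (toReal v) with hV
  have hVm : V ∈ hurwitz := pureQ_toReal_mem v
  have hnR : (n : ℝ) ≠ 0 := by positivity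
  let I : AddSubgroup ℍ[ℝ] :=
    { carrier := {x | ∃ s ∈ hurwitz, ∃ t ∈ hurwitz, x = V * s + (n : ℝ) • t}
      zero_mem' := ⟨0, zero_mem _, 0, zero_mem _, by simp⟩
      add_mem' := by
        rintro _ _ ⟨s, hs, t, ht, rfl⟩ ⟨s', hs', t', ht', rfl⟩
        exact ⟨s + s', add_mem hs hs', t + t', add_mem ht ht', by rw [mul_add, smul_add]; abel⟩
      neg_mem' := by
        rintro _ ⟨s, hs, t, ht, rfl⟩
        exact ⟨-s, neg_mem hs, -t, neg_mem ht, by rw [mul_neg, smul_neg]; abel⟩ }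
  have hn_mem : (n : ℝ) • (1 : ℍ[ℝ]) ∈ I := ⟨0, zero_mem _, 1, one_mem _, by simp⟩
  have hV_mem : V ∈ I := ⟨1, one_mem _, 0, zero_mem _, by simp⟩
  obtain ⟨q, ⟨s, hs, t, ht, hq⟩, hq0, hgen⟩ := exists_generator_of_right_ideal I
    (by
      rintro _ ⟨s, hs, t, ht, rfl⟩
      exact add_mem (mul_mem hVm hs) (natCast_smul_mem_hurwitz n ht))
    (by
      rintro _ ⟨s, hs, t, ht, rfl⟩ y hy
      exact ⟨s * y, mul_mem hs hy, t * y, mul_mem ht hy, by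
        rw [add_mul, mul_assoc, smul_mul_assoc]⟩)
    ⟨_, hn_mem, smul_ne_zero hnR one_ne_zero⟩
  have hqm : q ∈ hurwitz := by
    rw [hq]
    exact add_mem (mul_mem hVm hs) (natCast_smul_mem_hurwitz n ht)
  obtain ⟨a, ha, hna⟩ := hgen _ hn_mem
  obtain ⟨b, hb, hVb⟩ := hgen _ hV_mem
  obtain ⟨N, hN⟩ := exists_normSq_eq_natCast hqm
  obtain ⟨A, hA⟩ := exists_normSq_eq_natCast ha
  have hNpos := pos_of_normSq_eq hq0 hN
  have hNA : N * A = n ^ 2 := by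
    have := congrArg Quaternion.normSq hna
    rw [Quaternion.normSq_smul, map_mul, hN, hA, map_one, mul_one] at this
    exact_mod_cast this.symm
  -- |v s + n t|² = |v|²|s|² + n²|t|² + 2n Re(v s t̄), and n divides each term because 2 Re of a
  -- Hurwitz quaternion is an integer.
  obtain ⟨m, rfl⟩ : n ∣ N := by
    obtain ⟨c, hc⟩ := hv.exists_natCast
    obtain ⟨S, hS⟩ := exists_normSq_eq_natCast hs
    obtain ⟨T, hT⟩ := exists_normSq_eq_natCast ht
    obtain ⟨k, hk⟩ := exists_int_two_mul_re (mul_mem (mul_mem hVm hs) (star_mem_hurwitz ht))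
    have : (N : ℝ) = n * (c * S + n * T + k) := by
      rw [← hN, hq, Quaternion.normSq_add, map_mul, hc, hS, Quaternion.normSq_smul, hT,
        Quaternion.star_smul, mul_smul_comm, Quaternion.re_smul, smul_eq_mul, ← hk]
      ring
    have h' : (N : ℤ) = n * (c * S + n * T + k) := by exact_mod_cast this
    exact Int.natCast_dvd_natCast.1 ⟨_, h'⟩
  have hmA : m * A = n := by
    have : n * (m * A) = n * n := by linarith
    exact Nat.eq_of_mul_eq_mul_left hn this
  have hm : 0 < m := Nat.pos_of_mul_pos_left hNpos
  -- Multiply n = q a by q̄ on the left. Since v lies in qJ, the factor m of q then divides v.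
  have hqa : q = (m : ℝ) • star a := by
    have h1 : star q * ((n : ℝ) • (1 : ℍ[ℝ])) = ((n * m : ℕ) : ℝ) • a := by
      rw [hna, star_mul_of_normSq_eq hN]
    rw [mul_smul_comm, mul_one, Nat.cast_mul, mul_smul] at h1
    have h2 := smul_right_injective ℍ[ℝ] hnR h1
    rw [← star_star q, h2, Quaternion.star_smul]
  have hm1 : m = 1 := hv.eq_one_of_dvd hm ⟨A, hmA.symm⟩
    (mul_mem (star_mem_hurwitz ha) hb) (by rw [← hV, hVb, hqa, smul_mul_assoc])
  subst hm1
  rw [mul_one] at hN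
  refine ⟨q, ⟨hqm, fun k hk hkq => ?_⟩, hqm, hN, ⟨b, hb, hVb⟩, ⟨s, hs, t, ht, hq⟩⟩
  have hkR : (k : ℝ) ≠ 0 := by positivity
  obtain ⟨M, hM⟩ := exists_normSq_eq_natCast hkq
  -- An integer k dividing q divides v, and k² divides the norm n.
  refine hv.eq_one_of_dvd hk ⟨k * M, ?_⟩ (mul_mem hkq hb)
    (by rw [← hV, hVb, smul_mul_assoc, smul_inv_smul₀ hkR])
  rw [Quaternion.normSq_smul, hN] at hM
  have : (n : ℝ) = k * (k * M) := by
    rw [← hM]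
    field_simp
  exact_mod_cast this

theorem exists_unit_of_normSq_eq {q r c : ℍ[ℝ]} {n : ℕ} (hn : 0 < n)
    (hq : Quaternion.normSq q = n) (hr : Quaternion.normSq r = n) (h : r = q * c) :
    Quaternion.normSq c = 1 := by
  have hnR : (n : ℝ) ≠ 0 := by positivity
  have := congrArg Quaternion.normSq h
  rw [map_mul, hq, hr] at this
  exact mul_left_cancel₀ hnR (by rw [← this, mul_one])

theorem mul_star_of_unit {c : ℍ[ℝ]} (hc : Quaternion.normSq c = 1) : c * star c = 1 := by
  rw [Quaternion.self_mul_star, hc, Quaternion.coe_one]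

/-- Both v and n = q q̄ lie in qJ, so qJ contains the generator r of vJ + nJ; having the same norm
n, q and r differ by a unit. -/
theorem Conic.generates_of_mem {n : ℕ} (hn : 0 < n) {v : Fin 3 → ℤ} (hv : Conic n v) {q b : ℍ[ℝ]}
    (hq : q ∈ hurwitz) (hN : Quaternion.normSq q = n) (hb : b ∈ hurwitz)
    (h : pureQ (toReal v) = q * b) : Generates q n v := by
  obtain ⟨r, -, hr⟩ := hv.exists_generates hn
  obtain ⟨s, hs, t, ht, hrst⟩ := hr.exists_comb
  have hrq : r = q * (b * s + star q * t) := by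
    rw [hrst, h, mul_add, mul_star_of_normSq_eq hN, mul_assoc]
  have hc : b * s + star q * t ∈ hurwitz :=
    add_mem (mul_mem hb hs) (mul_mem (star_mem_hurwitz hq) ht)
  have hN1 := exists_unit_of_normSq_eq hn hN hr.normSq_eq hrq
  set c := b * s + star q * t
  refine ⟨hq, hN, ⟨b, hb, h⟩, s * star c, mul_mem hs (star_mem_hurwitz hc), t * star c,
    mul_mem ht (star_mem_hurwitz hc), ?_⟩
  calc q = r * star c := by rw [hrq, mul_assoc, mul_star_of_unit hN1, mul_one]
    _ = _ := by
      conv_lhs => rw [hrst]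
      rw [add_mul, mul_assoc, smul_mul_assoc]

/-- The congruence puts wJ + nJ inside vJ + nJ, and generators of equal norm differ by a unit. -/
theorem Generates.exists_unit {n : ℕ} (hn : 0 < n) {v w : Fin 3 → ℤ} {q r : ℍ[ℝ]}
    (hq : Generates q n v) (hr : Generates r n w) {t : ℤ} (h : ∀ i, (n : ℤ) ∣ w i - t * v i) :
    ∃ c ∈ hurwitz, Quaternion.normSq c = 1 ∧ r = q * c := by
  choose e he using h
  obtain ⟨b, hb, hvb⟩ := hq.exists_eq
  obtain ⟨s, hs, t', ht', hrst⟩ := hr.exists_comb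
  have hW : pureQ (toReal w) = (t : ℝ) • pureQ (toReal v) + (n : ℝ) • pureQ (toReal e) := by
    have hi : ∀ i, (w i : ℝ) = t * v i + n * e i := fun i => by
      have := congrArg (Int.cast (R := ℝ)) (he i)
      push_cast at this
      linarith
    ext <;> simp [hi]
  have hrq : r = q * (((t : ℝ) • b + star q * pureQ (toReal e)) * s + star q * t') := by
    rw [mul_add, mul_star_of_normSq_eq hq.normSq_eq, ← mul_assoc, mul_add,
      mul_star_of_normSq_eq hq.normSq_eq, mul_smul_comm, ← hvb, ← hW, hrst]
  have hs' := star_mem_hurwitz hq.mem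
  exact ⟨_, add_mem (mul_mem (add_mem (intCast_smul_mem_hurwitz t hb)
    (mul_mem hs' (pureQ_toReal_mem e))) hs) (mul_mem hs' ht'),
    exists_unit_of_normSq_eq hn hq.normSq_eq hr.normSq_eq hrq, hrq⟩

/-! ### Every primitive quaternion of odd norm comes from an isotropic vector -/

/-- Take for t the product of the primes p | n that do not divide the vector a. For these, a + t b ≡
a is nonzero modulo p. For the other primes a ≡ 0 and t is invertible, so b alone decides. -/
theorem exists_comb_coprime {n : ℕ} (hn : n ≠ 0) (a b : Fin 3 → ℤ) : ∃ t : ℤ, ∀ p : ℕ, p.Prime →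
    p ∣ n → (∀ i, (p : ℤ) ∣ a i + t * b i) → (∀ i, (p : ℤ) ∣ a i) ∧ ∀ i, (p : ℤ) ∣ b i := by
  classical
  let F : Finset ℕ := n.primeFactors.filter fun p : ℕ => ¬ ∀ i, (p : ℤ) ∣ a i
  let T : ℕ := ∏ p ∈ F, p
  refine ⟨T, fun p hp hpn h => ?_⟩
  by_cases ha : ∀ i, (p : ℤ) ∣ a i
  · refine ⟨ha, fun i => ?_⟩
    have h1 := (Int.dvd_add_right (ha i)).1 (h i)
    rcases (Nat.prime_iff_prime_int.1 hp).dvd_or_dvd h1 with h2 | h2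
    · exfalso
      obtain ⟨r, hr, hpr⟩ := (hp.prime.dvd_finsetProd_iff _).1 (Int.natCast_dvd_natCast.1 h2)
      have hr' := Finset.mem_filter.1 hr
      have : p = r := (Nat.prime_dvd_prime_iff_eq hp (Nat.prime_of_mem_primeFactors hr'.1)).1 hpr
      subst this
      exact hr'.2 ha
    · exact h2
  · exfalso
    have hpF : p ∈ F := Finset.mem_filter.2 ⟨Nat.mem_primeFactors.2 ⟨hp, hpn, hn⟩, ha⟩
    have h2 : (p : ℤ) ∣ T :=
      Int.natCast_dvd_natCast.2 (Finset.dvd_prod_of_mem _ hpF)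
    exact ha fun i => (Int.dvd_add_left (h2.mul_right (b i))).1 (h i)

/-- Bézout's identity for the three entries produces their gcd, which is coprime to n and hence
invertible modulo n. -/
theorem exists_unimodular {n : ℕ} (v : Fin 3 → ℤ)
    (h : ∀ p : ℕ, p.Prime → p ∣ n → ¬ ∀ i, (p : ℤ) ∣ v i) :
    ∃ u : Fin 3 → ℤ, (n : ℤ) ∣ u ⬝ᵥ v - 1 := by
  set g : ℕ := Int.gcd (Int.gcd (v 0) (v 1)) (v 2) with hg
  have hcop : Nat.Coprime g n := by
    refine Nat.Coprime.symm (Nat.Coprime.symm (Nat.coprime_of_dvd fun p hp hpg hpn => ?_))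
    apply h p hp hpn
    have hp1 : (p : ℤ) ∣ g := Int.natCast_dvd_natCast.2 hpg
    have h01 : (p : ℤ) ∣ Int.gcd (v 0) (v 1) := hp1.trans (Int.gcd_dvd_left _ _)
    intro i
    fin_cases i
    · exact h01.trans (Int.gcd_dvd_left _ _)
    · exact h01.trans (Int.gcd_dvd_right _ _)
    · exact hp1.trans (Int.gcd_dvd_right _ _)
  obtain ⟨x, y, hxy⟩ := Int.isCoprime_iff_gcd_eq_one.2 (by simpa using hcop : Int.gcd g n = 1)
  have e1 := Int.gcd_eq_gcd_ab (Int.gcd (v 0) (v 1)) (v 2)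
  have e2 := Int.gcd_eq_gcd_ab (v 0) (v 1)
  set α := Int.gcdA (Int.gcd (v 0) (v 1)) (v 2)
  set β := Int.gcdB (Int.gcd (v 0) (v 1)) (v 2)
  set γ := Int.gcdA (v 0) (v 1)
  set δ := Int.gcdB (v 0) (v 1)
  refine ⟨![x * (α * γ), x * (α * δ), x * β], -y, ?_⟩
  simp [dotProduct, Fin.sum_univ_three]
  rw [← hg] at e1
  linear_combination hxy - x * e1 - x * α * e2

theorem exists_int_conjMatrix {q : ℍ[ℝ]} (hq : q ∈ hurwitz) :
    ∃ A : Matrix (Fin 3) (Fin 3) ℤ, conjMatrix q = A.map (fun k : ℤ => (k : ℝ)) := by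
  have h : ∀ j, ∃ a : Fin 3 → ℤ, ∀ i, conjMatrix q i j = a i := fun j => by
    obtain ⟨a, ha⟩ := conjMatrix_mem_pc hq (x := Pi.single j 1) ⟨Pi.single j 1, fun i => by
      by_cases h : i = j
      · subst h; simp
      · simp [h]⟩
    exact ⟨a, fun i => by rw [← ha i]; simp⟩
  choose a ha using h
  exact ⟨Matrix.of fun i j => a j i, by ext i j; simp [ha]⟩

theorem int_dvd_of_sq_eq {p : ℕ} (hp : p.Prime) {a k : ℤ} (h : a ^ 2 = p * k) :
    (p : ℤ) ∣ a :=
  (Nat.prime_iff_prime_int.1 hp).dvd_of_dvd_pow ⟨k, h⟩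

/-- For p = 2m + 1 one has q/p = q - m(2q/p), so it is enough that 2q/p has integer components. -/
theorem inv_smul_mem_hurwitz_of_dvd {q : ℍ[ℝ]} (hq : q ∈ hurwitz) {p : ℕ} (hp : Odd p)
    {a b e f : ℤ} (h0 : 2 * q.re = p * a) (h1 : 2 * q.imI = p * b) (h2 : 2 * q.imJ = p * e)
    (h3 : 2 * q.imK = p * f) : (p : ℝ)⁻¹ • q ∈ hurwitz := by
  have hpR : (p : ℝ) ≠ 0 := by
    have := hp.pos
    positivity
  obtain ⟨m, hm⟩ := hp
  have hz : (p : ℝ)⁻¹ • ((2 : ℝ) • q) ∈ hurwitz := by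
    apply mem_hurwitz_of_components (a := a) (b := b) (e := e) (f := f) <;> simp <;> field_simp <;>
      linarith
  have h : (p : ℝ)⁻¹ • q = q - (m : ℝ) • ((p : ℝ)⁻¹ • ((2 : ℝ) • q)) := by
    have hm' : (p : ℝ) = 2 * m + 1 := by exact_mod_cast hm
    have : (p : ℝ)⁻¹ = 1 - m * ((p : ℝ)⁻¹ * 2) := by
      field_simp
      linarith
    rw [smul_smul, smul_smul, ← sub_eq_zero]
    nth_rewrite 1 [this]
    module
  rw [h]
  exact sub_mem hq (natCast_smul_mem_hurwitz m hz)

/-- Four times the square of each component of q is a signed sum of |q|² and the three diagonal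
entries. A prime p dividing all of these divides 2q, hence q because p is odd. -/
theorem IsPrimitive.not_dvd_conjMatrix {q : ℍ[ℝ]} (hq : IsPrimitive q) {n : ℕ}
    (hN : Quaternion.normSq q = n) (hn : Odd n) {A : Matrix (Fin 3) (Fin 3) ℤ}
    (hA : conjMatrix q = A.map (fun k : ℤ => (k : ℝ))) {p : ℕ} (hp : p.Prime) (hpn : p ∣ n) :
    ¬ ∀ i j, (p : ℤ) ∣ A i j := by
  intro h
  obtain ⟨m, hm⟩ := hpn
  obtain ⟨k0, hk0⟩ := h 0 0
  obtain ⟨k1, hk1⟩ := h 1 1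
  obtain ⟨k2, hk2⟩ := h 2 2
  obtain ⟨a, b, e, f, h0, h1, h2, h3⟩ := exists_two_mul_components hq.1
  have A0 : conjMatrix q 0 0 = p * k0 := by rw [hA]; simp [hk0]
  have A1 : conjMatrix q 1 1 = p * k1 := by rw [hA]; simp [hk1]
  have A2 : conjMatrix q 2 2 = p * k2 := by rw [hA]; simp [hk2]
  rw [conjMatrix_eq] at A0 A1 A2
  simp at A0 A1 A2
  rw [Quaternion.normSq_def'] at hN
  have hm' : (n : ℝ) = p * m := by exact_mod_cast hm
  have ha : a ^ 2 = p * (m + k0 + k1 + k2) := by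
    have : (a : ℝ) ^ 2 = p * (m + k0 + k1 + k2) := by
      rw [← h0]
      linear_combination hN + hm' + A0 + A1 + A2
    exact_mod_cast this
  have hb : b ^ 2 = p * (m + k0 - k1 - k2) := by
    have : (b : ℝ) ^ 2 = p * (m + k0 - k1 - k2) := by
      rw [← h1]
      linear_combination hN + hm' + A0 - A1 - A2
    exact_mod_cast this
  have he : e ^ 2 = p * (m - k0 + k1 - k2) := by
    have : (e : ℝ) ^ 2 = p * (m - k0 + k1 - k2) := by
      rw [← h2]
      linear_combination hN + hm' - A0 + A1 - A2
    exact_mod_cast this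
  have hf : f ^ 2 = p * (m - k0 - k1 + k2) := by
    have : (f : ℝ) ^ 2 = p * (m - k0 - k1 + k2) := by
      rw [← h3]
      linear_combination hN + hm' - A0 - A1 + A2
    exact_mod_cast this
  obtain ⟨a', rfl⟩ := int_dvd_of_sq_eq hp ha
  obtain ⟨b', rfl⟩ := int_dvd_of_sq_eq hp hb
  obtain ⟨e', rfl⟩ := int_dvd_of_sq_eq hp he
  obtain ⟨f', rfl⟩ := int_dvd_of_sq_eq hp hf
  push_cast at h0 h1 h2 h3
  have hpodd : Odd p := hn.of_dvd_nat ⟨m, hm⟩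
  have := hq.2 p hp.pos (inv_smul_mem_hurwitz_of_dvd hq.1 hpodd h0 h1 h2 h3)
  exact hp.one_lt.ne' this

/-- Modulo each prime p | n some column of A is nonzero. Two applications of `exists_comb_coprime`
merge the columns into one vector that is nonzero modulo all these primes at once. -/
theorem IsPrimitive.exists_unimodular_mulVec {q : ℍ[ℝ]} (hq : IsPrimitive q) {n : ℕ}
    (hN : Quaternion.normSq q = n) (hn : Odd n) {A : Matrix (Fin 3) (Fin 3) ℤ}
    (hA : conjMatrix q = A.map (fun k : ℤ => (k : ℝ))) :
    ∃ x u : Fin 3 → ℤ, (n : ℤ) ∣ u ⬝ᵥ (A *ᵥ x) - 1 := by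
  obtain ⟨t, ht⟩ := exists_comb_coprime hn.pos.ne' (fun i => A i 0) (fun i => A i 1)
  obtain ⟨s, hs⟩ := exists_comb_coprime hn.pos.ne' (fun i => A i 0 + t * A i 1) (fun i => A i 2)
  refine ⟨![1, t, s], exists_unimodular _ fun p hp hpn h => ?_⟩
  obtain ⟨h01, h2⟩ := hs p hp hpn fun i => by
    have := h i
    simp only [Matrix.mulVec, dotProduct, Fin.sum_univ_three, Matrix.cons_val_zero,
      Matrix.cons_val_one, Matrix.cons_val, mul_one] at this
    rwa [mul_comm (A i 1) t, mul_comm (A i 2) s] at this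
  obtain ⟨h0, h1⟩ := ht p hp hpn h01
  refine hq.not_dvd_conjMatrix hN hn hA hp hpn fun i j => ?_
  fin_cases j
  exacts [h0 i, h1 i, h2 i]

/-- Take v = q x q̄ with x from the preceding lemma: it lies in qJ, and its norm is a multiple of
|q|² = n. -/
theorem IsPrimitive.exists_conic {q : ℍ[ℝ]} (hq : IsPrimitive q) {n : ℕ}
    (hN : Quaternion.normSq q = n) (hn : Odd n) : ∃ v, Conic n v ∧ Generates q n v := by
  obtain ⟨A, hA⟩ := exists_int_conjMatrix hq.1
  obtain ⟨x, hx⟩ := hq.exists_unimodular_mulVec hN hn hA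
  have hv : pureQ (toReal (A *ᵥ x)) = q * (pureQ (toReal x) * star q) := by
    rw [← mul_assoc, ← pureQ_conjMatrix, hA]
    congr 1
    ext i
    simp [Matrix.mulVec, dotProduct, Fin.sum_univ_three]
  have hb : pureQ (toReal x) * star q ∈ hurwitz :=
    mul_mem (pureQ_toReal_mem _) (star_mem_hurwitz hq.1)
  have hconic : Conic n (A *ᵥ x) := by
    refine ⟨?_, hx⟩
    obtain ⟨B, hB⟩ := exists_normSq_eq_natCast hb
    have h := congrArg Quaternion.normSq hv
    rw [map_mul, hN, hB, normSq_pureQ, toReal_dotProduct] at h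
    exact ⟨B, by exact_mod_cast h⟩
  exact ⟨_, hconic, hconic.generates_of_mem hn.pos hq.1 hN hb hv⟩

/-! ### Coincidence site lattices -/

/-- The phase `⟨v, 2 x⟩ / n` modulo `1`. -/
def phase (n : ℕ) (v : Fin 3 → ℤ) : (Fin 3 → ℝ) →+ AddCircle (1 : ℝ) :=
  (QuotientAddGroup.mk' (AddSubgroup.zmultiples (1 : ℝ))).comp
    { toFun := fun x => (toReal v ⬝ᵥ (2 : ℝ) • x) / n
      map_zero' := by simp
      map_add' := fun x y => by rw [smul_add, dotProduct_add, add_div] }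

theorem phase_apply (n : ℕ) (v : Fin 3 → ℤ) (x : Fin 3 → ℝ) :
    phase n v x = (((toReal v ⬝ᵥ (2 : ℝ) • x) / n : ℝ) : AddCircle (1 : ℝ)) := rfl

/-- The sublattice of `Γ` of all `x` such that `n` divides `⟨v, 2 x⟩`. -/
def conicLattice (Γ : AddSubgroup (Fin 3 → ℝ)) (n : ℕ) (v : Fin 3 → ℤ) :
    AddSubgroup (Fin 3 → ℝ) :=
  Γ ⊓ (phase n v).ker

theorem mem_conicLattice_iff {Γ : AddSubgroup (Fin 3 → ℝ)} {n : ℕ} (hn : 0 < n) {v : Fin 3 → ℤ}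
    {x : Fin 3 → ℝ} :
    x ∈ conicLattice Γ n v ↔ x ∈ Γ ∧ ∃ k : ℤ, toReal v ⬝ᵥ (2 : ℝ) • x = n * k := by
  have hnR : (n : ℝ) ≠ 0 := by positivity
  rw [conicLattice, AddSubgroup.mem_inf, AddMonoidHom.mem_ker, phase_apply,
    AddCircle.coe_eq_zero_iff]
  refine and_congr_right fun _ => exists_congr fun k => ?_
  rw [zsmul_eq_mul, mul_one, eq_div_iff hnR, mul_comm, eq_comm]

/-- 4y = 2(2y) lies in 2ℤ³ ⊆ Γ, and n is coprime to 4. -/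
theorem IsCubic.mem_of_odd {Γ : AddSubgroup (Fin 3 → ℝ)} (hΓ : IsCubic Γ) {n : ℕ} (hn : Odd n)
    {y : Fin 3 → ℝ} (h1 : (n : ℝ) • y ∈ Γ) (h2 : (2 : ℝ) • y ∈ pc) : y ∈ Γ := by
  have h4 := hΓ.two_smul_mem _ h2
  have hcop : IsCoprime (n : ℤ) 4 := by
    rw [Int.isCoprime_iff_gcd_eq_one]
    change Nat.gcd n 4 = 1
    exact Nat.Coprime.pow_right 2 hn.coprime_two_right
  obtain ⟨a, b, hab⟩ := hcop
  have habR : (a : ℝ) * n + b * 4 = 1 := by exact_mod_cast hab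
  have : y = a • ((n : ℝ) • y) + b • ((2 : ℝ) • (2 : ℝ) • y) := by
    rw [← Int.cast_smul_eq_zsmul ℝ, ← Int.cast_smul_eq_zsmul ℝ, smul_smul, smul_smul, smul_smul,
      ← add_smul]
    rw [show (a : ℝ) * n + b * 2 * 2 = 1 by linarith, one_smul]
  rw [this]
  exact Γ.add_mem (Γ.zsmul_mem h1 a) (Γ.zsmul_mem h4 b)

theorem dvd_of_odd_of_dvd_four_mul {n : ℕ} (hn : Odd n) {w : ℤ} (h : (n : ℤ) ∣ 4 * w) :
    (n : ℤ) ∣ w := by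
  refine IsCoprime.dvd_of_dvd_mul_left ?_ h
  rw [Int.isCoprime_iff_gcd_eq_one]
  change Nat.gcd n 4 = 1
  exact Nat.Coprime.pow_right 2 hn.coprime_two_right

theorem Conic.dvd_of_dvd_mul {n : ℕ} {v : Fin 3 → ℤ} (hv : Conic n v) {w : ℤ}
    (h : ∀ i, (n : ℤ) ∣ w * v i) : (n : ℤ) ∣ w := by
  obtain ⟨u, hu⟩ := hv.unimodular
  have h1 : (n : ℤ) ∣ w * (u ⬝ᵥ v) := by
    simp only [dotProduct, Finset.mul_sum]
    refine Finset.dvd_sum fun i _ => ?_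
    rw [mul_left_comm]
    exact (h i).mul_left _
  have h2 := dvd_sub h1 (hu.mul_left w)
  rwa [mul_sub, mul_one, sub_sub_cancel] at h2

theorem natCast_smul_transpose_mulVec {q : ℍ[ℝ]} {n : ℕ} (hn : 0 < n)
    (hN : Quaternion.normSq q = n) (x : Fin 3 → ℝ) :
    (n : ℝ) • ((cayleyMatrix q)ᵀ *ᵥ x) = conjMatrix (star q) *ᵥ x := by
  have hnR : (n : ℝ) ≠ 0 := by positivity
  rw [← cayleyMatrix_star, cayleyMatrix_eq, Quaternion.normSq_star, hN, Matrix.smul_mulVec,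
    smul_inv_smul₀ hnR]

/-- Since v = q b = -b̄ q̄, the product v x v = -b̄(q̄ x q)b is divisible by n. As n also divides
|v|², the formula for v x v leaves n | 2⟨v, x⟩v, and v and 2 can be cancelled by unimodularity and
oddness. -/
theorem Generates.dvd_of_mem {n : ℕ} (hn : Odd n) {v : Fin 3 → ℤ} {q : ℍ[ℝ]} (hv : Conic n v)
    (hq : Generates q n v) {x y : Fin 3 → ℤ}
    (h : star q * pureQ (toReal x) * q = (n : ℝ) • pureQ (toReal y)) : (n : ℤ) ∣ v ⬝ᵥ x := by
  obtain ⟨b, hb, hvb⟩ := hq.exists_eq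
  have hnR : (n : ℝ) ≠ 0 := by
    have := hn.pos
    positivity
  obtain ⟨B, hB⟩ := exists_normSq_eq_natCast hb
  have hvv : toReal v ⬝ᵥ toReal v = n * B := by
    rw [← normSq_pureQ, hvb, map_mul, hq.normSq_eq, hB]
  have h1 : pureQ (toReal v) * pureQ (toReal x) * pureQ (toReal v)
      = (n : ℝ) • -(star b * pureQ (toReal y) * b) := by
    have : pureQ (toReal v) = -(star b * star q) := by
      rw [← star_mul, ← hvb, star_pureQ, neg_neg]
    calc pureQ (toReal v) * pureQ (toReal x) * pureQ (toReal v)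
        = -(star b * (star q * pureQ (toReal x) * q) * b) := by
          conv_lhs =>
            arg 1
            rw [this]
          rw [hvb]
          noncomm_ring
      _ = _ := by rw [h, mul_smul_comm, smul_mul_assoc, smul_neg]
  rw [pureQ_mul_pureQ_mul_pureQ, hvv, toReal_dotProduct] at h1
  have h2 : (2 * ((v ⬝ᵥ x : ℤ) : ℝ)) • pureQ (toReal v) = (n : ℝ) •
      ((B : ℝ) • pureQ (toReal x) + star b * pureQ (toReal y) * b) := by
    rw [smul_add, smul_smul, ← sub_eq_iff_eq_add', ← neg_sub, h1, smul_neg, neg_neg]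
  rw [← pureQ_smul] at h2
  obtain ⟨w, -, hw⟩ := exists_toReal_of_smul hnR (add_mem
    (natCast_smul_mem_hurwitz B (pureQ_toReal_mem x))
    (mul_mem (mul_mem (star_mem_hurwitz hb) (pureQ_toReal_mem y)) hb)) h2
  have h3 : (n : ℤ) ∣ 2 * (v ⬝ᵥ x) := hv.dvd_of_dvd_mul fun i => by
    have := congrFun hw i
    simp only [Pi.smul_apply, toReal_apply, smul_eq_mul] at this
    exact ⟨w i, by exact_mod_cast this⟩
  exact dvd_of_odd_of_dvd_four_mul hn (by
    rw [show (4 : ℤ) * (v ⬝ᵥ x) = 2 * (2 * (v ⬝ᵥ x)) by ring]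
    exact h3.mul_left 2)

/-- Substitute q = v s + n t for the right factor of q̄ x q. Moving v to the left of x costs 2⟨v,
x⟩, a multiple of n, and then q̄ v = q̄ q b = n b. -/
theorem Generates.exists_eq_smul {n : ℕ} {v : Fin 3 → ℤ} {q : ℍ[ℝ]} (hq : Generates q n v)
    {x : Fin 3 → ℤ} (h : (n : ℤ) ∣ v ⬝ᵥ x) :
    ∃ z ∈ hurwitz, star q * pureQ (toReal x) * q = (n : ℝ) • z := by
  obtain ⟨k, hk⟩ := h
  obtain ⟨b, hb, hvb⟩ := hq.exists_eq
  obtain ⟨s, hs, t, ht, hst⟩ := hq.exists_comb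
  have hx := pureQ_toReal_mem x
  have hsq := star_mem_hurwitz hq.mem
  refine ⟨-(b * pureQ (toReal x) * s) - ((2 * k : ℤ) : ℝ) • (star q * s)
      + star q * pureQ (toReal x) * t,
    add_mem (sub_mem (neg_mem (mul_mem (mul_mem hb hx) hs))
      (intCast_smul_mem_hurwitz _ (mul_mem hsq hs))) (mul_mem (mul_mem hsq hx) ht), ?_⟩
  have hqv : star q * pureQ (toReal v) = (n : ℝ) • b := by
    rw [hvb, star_mul_of_normSq_eq hq.normSq_eq]
  have hcomm := pureQ_mul_comm (toReal v) (toReal x)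
  rw [toReal_dotProduct, hk] at hcomm
  calc star q * pureQ (toReal x) * q
      = star q * (pureQ (toReal x) * pureQ (toReal v)) * s
          + star q * pureQ (toReal x) * ((n : ℝ) • t) := by
        conv_lhs =>
          arg 2
          rw [hst]
        rw [mul_add, mul_assoc, mul_assoc, mul_assoc, mul_assoc]
    _ = -((star q * pureQ (toReal v)) * pureQ (toReal x) * s)
          - (2 * (n * k) : ℝ) • (star q * s)
          + (n : ℝ) • (star q * pureQ (toReal x) * t) := by
        rw [hcomm, mul_sub, Quaternion.mul_coe_eq_smul, sub_mul, smul_mul_assoc, mul_smul_comm]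
        push_cast
        noncomm_ring
    _ = _ := by
        rw [hqv, smul_mul_assoc, smul_mul_assoc]
        push_cast
        module

/-- The question is whether y = q̄ x q / n lies in Γ. As n y does and n is odd, it suffices to test
2y ∈ ℤ³, that is, whether n divides q̄ X q for the integer vector X = 2x. The two preceding lemmas
decide this by ⟨v, X⟩ modulo n. -/
theorem Generates.csl_eq {Γ : AddSubgroup (Fin 3 → ℝ)} (hΓ : IsCubic Γ) {n : ℕ} (hn : Odd n)
    {v : Fin 3 → ℤ} {q : ℍ[ℝ]} (hv : Conic n v) (hq : Generates q n v) (hq0 : q ≠ 0) :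
    csl Γ (rotation q hq0) = conicLattice Γ n v := by
  have hnR : (n : ℝ) ≠ 0 := by
    have := hn.pos
    positivity
  ext x
  rw [mem_conicLattice_iff hn.pos, csl, AddSubgroup.mem_inf, mem_image_orthogonal_iff]
  refine and_congr_right fun hx => ?_
  change (cayleyMatrix q)ᵀ *ᵥ x ∈ Γ ↔ _
  have hsm := fun z => natCast_smul_transpose_mulVec hn.pos hq.normSq_eq z
  set y := (cayleyMatrix q)ᵀ *ᵥ x with hy
  obtain ⟨X, hX⟩ := exists_toReal_eq (hΓ.two_smul_mem_pc x hx)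
  have hXy : star q * pureQ (toReal X) * q = (n : ℝ) • pureQ ((2 : ℝ) • y) := by
    have h := pureQ_conjMatrix (star q) (toReal X)
    rw [star_star, ← hsm, ← hX, Matrix.mulVec_smul, ← hy, pureQ_smul, hX] at h
    exact h.symm
  have hdot : ∀ k : ℤ, toReal v ⬝ᵥ (2 : ℝ) • x = n * k ↔ v ⬝ᵥ X = n * k := fun k => by
    rw [hX, toReal_dotProduct]
    exact_mod_cast Iff.rfl
  simp only [hdot]
  constructor
  · intro h
    obtain ⟨Y, hY⟩ := exists_toReal_eq (hΓ.two_smul_mem_pc y h)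
    rw [hY] at hXy
    exact hq.dvd_of_mem hn hv hXy
  · intro h
    obtain ⟨z, hz, hzq⟩ := hq.exists_eq_smul h
    refine hΓ.mem_of_odd hn ?_ ?_
    · rw [hy, hsm]
      exact hΓ.conjMatrix_mem _ (star_mem_hurwitz hq.mem) x hx
    · rw [← pureQ_mem_hurwitz_iff]
      rwa [smul_right_injective ℍ[ℝ] hnR (hXy.symm.trans hzq)]

/-- The phase maps Γ onto the cyclic subgroup of order n in ℝ/ℤ. -/
theorem relIndex_conicLattice {Γ : AddSubgroup (Fin 3 → ℝ)} (hΓ : IsCubic Γ) {n : ℕ} (hn : Odd n)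
    {v : Fin 3 → ℤ} (hv : Conic n v) : (conicLattice Γ n v).relIndex Γ = n := by
  have hnR : (n : ℝ) ≠ 0 := by
    have := hn.pos
    positivity
  have hmap : Γ.map (phase n v)
      = AddSubgroup.zmultiples (((1 : ℝ) / n : ℝ) : AddCircle (1 : ℝ)) := by
    apply le_antisymm
    · rintro _ ⟨x, hx, rfl⟩
      obtain ⟨X, hX⟩ := exists_toReal_eq (hΓ.two_smul_mem_pc x hx)
      refine AddSubgroup.mem_zmultiples_iff.2 ⟨v ⬝ᵥ X, ?_⟩
      change _ = phase n v x
      rw [phase_apply, hX, toReal_dotProduct, ← AddCircle.coe_zsmul, zsmul_eq_mul]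
      congr 1
      ring
    · rw [AddSubgroup.zmultiples_le]
      obtain ⟨u, m, hu⟩ := hv.unimodular
      obtain ⟨k, l, hkl⟩ : IsCoprime (4 : ℤ) n := by
        rw [Int.isCoprime_iff_gcd_eq_one]
        change Nat.gcd 4 n = 1
        exact Nat.Coprime.pow_left 2 hn.coprime_two_left
      -- One factor 2 brings the vector into Γ and another comes from the phase, so k is chosen with
      -- 4k ≡ 1 modulo n.
      refine ⟨(2 : ℝ) • toReal (k • u), hΓ.two_smul_mem _ (toReal_mem_pc _), ?_⟩
      change phase n v _ = _
      have hk : toReal (k • u) = (k : ℝ) • toReal u := by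
        ext i
        simp
      have huR : toReal v ⬝ᵥ toReal u = n * m + 1 := by
        rw [toReal_dotProduct, dotProduct_comm, sub_eq_iff_eq_add.1 hu]
        push_cast
        rfl
      have hklR : (k : ℝ) * 4 + l * n = 1 := by exact_mod_cast hkl
      rw [phase_apply, hk, dotProduct_smul, dotProduct_smul, dotProduct_smul, huR, ← sub_eq_zero,
        ← AddCircle.coe_sub, AddCircle.coe_eq_zero_iff]
      refine ⟨4 * k * m - l, ?_⟩
      rw [zsmul_eq_mul]
      push_cast
      simp only [smul_eq_mul]
      field_simp
      linear_combination (-1 : ℝ) * hklR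
  rw [conicLattice, AddSubgroup.inf_relIndex_left, AddSubgroup.relIndex_ker, hmap,
    Nat.card_zmultiples]
  exact AddCircle.addOrderOf_period_div hn.pos

/-- The vectors eᵢ - vᵢu are orthogonal to v modulo n, so w must be orthogonal to them too, which
reads wᵢ ≡ ⟨w, u⟩vᵢ. -/
theorem Conic.exists_smul_of_le {Γ : AddSubgroup (Fin 3 → ℝ)} (hΓ : IsCubic Γ) {n : ℕ} (hn : Odd n)
    {v w : Fin 3 → ℤ} (hv : Conic n v) (h : conicLattice Γ n v ≤ conicLattice Γ n w) :
    ∃ t : ℤ, ∀ i, (n : ℤ) ∣ w i - t * v i := by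
  obtain ⟨u, m, hu⟩ := hv.unimodular
  refine ⟨w ⬝ᵥ u, fun i => ?_⟩
  have hmem : (2 : ℝ) • toReal (Pi.single i 1 - v i • u) ∈ conicLattice Γ n v := by
    refine (mem_conicLattice_iff hn.pos).2 ⟨hΓ.two_smul_mem _ (toReal_mem_pc _), -4 * v i * m, ?_⟩
    rw [dotProduct_smul, dotProduct_smul, toReal_dotProduct, dotProduct_sub, dotProduct_smul,
      dotProduct_comm v u, sub_eq_iff_eq_add.1 hu]
    simp
    ring
  obtain ⟨-, k, hk⟩ := (mem_conicLattice_iff hn.pos).1 (h hmem)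
  rw [dotProduct_smul, dotProduct_smul, toReal_dotProduct, dotProduct_sub, dotProduct_smul] at hk
  simp only [dotProduct_single, mul_one, smul_eq_mul] at hk
  apply dvd_of_odd_of_dvd_four_mul hn
  refine ⟨k, ?_⟩
  have : (2 : ℤ) * (2 * (w i - v i * (w ⬝ᵥ u))) = n * k := by exact_mod_cast hk
  linarith

theorem conicLattice_le_of_smul {Γ : AddSubgroup (Fin 3 → ℝ)} (hΓ : IsCubic Γ) {n : ℕ}
    (hn : 0 < n) {v w : Fin 3 → ℤ} {t : ℤ} (h : ∀ i, (n : ℤ) ∣ w i - t * v i) :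
    conicLattice Γ n v ≤ conicLattice Γ n w := by
  intro x hx
  obtain ⟨hxΓ, k, hk⟩ := (mem_conicLattice_iff hn).1 hx
  refine (mem_conicLattice_iff hn).2 ⟨hxΓ, ?_⟩
  obtain ⟨X, hX⟩ := exists_toReal_eq (hΓ.two_smul_mem_pc x hxΓ)
  choose e he using h
  have hw : w = t • v + (n : ℤ) • e := by
    ext i
    simp only [Pi.add_apply, Pi.smul_apply, smul_eq_mul]
    linarith [he i]
  rw [hX, toReal_dotProduct] at hk ⊢
  refine ⟨t * k + e ⬝ᵥ X, ?_⟩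
  have hk' : v ⬝ᵥ X = n * k := by exact_mod_cast hk
  rw [hw, add_dotProduct, smul_dotProduct, smul_dotProduct, hk']
  simp only [smul_eq_mul]
  push_cast
  ring

/-! ### Coincidence and similarity isometries -/

theorem rotation_mem_rationalOrthogonal {q : ℍ[ℝ]} (hq : q ∈ hurwitz) (h0 : q ≠ 0) :
    rotation q h0 ∈ rationalOrthogonal 3 := by
  obtain ⟨A, hA⟩ := exists_int_conjMatrix hq
  obtain ⟨n, hn⟩ := exists_normSq_eq_natCast hq
  have hM : cayleyMatrix q = ((n : ℚ)⁻¹ • A.map (fun k : ℤ => (k : ℚ))).map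
      (fun x : ℚ => (x : ℝ)) := by
    rw [cayleyMatrix_eq, hA, hn]
    ext i j
    simp
  refine ⟨_, ?_, hM⟩
  rw [Matrix.mem_orthogonalGroup_iff]
  have h := (Matrix.mem_orthogonalGroup_iff (Fin 3) ℝ).1 (cayleyMatrix_mem h0)
  rw [hM] at h
  ext i j
  have hij := congrFun (congrFun h i) j
  have : ((((n : ℚ)⁻¹ • A.map (fun k : ℤ => (k : ℚ))) *
      star ((n : ℚ)⁻¹ • A.map (fun k : ℤ => (k : ℚ)))) i j : ℚ) = (1 : Matrix (Fin 3) (Fin 3) ℚ) i j := by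
    have hcast : (((((n : ℚ)⁻¹ • A.map (fun k : ℤ => (k : ℚ))) *
      star ((n : ℚ)⁻¹ • A.map (fun k : ℤ => (k : ℚ)))) i j : ℚ) : ℝ)
        = (((1 : Matrix (Fin 3) (Fin 3) ℚ) i j : ℚ) : ℝ) := by
      have h1 : (((1 : Matrix (Fin 3) (Fin 3) ℚ) i j : ℚ) : ℝ)
          = (1 : Matrix (Fin 3) (Fin 3) ℝ) i j := by
        by_cases hij : i = j <;> simp [Matrix.one_apply, hij]
      rw [h1, ← hij]
      simp [Matrix.mul_apply, Fin.sum_univ_three, Matrix.star_apply]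
    exact_mod_cast hcast
  exact this

theorem rationalOrthogonal_inv_mem {d : ℕ} {R : Matrix.orthogonalGroup (Fin d) ℝ}
    (hR : R ∈ rationalOrthogonal d) : R⁻¹ ∈ rationalOrthogonal d := by
  obtain ⟨M, hM, hRM⟩ := hR
  refine ⟨Mᵀ, ?_, ?_⟩
  · rw [Matrix.mem_orthogonalGroup_iff]
    change Mᵀ * Mᵀᵀ = 1
    rw [Matrix.transpose_transpose]
    exact (Matrix.mem_orthogonalGroup_iff' (Fin d) ℚ).1 hM
  · rw [inv_val_eq_transpose, hRM]
    rfl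

/-- A = αR is an integer matrix, so α² (an entry of AᵀA) and α³ = ±det A are integers. Their
quotient α is rational, and so is R. -/
theorem exists_rat_of_image_le {R : Matrix.orthogonalGroup (Fin 3) ℝ} {α : ℝ} (hα : 0 < α)
    (h : ∀ x ∈ pc, (α • R.1) *ᵥ x ∈ pc) : R ∈ rationalOrthogonal 3 := by
  have hcol : ∀ j, ∃ a : Fin 3 → ℤ, ∀ i, α * R.1 i j = a i := fun j => by
    obtain ⟨a, ha⟩ := h (Pi.single j 1) ⟨Pi.single j 1, fun i => by
      by_cases h : i = j
      · subst h; simp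
      · simp [h]⟩
    exact ⟨a, fun i => by rw [← ha i]; simp⟩
  choose a ha using hcol
  let A : Matrix (Fin 3) (Fin 3) ℤ := Matrix.of fun i j => a j i
  have hA : α • R.1 = A.map (Int.castRingHom ℝ) := by
    ext i j
    simpa [A] using ha j i
  have hsq : ∃ k : ℤ, α ^ 2 = k := by
    have h1 : (α • R.1)ᵀ * (α • R.1) = (α ^ 2) • (1 : Matrix (Fin 3) (Fin 3) ℝ) := by
      rw [Matrix.transpose_smul, Matrix.smul_mul, Matrix.mul_smul, transpose_mul_self, smul_smul,
        sq]
    rw [hA, ← Matrix.transpose_map, ← Matrix.map_mul] at h1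
    refine ⟨(Aᵀ * A) 0 0, ?_⟩
    have := congrFun (congrFun h1 0) 0
    simpa using this.symm
  have hcube : ∃ k : ℤ, α ^ 3 = k := by
    have h1 := congrArg Matrix.det hA
    rw [Matrix.det_smul, ← RingHom.mapMatrix_apply, ← RingHom.map_det, Fintype.card_fin] at h1
    have h2 : R.1.det * R.1.det = 1 := by
      have := congrArg Matrix.det (transpose_mul_self R)
      rwa [Matrix.det_mul, Matrix.det_transpose, Matrix.det_one] at this
    rcases mul_self_eq_one_iff.1 h2 with h3 | h3
    · exact ⟨A.det, by rw [h3, mul_one] at h1; simpa using h1⟩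
    · exact ⟨-A.det, by
        rw [h3] at h1
        have h4 : α ^ 3 * -1 = (A.det : ℝ) := h1
        rw [Int.cast_neg]
        linarith⟩
  obtain ⟨k, hk⟩ := hsq
  obtain ⟨l, hl⟩ := hcube
  have hαq : α = ((l / k : ℚ) : ℝ) := by
    push_cast
    rw [← hk, ← hl]
    field_simp
  have hα0 : ((l / k : ℚ) : ℝ) ≠ 0 := hαq ▸ hα.ne'
  have hM : R.1 = ((l / k : ℚ)⁻¹ • A.map (fun k : ℤ => (k : ℚ))).map (fun x : ℚ => (x : ℝ)) := by
    ext i j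
    have := ha j i
    rw [hαq] at this
    simp only [Matrix.map_apply, Matrix.smul_apply, smul_eq_mul, Rat.cast_mul, Rat.cast_inv,
      Rat.cast_intCast]
    rw [eq_inv_mul_iff_mul_eq₀ hα0]
    exact this
  refine ⟨_, ?_, hM⟩
  rw [Matrix.mem_orthogonalGroup_iff]
  have h := mul_transpose_self R
  rw [hM] at h
  change _ * Matrix.transpose _ = 1
  have hinj : Function.Injective
      (fun N : Matrix (Fin 3) (Fin 3) ℚ => N.map (Rat.castHom ℝ)) :=
    Matrix.map_injective Rat.cast_injective
  apply hinj
  change (_ * _ : Matrix (Fin 3) (Fin 3) ℚ).map (Rat.castHom ℝ)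
    = (1 : Matrix (Fin 3) (Fin 3) ℚ).map (Rat.castHom ℝ)
  rw [Matrix.map_mul, Matrix.map_one _ (map_zero _) (map_one _), Matrix.transpose_map]
  exact h

theorem IsCubic.OS_subset {Γ : AddSubgroup (Fin 3 → ℝ)} (hΓ : IsCubic Γ) :
    OS Γ ⊆ rationalOrthogonal 3 := by
  rintro R ⟨α, hα, h⟩
  rw [image_le_iff] at h
  -- One factor 2 for 2ℤ³ ⊆ Γ and another for 2Γ ⊆ ℤ³.
  refine exists_rat_of_image_le (α := 4 * α) (by positivity) fun x hx => ?_
  have := hΓ.two_smul_mem_pc _ (h _ (hΓ.two_smul_mem x hx))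
  rw [Matrix.mulVec_smul, smul_smul, ← Matrix.smul_mulVec, smul_smul] at this
  norm_num at this
  exact this

theorem IsCubic.rational_subset_OS {Γ : AddSubgroup (Fin 3 → ℝ)} (hΓ : IsCubic Γ) :
    rationalOrthogonal 3 ⊆ OS Γ := by
  intro R hR
  obtain ⟨q, hq, n, hN, hn, S, hS, rfl⟩ := exists_rotation_of_rational hR
  refine ⟨n, by exact_mod_cast hn.pos, image_le_iff.2 fun x hx => ?_⟩
  change ((n : ℝ) • (cayleyMatrix q * S.1)) *ᵥ x ∈ Γ
  rw [← Matrix.smul_mul, ← hN, ← Matrix.mulVec_mulVec]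
  have hSx : S.1 *ᵥ x ∈ Γ := by
    have h : image S.1 Γ = Γ := hS Γ hΓ
    rw [← h]
    exact ⟨x, hx, rfl⟩
  exact hΓ.conjMatrix_mem q hq.1 _ hSx

theorem csl_mul_symmetry {d : ℕ} {Γ : AddSubgroup (Fin d → ℝ)}
    {R S : Matrix.orthogonalGroup (Fin d) ℝ} (hS : S ∈ symmetryGroup Γ) :
    csl Γ (R * S) = csl Γ R := by
  rw [csl, csl, image_mul_symmetry hS]

theorem coincidenceIndex_mul_symmetry {d : ℕ} {Γ : AddSubgroup (Fin d → ℝ)}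
    {R S : Matrix.orthogonalGroup (Fin d) ℝ} (hS : S ∈ symmetryGroup Γ) :
    coincidenceIndex Γ (R * S) = coincidenceIndex Γ R := by
  rw [coincidenceIndex, coincidenceIndex, csl_mul_symmetry hS]

theorem IsCubic.coincidenceIndex_rotation {Γ : AddSubgroup (Fin 3 → ℝ)} (hΓ : IsCubic Γ)
    {q : ℍ[ℝ]} (hq : IsPrimitive q) {n : ℕ} (hN : Quaternion.normSq q = n) (hn : Odd n) :
    coincidenceIndex Γ (rotation q hq.ne_zero) = n := by
  obtain ⟨v, hv, hqv⟩ := hq.exists_conic hN hn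
  rw [coincidenceIndex, hqv.csl_eq hΓ hn hv, relIndex_conicLattice hΓ hn hv]

theorem image_injective {d : ℕ} (R : Matrix.orthogonalGroup (Fin d) ℝ) :
    Function.Injective (Matrix.mulVecLin R.1).toAddMonoidHom := by
  intro x y h
  have h' : R.1 *ᵥ x = R.1 *ᵥ y := h
  have := congrArg (fun z => R.1ᵀ *ᵥ z) h'
  simpa [Matrix.mulVec_mulVec, transpose_mul_self] using this

theorem IsCubic.relIndex_ne_zero {Γ : AddSubgroup (Fin 3 → ℝ)} (hΓ : IsCubic Γ)
    {R : Matrix.orthogonalGroup (Fin 3) ℝ} (hR : R ∈ rationalOrthogonal 3) :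
    (image R.1 Γ).relIndex Γ ≠ 0 := by
  obtain ⟨q, hq, n, hN, hn, S, hS, rfl⟩ := exists_rotation_of_rational hR
  have h := hΓ.coincidenceIndex_rotation hq hN hn
  rw [image_mul_symmetry (hS Γ hΓ)]
  rw [coincidenceIndex, csl, AddSubgroup.inf_relIndex_left] at h
  rw [h]
  exact hn.pos.ne'

/-- Applying R⁻¹ turns the index in RΓ into the index in Γ that belongs to R⁻¹, which is rational as
well. -/
theorem IsCubic.rational_subset_OC {Γ : AddSubgroup (Fin 3 → ℝ)} (hΓ : IsCubic Γ) :
    rationalOrthogonal 3 ⊆ OC Γ := by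
  intro R hR
  refine ⟨?_, hΓ.relIndex_ne_zero hR⟩
  have h := hΓ.relIndex_ne_zero (rationalOrthogonal_inv_mem hR)
  have h1 : Γ = image R.1 (image (R⁻¹).1 Γ) := by
    rw [← image_mul, inv_val_eq_transpose, mul_transpose_self, image_one]
  have h2 : Γ.relIndex (image R.1 Γ) = (image (R⁻¹).1 Γ).relIndex Γ := by
    conv_lhs =>
      arg 1
      rw [h1]
    exact AddSubgroup.relIndex_map_map_of_injective _ _ (image_injective R)
  rwa [h2]

/-- If m is the index of Γ ∩ RΓ in Γ, then mΓ ⊆ RΓ, that is, mR⁻¹Γ ⊆ Γ. -/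
theorem IsCubic.OC_subset {Γ : AddSubgroup (Fin 3 → ℝ)} (hΓ : IsCubic Γ) :
    OC Γ ⊆ rationalOrthogonal 3 := by
  rintro R ⟨-, hR⟩
  have h : R⁻¹ ∈ OS Γ := by
    refine ⟨(image R.1 Γ).relIndex Γ, by exact_mod_cast Nat.pos_of_ne_zero hR,
      image_le_iff.2 fun x hx => ?_⟩
    have h1 : (image R.1 Γ).relIndex Γ • x ∈ image R.1 Γ := by
      have := AddSubgroup.nsmul_index_mem ((image R.1 Γ).addSubgroupOf Γ) ⟨x, hx⟩
      exact this
    rw [mem_image_orthogonal_iff] at h1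
    rw [inv_val_eq_transpose, Matrix.smul_mulVec, ← Matrix.mulVec_smul]
    rwa [← Nat.cast_smul_eq_nsmul ℝ] at h1
  simpa using rationalOrthogonal_inv_mem (hΓ.OS_subset h)

theorem IsCubic.OC_eq {Γ : AddSubgroup (Fin 3 → ℝ)} (hΓ : IsCubic Γ) :
    OC Γ = rationalOrthogonal 3 :=
  Set.Subset.antisymm hΓ.OC_subset hΓ.rational_subset_OC

theorem IsCubic.OS_eq {Γ : AddSubgroup (Fin 3 → ℝ)} (hΓ : IsCubic Γ) :
    OS Γ = rationalOrthogonal 3 :=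
  Set.Subset.antisymm hΓ.OS_subset hΓ.rational_subset_OS

/-! ### The denominator -/

theorem isDen_mul_symmetry {d : ℕ} {Γ : AddSubgroup (Fin d → ℝ)}
    {R S : Matrix.orthogonalGroup (Fin d) ℝ} (hS : S ∈ symmetryGroup Γ) {δ : ℝ} :
    IsDen Γ (R * S) δ ↔ IsDen Γ R δ := by
  have h : Scal Γ (R * S) = Scal Γ R := by
    ext α
    change image (α • (R.1 * S.1)) Γ ≤ Γ ↔ image (α • R.1) Γ ≤ Γ
    rw [← Matrix.smul_mul, image_mul, show image S.1 Γ = Γ from hS]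
  rw [IsDen, IsDen, h]

theorem IsCubic.isDen_rotation {Γ : AddSubgroup (Fin 3 → ℝ)} (hΓ : IsCubic Γ)
    {q : ℍ[ℝ]} (hq : IsPrimitive q) {n : ℕ} (hN : Quaternion.normSq q = n) (hn : Odd n) :
    IsDen Γ (rotation q hq.ne_zero) n := by
  have hnpos := hn.pos
  have hnR : (n : ℝ) ≠ 0 := by positivity
  refine ⟨⟨image_le_iff.2 fun x hx => ?_, by positivity⟩, fun α hα => ?_⟩
  · rw [← hN]
    exact hΓ.conjMatrix_mem q hq.1 x hx
  · obtain ⟨hα, hpos⟩ := hα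
    have hα' := image_le_iff.1 hα
    change ∀ x ∈ Γ, (α • cayleyMatrix q) *ᵥ x ∈ Γ at hα'
    -- Composing αR(q) with x ↦ q̄ x q = n R(q)⁻¹x gives multiplication by αn.
    obtain ⟨m, hm⟩ := hΓ.exists_int_of_smul (α * n) fun x hx => by
      have h := hΓ.conjMatrix_mem _ (star_mem_hurwitz hq.1) _ (hα' x hx)
      rw [← natCast_smul_transpose_mulVec hnpos hN, Matrix.smul_mulVec, Matrix.mulVec_smul,
        Matrix.mulVec_mulVec, show (cayleyMatrix q)ᵀ * cayleyMatrix q = 1 from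
          transpose_mul_self (rotation q hq.ne_zero), Matrix.one_mulVec,
        smul_smul, mul_comm] at h
      exact h
    obtain ⟨A, hA⟩ := exists_int_conjMatrix hq.1
    have hdvd : ∀ i j, ((n ^ 2 : ℕ) : ℤ) ∣ 4 * m * A i j := fun i j => by
      obtain ⟨a, ha⟩ := hΓ.two_smul_mem_pc _ (hα' _ (hΓ.two_smul_mem _ (toReal_mem_pc (Pi.single j 1))))
      refine ⟨a i, ?_⟩
      have h1 := ha i
      have hs : toReal (Pi.single j 1) = Pi.single j 1 := by
        ext i
        by_cases h : i = j
        · subst h; simp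
        · simp [h]
      rw [hs, Matrix.mulVec_smul, Matrix.mulVec_single_one] at h1
      simp only [cayleyMatrix_eq, hN, hA, Pi.smul_apply, Matrix.col_apply, Matrix.smul_apply,
        Matrix.map_apply, smul_eq_mul] at h1
      have h2 : ((4 * m * A i j : ℤ) : ℝ) = ((n ^ 2 : ℕ) * a i : ℤ) := by
        push_cast
        rw [← h1, ← hm]
        field_simp
        ring
      exact_mod_cast h2
    -- Some integer combination of the entries of A is 1 modulo n, hence coprime to n². Thus n² | m
    -- = αn, so α is a multiple of n.
    have h4 : ((n ^ 2 : ℕ) : ℤ) ∣ 4 * m := by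
      obtain ⟨y, x, l, hxy⟩ := hq.exists_unimodular_mulVec hN hn hA
      have h5 : ((n ^ 2 : ℕ) : ℤ) ∣ 4 * m * (x ⬝ᵥ (A *ᵥ y)) := by
        simp only [dotProduct, Matrix.mulVec, Finset.mul_sum]
        refine Finset.dvd_sum fun i _ => Finset.dvd_sum fun j _ => ?_
        rw [show 4 * m * (x i * (A i j * y j)) = 4 * m * A i j * (x i * y j) by ring]
        exact (hdvd i j).mul_right _
      refine IsCoprime.dvd_of_dvd_mul_right ?_ h5
      push_cast
      exact IsCoprime.pow_left ⟨-l, 1, by linarith⟩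
    have h6 := dvd_of_odd_of_dvd_four_mul (hn.pow) h4
    obtain ⟨k, hk⟩ := h6
    have hαk : α = n * k := by
      have : α * n = ((n ^ 2 : ℕ) * k : ℤ) := by rw [hm, hk]
      push_cast at this
      have h7 : (n : ℝ) * α = n * (n * k) := by linarith
      exact mul_left_cancel₀ hnR h7
    have hkpos : 0 < k := by
      have : (0 : ℝ) < n * k := hαk ▸ hpos
      have hk0 : (0 : ℝ) < k := pos_of_mul_pos_right this (by positivity)
      exact_mod_cast hk0
    rw [hαk]
    have : (1 : ℝ) ≤ k := by exact_mod_cast hkpos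
    have hn0 : (0 : ℝ) ≤ n := by positivity
    nlinarith

/-! ### Counting coincidence site lattices -/

/-- Unimodular isotropic vectors over a ring, for the form `x² + y² + z²`. -/
def ConicPoint (R : Type*) [CommRing R] : Type _ :=
  {v : Fin 3 → R // v ⬝ᵥ v = 0 ∧ ∃ u, u ⬝ᵥ v = 1}

instance {R : Type*} [CommRing R] [Finite R] : Finite (ConicPoint R) := Subtype.finite

theorem intCast_dotProduct {R : Type*} [CommRing R] (v w : Fin 3 → ℤ) :
    ((v ⬝ᵥ w : ℤ) : R) = (fun i => (v i : R)) ⬝ᵥ fun i => (w i : R) := by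
  simp [dotProduct]

theorem conic_iff {n : ℕ} {v : Fin 3 → ℤ} : Conic n v ↔
    (fun i => (v i : ZMod n)) ⬝ᵥ (fun i => (v i : ZMod n)) = 0 ∧
      ∃ u : Fin 3 → ZMod n, u ⬝ᵥ (fun i => (v i : ZMod n)) = 1 := by
  constructor
  · rintro ⟨h, u, hu⟩
    refine ⟨?_, fun i => (u i : ZMod n), ?_⟩
    · rw [← intCast_dotProduct, ZMod.intCast_zmod_eq_zero_iff_dvd]
      exact h
    · rw [← intCast_dotProduct, ← sub_eq_zero, ← Int.cast_one, ← Int.cast_sub,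
        ZMod.intCast_zmod_eq_zero_iff_dvd]
      exact hu
  · rintro ⟨h, u, hu⟩
    refine ⟨?_, fun i => (u i).cast, ?_⟩
    · rw [← ZMod.intCast_zmod_eq_zero_iff_dvd, intCast_dotProduct]
      exact h
    · rw [← ZMod.intCast_zmod_eq_zero_iff_dvd, Int.cast_sub, intCast_dotProduct, Int.cast_one,
        sub_eq_zero, ← hu]
      simp

/-- Integer representatives of a vector modulo `n`. -/
def ConicPoint.lift {n : ℕ} (v : ConicPoint (ZMod n)) : Fin 3 → ℤ := fun i => (v.1 i).cast

theorem ConicPoint.intCast_lift {n : ℕ} (v : ConicPoint (ZMod n)) (i : Fin 3) :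
    ((v.lift i : ℤ) : ZMod n) = v.1 i := ZMod.intCast_zmod_cast _

theorem ConicPoint.conic_lift {n : ℕ} (v : ConicPoint (ZMod n)) : Conic n v.lift := by
  rw [conic_iff]
  simp only [v.intCast_lift]
  exact v.2

/-- Multiplication of a point by a unit. -/
def ConicPoint.unitSMul {R : Type*} [CommRing R] (t : Rˣ) (v : ConicPoint R) : ConicPoint R :=
  ⟨(t : R) • v.1, by rw [smul_dotProduct, dotProduct_smul, v.2.1, smul_zero, smul_zero], by
    obtain ⟨u, hu⟩ := v.2.2
    exact ⟨((t⁻¹ : Rˣ) : R) • u, by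
      rw [smul_dotProduct, dotProduct_smul, hu, smul_smul, Units.inv_mul, one_smul]⟩⟩

theorem ConicPoint.unitSMul_injective {R : Type*} [CommRing R] (v : ConicPoint R) :
    Function.Injective fun t : Rˣ => ConicPoint.unitSMul t v := by
  intro t t' h
  obtain ⟨u, hu⟩ := v.2.2
  have h1 : (t : R) • v.1 = (t' : R) • v.1 := congrArg Subtype.val h
  have h2 := congrArg (fun w => u ⬝ᵥ w) h1
  simp only [dotProduct_smul, hu, smul_eq_mul, mul_one] at h2
  exact Units.ext h2

theorem conicLattice_lift_eq_iff {Γ : AddSubgroup (Fin 3 → ℝ)} (hΓ : IsCubic Γ) {n : ℕ}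
    (hn : Odd n) (v w : ConicPoint (ZMod n)) :
    conicLattice Γ n v.lift = conicLattice Γ n w.lift ↔
      ∃ t : (ZMod n)ˣ, w = ConicPoint.unitSMul t v := by
  have key : ∀ (v w : ConicPoint (ZMod n)) (t : ℤ),
      (∀ i, (n : ℤ) ∣ w.lift i - t * v.lift i) ↔ w.1 = (t : ZMod n) • v.1 := by
    intro v w t
    rw [funext_iff]
    refine forall_congr' fun i => ?_
    rw [← ZMod.intCast_zmod_eq_zero_iff_dvd, Int.cast_sub, Int.cast_mul, sub_eq_zero,
      v.intCast_lift, w.intCast_lift]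
    rfl
  have hle : ∀ (v w : ConicPoint (ZMod n)) (t : (ZMod n)ˣ), w = ConicPoint.unitSMul t v →
      conicLattice Γ n v.lift ≤ conicLattice Γ n w.lift := by
    intro v w t h
    refine conicLattice_le_of_smul hΓ hn.pos (t := (t : ZMod n).cast) ((key v w _).2 ?_)
    rw [ZMod.intCast_zmod_cast]
    exact congrArg Subtype.val h
  constructor
  · intro h
    obtain ⟨t, ht⟩ := v.conic_lift.exists_smul_of_le hΓ hn h.le
    rw [key] at ht
    -- w = t v and ⟨u, w⟩ = 1 exhibit ⟨u, v⟩ as the inverse of t.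
    obtain ⟨u, hu⟩ := w.2.2
    rw [ht, dotProduct_smul, smul_eq_mul] at hu
    exact ⟨Units.mkOfMulEqOne _ _ hu, Subtype.ext ht⟩
  · rintro ⟨t, h⟩
    refine le_antisymm (hle v w t h) (hle w v t⁻¹ ?_)
    subst h
    apply Subtype.ext
    change v.1 = ((t⁻¹ : (ZMod n)ˣ) : ZMod n) • (t : ZMod n) • v.1
    rw [smul_smul, Units.inv_mul, one_smul]

theorem exists_lift_eq {Γ : AddSubgroup (Fin 3 → ℝ)} (hΓ : IsCubic Γ) {n : ℕ} (hn : 0 < n)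
    {v : Fin 3 → ℤ} (hv : Conic n v) :
    ∃ w : ConicPoint (ZMod n), conicLattice Γ n w.lift = conicLattice Γ n v := by
  let w : ConicPoint (ZMod n) := ⟨_, conic_iff.1 hv⟩
  have hw : ∀ i, ((w.lift i : ℤ) : ZMod n) = v i := w.intCast_lift
  refine ⟨w, ?_⟩
  apply le_antisymm <;> refine conicLattice_le_of_smul hΓ hn (t := 1) fun i => ?_ <;>
    rw [← ZMod.intCast_zmod_eq_zero_iff_dvd, Int.cast_sub, one_mul, hw, sub_self]

theorem IsCubic.exists_odd_of_mem_OC {Γ : AddSubgroup (Fin 3 → ℝ)} (hΓ : IsCubic Γ)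
    {R : Matrix.orthogonalGroup (Fin 3) ℝ} (hR : R ∈ OC Γ) :
    ∃ (q : ℍ[ℝ]) (hq : IsPrimitive q) (v : Fin 3 → ℤ),
      Conic (coincidenceIndex Γ R) v ∧ Odd (coincidenceIndex Γ R) ∧
      Generates q (coincidenceIndex Γ R) v ∧ csl Γ R = conicLattice Γ (coincidenceIndex Γ R) v ∧
      ∃ S ∈ symmetryGroup Γ, R = rotation q hq.ne_zero * S := by
  obtain ⟨q, hq, n, hN, hn, S, hS, rfl⟩ := exists_rotation_of_rational (hΓ.OC_subset hR)
  rw [coincidenceIndex_mul_symmetry (hS Γ hΓ), csl_mul_symmetry (hS Γ hΓ),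
    hΓ.coincidenceIndex_rotation hq hN hn]
  obtain ⟨v, hv, hqv⟩ := hq.exists_conic hN hn
  exact ⟨q, hq, v, hv, hn, hqv, hqv.csl_eq hΓ hn hv hq.ne_zero, S, hS Γ hΓ, rfl⟩

theorem IsCubic.cslsOfIndex_eq_empty {Γ : AddSubgroup (Fin 3 → ℝ)} (hΓ : IsCubic Γ) {n : ℕ}
    (hn : ¬ Odd n) : cslsOfIndex Γ n = ∅ := by
  rw [Set.eq_empty_iff_forall_notMem]
  rintro Λ ⟨⟨R, hR, rfl⟩, rfl⟩
  obtain ⟨q, hq, v, hv, hodd, -⟩ := hΓ.exists_odd_of_mem_OC hR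
  exact hn hodd

/-- The primitive quaternion of a coincidence isometry yields a point of the conic, and each point
yields such a quaternion, whose CSL is the lattice of the point. -/
theorem IsCubic.cslsOfIndex_eq_range {Γ : AddSubgroup (Fin 3 → ℝ)} (hΓ : IsCubic Γ) {n : ℕ}
    (hn : Odd n) :
    cslsOfIndex Γ n = Set.range fun v : ConicPoint (ZMod n) => conicLattice Γ n v.lift := by
  ext Λ
  constructor
  · rintro ⟨⟨R, hR, rfl⟩, hindex⟩
    obtain ⟨q, hq, v, hv, -, -, h, -⟩ := hΓ.exists_odd_of_mem_OC hR
    rw [show coincidenceIndex Γ R = n from hindex] at hv h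
    obtain ⟨w, hw⟩ := exists_lift_eq hΓ hn.pos hv
    exact ⟨w, hw.trans h.symm⟩
  · rintro ⟨v, rfl⟩
    obtain ⟨q, hq, hqv⟩ := v.conic_lift.exists_generates hn.pos
    refine ⟨⟨rotation q hq.ne_zero, ?_, (hqv.csl_eq hΓ hn v.conic_lift hq.ne_zero).symm⟩,
      relIndex_conicLattice hΓ hn v.conic_lift⟩
    exact hΓ.rational_subset_OC (rotation_mem_rationalOrthogonal hq.1 hq.ne_zero)

theorem IsCubic.finite_cslsOfIndex {Γ : AddSubgroup (Fin 3 → ℝ)} (hΓ : IsCubic Γ) (n : ℕ) :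
    (cslsOfIndex Γ n).Finite := by
  by_cases hn : Odd n
  · have : NeZero n := ⟨hn.pos.ne'⟩
    rw [hΓ.cslsOfIndex_eq_range hn]
    exact Set.finite_range _
  · rw [hΓ.cslsOfIndex_eq_empty hn]
    exact Set.finite_empty

/-- The φ(n) units act freely on unimodular vectors, and their orbits are the fibres of the map to
the CSLs. -/
theorem IsCubic.card_conicPoint {Γ : AddSubgroup (Fin 3 → ℝ)} (hΓ : IsCubic Γ) {n : ℕ}
    (hn : Odd n) : Nat.card (ConicPoint (ZMod n)) = c Γ n * n.totient := by
  have : NeZero n := ⟨hn.pos.ne'⟩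
  let f : ConicPoint (ZMod n) → AddSubgroup (Fin 3 → ℝ) := fun v => conicLattice Γ n v.lift
  have hf : ∀ v w, f v = f w ↔ ∃ t : (ZMod n)ˣ, w = ConicPoint.unitSMul t v :=
    fun v w => conicLattice_lift_eq_iff hΓ hn v w
  have hc : c Γ n = Nat.card (Set.range f) := by
    rw [c, hΓ.cslsOfIndex_eq_range hn]
    rfl
  rw [hc, ← ZMod.card_units_eq_totient, ← Nat.card_eq_fintype_card, ← Nat.card_prod]
  have hsec : ∀ Λ : Set.range f, ∃ v, f v = Λ := fun Λ => Λ.2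
  choose s hs using hsec
  symm
  refine Nat.card_congr (Equiv.ofBijective
    (fun x : Set.range f × (ZMod n)ˣ => ConicPoint.unitSMul x.2 (s x.1)) ⟨?_, ?_⟩)
  · rintro ⟨Λ, t⟩ ⟨Λ', t'⟩ h
    have h1 := (hf (s Λ) _).2 ⟨t, rfl⟩
    have h2 := (hf (s Λ') _).2 ⟨t', rfl⟩
    simp only at h
    rw [h, ← h2, hs, hs] at h1
    have : Λ = Λ' := Subtype.ext h1
    subst this
    rw [(s Λ).unitSMul_injective h]
  · intro v
    obtain ⟨t, ht⟩ := (hf (s ⟨f v, v, rfl⟩) v).1 (hs _)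
    exact ⟨⟨⟨f v, v, rfl⟩, t⟩, ht.symm⟩

/-! ### Coincidence isometries modulo symmetries -/

/-- Equal CSLs have proportional isotropic vectors, so the quaternions generate the same right ideal
and differ by a unit on the right; the rotation of a unit preserves Γ. -/
theorem IsCubic.inv_mul_mem_of_csl_eq {Γ : AddSubgroup (Fin 3 → ℝ)} (hΓ : IsCubic Γ)
    {R R' : Matrix.orthogonalGroup (Fin 3) ℝ} (hR : R ∈ OC Γ) (hR' : R' ∈ OC Γ)
    (h : csl Γ R = csl Γ R') : R⁻¹ * R' ∈ symmetryGroup Γ := by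
  obtain ⟨q, hq, v, hv, hodd, hqv, hcsl, S, hS, hRS⟩ := hΓ.exists_odd_of_mem_OC hR
  obtain ⟨q', hq', v', hv', -, hqv', hcsl', S', hS', hRS'⟩ := hΓ.exists_odd_of_mem_OC hR'
  have hindex : coincidenceIndex Γ R' = coincidenceIndex Γ R := by
    rw [coincidenceIndex, coincidenceIndex, h]
  rw [hindex] at hqv' hcsl'
  obtain ⟨t, ht⟩ := hv.exists_smul_of_le hΓ hodd (hcsl.symm.trans (h.trans hcsl')).le
  obtain ⟨u, hu, hN, hqu⟩ := hqv.exists_unit hodd.pos hqv' ht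
  have hu0 : u ≠ 0 := by
    rw [← Quaternion.normSq_ne_zero, hN]
    exact one_ne_zero
  have hrot : rotation q' hq'.ne_zero = rotation q hq.ne_zero * rotation u hu0 := by
    subst hqu
    exact rotation_mul _ _
  rw [hRS, hRS', hrot, mul_inv_rev]
  have : S⁻¹ * (rotation q hq.ne_zero)⁻¹ * (rotation q hq.ne_zero * rotation u hu0 * S')
      = S⁻¹ * (rotation u hu0 * S') := by group
  rw [this]
  exact mul_mem (inv_mem hS) (mul_mem (hΓ.rotation_unit_mem hu hN hu0) hS')

/-- The coincidence site lattice of a class of isometries modulo symmetries. -/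
def cslOfClass (Γ : AddSubgroup (Fin 3 → ℝ)) :
    Matrix.orthogonalGroup (Fin 3) ℝ ⧸ symmetryGroup Γ → AddSubgroup (Fin 3 → ℝ) :=
  Quotient.lift (csl Γ) fun R R' h => by
    have h' := QuotientGroup.leftRel_apply.1 h
    rw [← csl_mul_symmetry h', mul_inv_cancel_left]

theorem image_cslOfClass (Γ : AddSubgroup (Fin 3 → ℝ)) (n : ℕ) :
    cslOfClass Γ '' isosOfIndex Γ n = cslsOfIndex Γ n := by
  ext Λ
  constructor
  · rintro ⟨_, ⟨R, ⟨hR, hn⟩, rfl⟩, rfl⟩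
    exact ⟨⟨R, hR, rfl⟩, hn⟩
  · rintro ⟨⟨R, hR, rfl⟩, hn⟩
    exact ⟨_, ⟨R, ⟨hR, hn⟩, rfl⟩, rfl⟩

theorem IsCubic.injOn_cslOfClass {Γ : AddSubgroup (Fin 3 → ℝ)} (hΓ : IsCubic Γ) (n : ℕ) :
    Set.InjOn (cslOfClass Γ) (isosOfIndex Γ n) := by
  rintro _ ⟨R, ⟨hR, -⟩, rfl⟩ _ ⟨R', ⟨hR', -⟩, rfl⟩ h
  exact QuotientGroup.eq.2 (hΓ.inv_mul_mem_of_csl_eq hR hR' h)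

theorem IsCubic.finite_isosOfIndex {Γ : AddSubgroup (Fin 3 → ℝ)} (hΓ : IsCubic Γ) (n : ℕ) :
    (isosOfIndex Γ n).Finite :=
  Set.Finite.of_finite_image (by rw [image_cslOfClass]; exact hΓ.finite_cslsOfIndex n)
    (hΓ.injOn_cslOfClass n)

theorem IsCubic.c_eq_cIso {Γ : AddSubgroup (Fin 3 → ℝ)} (hΓ : IsCubic Γ) (n : ℕ) :
    c Γ n = cIso Γ n := by
  rw [c, cIso, ← image_cslOfClass, (hΓ.injOn_cslOfClass n).ncard_image]

/-! ### The number of points of the conic -/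

/-- A ring isomorphism induces a bijection of the points of the conic. -/
def ConicPoint.congr {R S : Type*} [CommRing R] [CommRing S] (e : R ≃+* S) :
    ConicPoint R ≃ ConicPoint S where
  toFun v := ⟨fun i => e (v.1 i), by
      have := congrArg e v.2.1
      simpa [dotProduct] using this, by
      obtain ⟨u, hu⟩ := v.2.2
      have := congrArg e hu
      exact ⟨fun i => e (u i), by simpa [dotProduct] using this⟩⟩
  invFun v := ⟨fun i => e.symm (v.1 i), by
      have := congrArg e.symm v.2.1
      simpa [dotProduct] using this, by
      obtain ⟨u, hu⟩ := v.2.2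
      have := congrArg e.symm hu
      exact ⟨fun i => e.symm (u i), by simpa [dotProduct] using this⟩⟩
  left_inv v := Subtype.ext (funext fun i => e.symm_apply_apply _)
  right_inv v := Subtype.ext (funext fun i => e.apply_symm_apply _)

/-- The points of the conic over a product ring. -/
def ConicPoint.prodEquiv (R S : Type*) [CommRing R] [CommRing S] :
    ConicPoint (R × S) ≃ ConicPoint R × ConicPoint S where
  toFun v := ⟨⟨fun i => (v.1 i).1, by
        have := congrArg Prod.fst v.2.1
        simpa [dotProduct, Fin.sum_univ_three] using this, by
        obtain ⟨u, hu⟩ := v.2.2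
        have := congrArg Prod.fst hu
        exact ⟨fun i => (u i).1, by simpa [dotProduct, Fin.sum_univ_three] using this⟩⟩,
      ⟨fun i => (v.1 i).2, by
        have := congrArg Prod.snd v.2.1
        simpa [dotProduct, Fin.sum_univ_three] using this, by
        obtain ⟨u, hu⟩ := v.2.2
        have := congrArg Prod.snd hu
        exact ⟨fun i => (u i).2, by simpa [dotProduct, Fin.sum_univ_three] using this⟩⟩⟩
  invFun v := ⟨fun i => (v.1.1 i, v.2.1 i), by
      have h1 := v.1.2.1
      have h2 := v.2.2.1
      simp only [dotProduct, Fin.sum_univ_three] at h1 h2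
      simp [dotProduct, Fin.sum_univ_three, h1, h2], by
      obtain ⟨u, hu⟩ := v.1.2.2
      obtain ⟨w, hw⟩ := v.2.2.2
      simp only [dotProduct, Fin.sum_univ_three] at hu hw
      exact ⟨fun i => (u i, w i), by simp [dotProduct, Fin.sum_univ_three, hu, hw]⟩⟩
  left_inv v := rfl
  right_inv v := rfl

theorem card_conicPoint_mul {m n : ℕ} (h : Nat.Coprime m n) :
    Nat.card (ConicPoint (ZMod (m * n)))
      = Nat.card (ConicPoint (ZMod m)) * Nat.card (ConicPoint (ZMod n)) := by
  rw [Nat.card_congr (ConicPoint.congr (ZMod.chineseRemainder h)),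
    Nat.card_congr (ConicPoint.prodEquiv _ _), Nat.card_prod]

/-- Modulo an odd number, `-1` is a sum of two squares. -/
theorem exists_sq_add_sq_eq_neg_one {n : ℕ} (hn : Odd n) :
    ∃ a b : ZMod n, a ^ 2 + b ^ 2 = -1 := by
  have hcop : Nat.Coprime 4 n := Nat.Coprime.pow_left 2 hn.coprime_two_left
  have : NeZero (4 * n) := ⟨by have := hn.pos; omega⟩
  let e := ZMod.chineseRemainder hcop
  -- By Dirichlet's theorem there is a prime p with p ≡ 1 modulo 4 and p ≡ -1 modulo n, and such a p
  -- is a sum of two squares.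
  have hu : IsUnit (e.symm (1, -1)) := by
    refine IsUnit.map e.symm ?_
    rw [Prod.isUnit_iff]
    exact ⟨isUnit_one, isUnit_one.neg⟩
  obtain ⟨p, -, hp, hpe⟩ := Nat.forall_exists_prime_gt_and_eq_mod hu 0
  have he : ((p : ZMod 4), (p : ZMod n)) = (1, -1) := by
    have := congrArg e hpe
    rw [e.apply_symm_apply, map_natCast] at this
    rw [← this]
    rfl
  obtain ⟨h4, hpn⟩ := Prod.ext_iff.1 he
  have : Fact p.Prime := ⟨hp⟩
  have hp4 : p % 4 = 1 := by
    have : ((p : ℕ) : ZMod 4) = ((1 : ℕ) : ZMod 4) := by simpa using h4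
    rw [ZMod.natCast_eq_natCast_iff'] at this
    exact this
  obtain ⟨a, b, hab⟩ := Nat.Prime.sq_add_sq (p := p) (by omega)
  refine ⟨a, b, ?_⟩
  rw [← show (p : ZMod n) = -1 from hpn, ← hab]
  push_cast
  rfl

/-- Unimodular vectors on the split cone `x z = y²`. -/
def ConePoint (R : Type*) [CommRing R] : Type _ :=
  {v : Fin 3 → R // v 0 * v 2 = v 1 ^ 2 ∧ ∃ u, u ⬝ᵥ v = 1}

instance {R : Type*} [CommRing R] [Finite R] : Finite (ConePoint R) := Subtype.finite

/-- If `-1` is a sum of two squares and `2` is invertible, then the conic splits. -/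
def ConicPoint.coneEquiv {R : Type*} [CommRing R] {a b h : R} (hab : a ^ 2 + b ^ 2 = -1)
    (hh : 2 * h = 1) : ConePoint R ≃ ConicPoint R where
  -- As a² + b² = -1, the squares of the last two coordinates add up to -(x - z)² - 4y², so the form
  -- becomes (x + z)² - (x - z)² - 4y² = 4(xz - y²).
  toFun v := ⟨![v.1 0 + v.1 2, a * (v.1 0 - v.1 2) + 2 * b * v.1 1,
      b * (v.1 0 - v.1 2) - 2 * a * v.1 1], by
        simp [dotProduct, Fin.sum_univ_three]
        linear_combination 4 * v.2.1 + ((v.1 0 - v.1 2) ^ 2 + 4 * v.1 1 ^ 2) * hab, by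
        obtain ⟨u, hu⟩ := v.2.2
        simp only [dotProduct, Fin.sum_univ_three] at hu
        refine ⟨![h * (u 0 + u 2), -h * (a * (u 0 - u 2) + b * u 1),
          -h * (b * (u 0 - u 2) - a * u 1)], ?_⟩
        simp [dotProduct, Fin.sum_univ_three]
        linear_combination hu - h * ((u 0 - u 2) * (v.1 0 - v.1 2) + 2 * u 1 * v.1 1) * hab
          + (u 0 * v.1 0 + u 2 * v.1 2 + u 1 * v.1 1) * hh⟩
  invFun v := ⟨![h * (v.1 0 - a * v.1 1 - b * v.1 2), h * (a * v.1 2 - b * v.1 1),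
      h * (v.1 0 + a * v.1 1 + b * v.1 2)], by
        have hv := v.2.1
        simp only [dotProduct, Fin.sum_univ_three] at hv
        simp
        linear_combination h ^ 2 * hv - h ^ 2 * (v.1 1 ^ 2 + v.1 2 ^ 2) * hab, by
        obtain ⟨u, hu⟩ := v.2.2
        simp only [dotProduct, Fin.sum_univ_three] at hu
        refine ⟨![u 0 + (a * u 1 + b * u 2), 2 * (b * u 1 - a * u 2),
          u 0 - (a * u 1 + b * u 2)], ?_⟩
        simp [dotProduct, Fin.sum_univ_three]
        linear_combination hu - 2 * h * (u 1 * v.1 1 + u 2 * v.1 2) * hab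
          + (u 0 * v.1 0 + u 1 * v.1 1 + u 2 * v.1 2) * hh⟩
  left_inv v := by
    apply Subtype.ext
    ext i
    fin_cases i <;> simp
    · linear_combination v.1 0 * hh - h * (v.1 0 - v.1 2) * hab
    · linear_combination v.1 1 * hh - 2 * h * v.1 1 * hab
    · linear_combination v.1 2 * hh + h * (v.1 0 - v.1 2) * hab
  right_inv v := by
    apply Subtype.ext
    ext i
    fin_cases i <;> simp
    · linear_combination v.1 0 * hh
    · linear_combination v.1 1 * hh - 2 * h * v.1 1 * hab
    · linear_combination v.1 2 * hh - 2 * h * v.1 2 * hab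

/-- In a local ring a unimodular vector (x, y, z) has a unit coordinate. If x is a unit, y is free
and z = y²/x. Otherwise y² = xz makes y a nonunit, so z is a unit and x = y²/z. -/
theorem card_conePoint (R : Type*) [CommRing R] [Finite R] [IsLocalRing R] :
    Nat.card (ConePoint R) = Nat.card Rˣ * (2 * Nat.card R - Nat.card Rˣ) := by
  classical
  have hnon : ∀ v : ConePoint R, ¬ IsUnit (v.1 0) → IsUnit (v.1 2) ∧ ¬ IsUnit (v.1 1) := by
    intro v h0
    have h1 : ¬ IsUnit (v.1 1) := fun h1 => by
      have := v.2.1 ▸ h1.pow 2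
      exact h0 (isUnit_of_mul_isUnit_left this)
    refine ⟨?_, h1⟩
    by_contra h2
    obtain ⟨u, hu⟩ := v.2.2
    simp only [dotProduct, Fin.sum_univ_three] at hu
    have hnu : ∀ i, v.1 i ∈ nonunits R → u i * v.1 i ∈ nonunits R :=
      fun i h h' => h (isUnit_of_mul_isUnit_right h')
    have := IsLocalRing.nonunits_add (IsLocalRing.nonunits_add (hnu 0 h0) (hnu 1 h1)) (hnu 2 h2)
    rw [hu] at this
    exact this isUnit_one
  have e1 : {v : ConePoint R // IsUnit (v.1 0)} ≃ Rˣ × R :=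
    { toFun := fun v => (v.2.unit, v.1.1 1)
      invFun := fun x => ⟨⟨![x.1, x.2, x.2 ^ 2 * ((x.1⁻¹ : Rˣ) : R)], by
        simp [mul_comm], ![((x.1⁻¹ : Rˣ) : R), 0, 0], by
        simp [dotProduct, Fin.sum_univ_three]⟩, x.1.isUnit⟩
      left_inv := fun v => by
        apply Subtype.ext
        apply Subtype.ext
        ext i
        fin_cases i
        · rfl
        · rfl
        · change v.1.1 1 ^ 2 * ((v.2.unit⁻¹ : Rˣ) : R) = v.1.1 2
          rw [Units.mul_inv_eq_iff_eq_mul, ← v.1.2.1, mul_comm]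
          rfl
      right_inv := fun x => by
        ext <;> simp }
  have e2 : {v : ConePoint R // ¬ IsUnit (v.1 0)} ≃ Rˣ × {y : R // ¬ IsUnit y} :=
    { toFun := fun v => ((hnon v.1 v.2).1.unit, ⟨v.1.1 1, (hnon v.1 v.2).2⟩)
      invFun := fun x => ⟨⟨![x.2 ^ 2 * ((x.1⁻¹ : Rˣ) : R), x.2, x.1], by
        simp, ![0, 0, ((x.1⁻¹ : Rˣ) : R)], by
        simp [dotProduct, Fin.sum_univ_three]⟩, by
          intro h
          have h' : IsUnit ((x.2 : R) ^ 2 * ((x.1⁻¹ : Rˣ) : R)) := h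
          have := isUnit_of_mul_isUnit_left h'
          exact x.2.2 ((isUnit_pow_iff two_ne_zero).1 this)⟩
      left_inv := fun v => by
        apply Subtype.ext
        apply Subtype.ext
        ext i
        fin_cases i
        · change v.1.1 1 ^ 2 * (((hnon v.1 v.2).1.unit⁻¹ : Rˣ) : R) = v.1.1 0
          rw [Units.mul_inv_eq_iff_eq_mul, ← v.1.2.1]
          rfl
        · rfl
        · rfl
      right_inv := fun x => by
        ext <;> simp }
  have e3 : {y : R // IsUnit y} ≃ Rˣ :=
    { toFun := fun y => y.2.unit
      invFun := fun x => ⟨x, x.isUnit⟩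
      left_inv := fun y => rfl
      right_inv := fun x => by ext; rfl }
  have h1 := Nat.card_congr (Equiv.sumCompl fun v : ConePoint R => IsUnit (v.1 0))
  have h2 := Nat.card_congr (Equiv.sumCompl fun y : R => IsUnit y)
  rw [Nat.card_sum, Nat.card_congr e1, Nat.card_congr e2, Nat.card_prod, Nat.card_prod] at h1
  rw [Nat.card_sum, Nat.card_congr e3] at h2
  rw [← h1, ← mul_add]
  congr 1
  omega

/-- A nontrivial quotient of the local ring of p-adic integers. -/
theorem isLocalRing_zmod_prime_pow {p : ℕ} (hp : p.Prime) {r : ℕ} (hr : 1 ≤ r) :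
    IsLocalRing (ZMod (p ^ r)) := by
  have : Fact p.Prime := ⟨hp⟩
  have : Fact (1 < p ^ r) := ⟨Nat.one_lt_pow (by omega) hp.one_lt⟩
  exact IsLocalRing.of_surjective' (PadicInt.toZModPow (p := p) r)
    (ZMod.ringHom_surjective _)

theorem card_conicPoint_prime_pow {p : ℕ} (hp : p.Prime) (hp2 : p ≠ 2) {r : ℕ} (hr : 1 ≤ r) :
    Nat.card (ConicPoint (ZMod (p ^ r))) = ((p + 1) * p ^ (r - 1)) * (p ^ r).totient := by
  have hodd : Odd (p ^ r) := (hp.odd_of_ne_two hp2).pow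
  have : NeZero (p ^ r) := ⟨hodd.pos.ne'⟩
  have := isLocalRing_zmod_prime_pow hp hr
  obtain ⟨a, b, hab⟩ := exists_sq_add_sq_eq_neg_one hodd
  have h2 : (2 : ZMod (p ^ r)) * (2 : ZMod (p ^ r))⁻¹ = 1 := by
    have := ZMod.coe_mul_inv_eq_one 2 (n := p ^ r) hodd.coprime_two_left
    exact_mod_cast this
  rw [← Nat.card_congr (ConicPoint.coneEquiv hab h2), card_conePoint, Nat.card_zmod,
    Nat.card_eq_fintype_card, ZMod.card_units_eq_totient, mul_comm]
  congr 1
  -- 2p^r - φ(p^r) = p^r + p^(r-1).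
  rw [Nat.totient_prime_pow hp hr]
  obtain ⟨s, rfl⟩ := Nat.exists_eq_add_of_le' hr
  obtain ⟨m, rfl⟩ := Nat.exists_eq_add_of_le' hp.one_le
  simp only [Nat.add_sub_cancel, pow_succ]
  apply Nat.sub_eq_of_eq_add
  ring

/-! ### The counting function -/

/-- The number of points of the conic over ℤ/n does not involve the lattice, and φ(n) cancels. -/
theorem IsCubic.c_eq {Γ Γ' : AddSubgroup (Fin 3 → ℝ)} (hΓ : IsCubic Γ) (hΓ' : IsCubic Γ')
    (n : ℕ) : c Γ n = c Γ' n := by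
  by_cases hn : Odd n
  · have h := (hΓ.card_conicPoint hn).symm.trans (hΓ'.card_conicPoint hn)
    exact Nat.eq_of_mul_eq_mul_right (Nat.totient_pos.2 hn.pos) h
  · rw [c, c, hΓ.cslsOfIndex_eq_empty hn, hΓ'.cslsOfIndex_eq_empty hn]

theorem IsCubic.c_of_not_odd {Γ : AddSubgroup (Fin 3 → ℝ)} (hΓ : IsCubic Γ) {n : ℕ}
    (hn : ¬ Odd n) : c Γ n = 0 := by
  rw [c, hΓ.cslsOfIndex_eq_empty hn, Set.ncard_empty]

theorem IsCubic.c_mul {Γ : AddSubgroup (Fin 3 → ℝ)} (hΓ : IsCubic Γ) {m n : ℕ}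
    (h : Nat.Coprime m n) : c Γ (m * n) = c Γ m * c Γ n := by
  by_cases hm : Odd m
  · by_cases hn : Odd n
    · have h1 := hΓ.card_conicPoint (hm.mul hn)
      rw [card_conicPoint_mul h, hΓ.card_conicPoint hm, hΓ.card_conicPoint hn,
        Nat.totient_mul h] at h1
      refine (Nat.eq_of_mul_eq_mul_right
        (Nat.mul_pos (Nat.totient_pos.2 hm.pos) (Nat.totient_pos.2 hn.pos)) ?_).symm
      rw [← h1]
      ring
    · rw [hΓ.c_of_not_odd hn, hΓ.c_of_not_odd (fun h => hn (Nat.odd_mul.1 h).2), mul_zero]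
  · rw [hΓ.c_of_not_odd hm, hΓ.c_of_not_odd (fun h => hm (Nat.odd_mul.1 h).1), zero_mul]

theorem IsCubic.c_prime_pow {Γ : AddSubgroup (Fin 3 → ℝ)} (hΓ : IsCubic Γ) {p r : ℕ}
    (hp : p.Prime) (hp2 : p ≠ 2) (hr : 1 ≤ r) : c Γ (p ^ r) = (p + 1) * p ^ (r - 1) := by
  have hodd : Odd (p ^ r) := (hp.odd_of_ne_two hp2).pow
  have h := hΓ.card_conicPoint hodd
  rw [card_conicPoint_prime_pow hp hp2 hr] at h
  exact (Nat.eq_of_mul_eq_mul_right (Nat.totient_pos.2 hodd.pos) h).symm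

theorem IsCubic.c_two_pow {Γ : AddSubgroup (Fin 3 → ℝ)} (hΓ : IsCubic Γ) {r : ℕ} (hr : 1 ≤ r) :
    c Γ (2 ^ r) = 0 := by
  apply hΓ.c_of_not_odd
  rw [Nat.not_odd_iff_even]
  exact even_two.pow_of_ne_zero (by omega)

theorem IsCubic.c_ne_zero_iff {Γ : AddSubgroup (Fin 3 → ℝ)} (hΓ : IsCubic Γ) (n : ℕ) :
    c Γ n ≠ 0 ↔ Odd n := by
  constructor
  · intro h
    by_contra hn
    exact h (hΓ.c_of_not_odd hn)
  · intro hn h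
    have : NeZero n := ⟨hn.pos.ne'⟩
    have hcard := hΓ.card_conicPoint hn
    rw [h, zero_mul] at hcard
    obtain ⟨a, b, hab⟩ := exists_sq_add_sq_eq_neg_one hn
    -- The point (1, a, b) with a² + b² = -1.
    have : Nonempty (ConicPoint (ZMod n)) := ⟨⟨![1, a, b], by
      simp [dotProduct, Fin.sum_univ_three]
      linear_combination hab, ![1, 0, 0], by simp [dotProduct, Fin.sum_univ_three]⟩⟩
    exact Nat.card_pos.ne' hcard

/-- c(1) = c(1)², and c(1) is nonzero because 1 is odd. -/
theorem IsCubic.c_one {Γ : AddSubgroup (Fin 3 → ℝ)} (hΓ : IsCubic Γ) : c Γ 1 = 1 := by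
  have h := hΓ.c_mul (Nat.coprime_one_left 1)
  have h0 := (hΓ.c_ne_zero_iff 1).2 odd_one
  rw [mul_one] at h
  exact Nat.eq_of_mul_eq_mul_left (Nat.pos_of_ne_zero h0) (by rw [← h, mul_one])

/-! ### The Dirichlet series -/

theorem lseriesSummable_natCast {s : ℂ} (hs : 2 < s.re) :
    LSeriesSummable (fun n : ℕ => (n : ℂ)) s := by
  refine LSeriesSummable_of_le_const_mul_rpow (x := 2) hs ⟨1, fun n _ => ?_⟩
  norm_num

theorem lseriesSummable_sigma {s : ℂ} (hs : 2 < s.re) :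
    LSeriesSummable (fun n : ℕ => ((ArithmeticFunction.sigma 1 n : ℕ) : ℂ)) s := by
  have h1 : LSeriesSummable 1 s := LSeriesSummable_one_iff.2 (by linarith)
  refine (LSeriesSummable_congr s fun {n} _ => ?_).1
    (h1.convolution (lseriesSummable_natCast hs))
  rw [LSeries.convolution_def, ArithmeticFunction.sigma_one_apply]
  simp only [Pi.one_apply, one_mul]
  rw [Nat.sum_divisorsAntidiagonal' (f := fun _ d => (d : ℂ))]
  push_cast
  rfl

/-- Gives absolute convergence for Re s > 2. At an odd prime power c is the sum p^r + p^(r-1) of the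
two largest divisors, and both sides are multiplicative. -/
theorem IsCubic.c_le_sigma {Γ : AddSubgroup (Fin 3 → ℝ)} (hΓ : IsCubic Γ) (n : ℕ) :
    c Γ n ≤ ArithmeticFunction.sigma 1 n := by
  induction n using Nat.recOnPosPrimePosCoprime with
  | zero => rw [hΓ.c_of_not_odd (by decide)]; exact Nat.zero_le _
  | one => rw [hΓ.c_one]; simp
  | prime_pow p r hp hr =>
    by_cases hp2 : p = 2
    · rw [hp2, hΓ.c_two_pow hr]
      exact Nat.zero_le _
    · rw [hΓ.c_prime_pow hp hp2 hr, ArithmeticFunction.sigma_one_apply_prime_pow hp]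
      obtain ⟨k, rfl⟩ := Nat.exists_eq_add_of_le' (Nat.one_le_iff_ne_zero.2 hr.ne')
      rw [Finset.sum_range_succ, Finset.sum_range_succ, Nat.add_sub_cancel, pow_succ]
      have := Nat.zero_le (∑ i ∈ Finset.range k, p ^ i)
      linarith [show (p + 1) * p ^ k = p ^ k + p ^ k * p by ring]
  | coprime a b _ _ hab iha ihb =>
    rw [hΓ.c_mul hab, ArithmeticFunction.isMultiplicative_sigma.map_mul_of_coprime hab]
    exact Nat.mul_le_mul iha ihb

theorem IsCubic.lseriesSummable_c {Γ : AddSubgroup (Fin 3 → ℝ)} (hΓ : IsCubic Γ) {s : ℂ}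
    (hs : 2 < s.re) : LSeriesSummable (fun n => (c Γ n : ℂ)) s := by
  refine Summable.of_norm_bounded (lseriesSummable_sigma hs).norm fun n => ?_
  apply LSeries.norm_term_le
  rw [Complex.norm_natCast, Complex.norm_natCast]
  exact_mod_cast hΓ.c_le_sigma n

theorem natCast_pow_cpow (p r : ℕ) (s : ℂ) : ((p ^ r : ℕ) : ℂ) ^ s = ((p : ℂ) ^ s) ^ r := by
  induction r with
  | zero => simp
  | succ r ih => rw [pow_succ, Nat.cast_mul, Complex.natCast_mul_natCast_cpow, ih, pow_succ]

theorem prime_cpow_one_sub {p : ℕ} (hp : p.Prime) (s : ℂ) :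
    (p : ℂ) ^ (1 - s) = p * (p : ℂ) ^ (-s) := by
  have hp0 : (p : ℂ) ≠ 0 := by exact_mod_cast hp.ne_zero
  rw [sub_eq_add_neg, Complex.cpow_add _ _ hp0, Complex.cpow_one]

theorem norm_prime_cpow_lt_one {p : ℕ} (hp : p.Prime) {s : ℂ} (hs : 0 < s.re) :
    ‖(p : ℂ) ^ (-s)‖ < 1 := by
  rw [Complex.norm_natCast_cpow_of_pos hp.pos, Complex.neg_re]
  exact Real.rpow_lt_one_of_one_lt_of_neg (by exact_mod_cast hp.one_lt) (by linarith)

theorem norm_prime_cpow_one_sub_lt_one {p : ℕ} (hp : p.Prime) {s : ℂ} (hs : 1 < s.re) :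
    ‖(p : ℂ) ^ (1 - s)‖ < 1 := by
  rw [← neg_sub]
  exact norm_prime_cpow_lt_one hp (by simpa using hs)

theorem one_sub_ne_zero_of_norm_lt_one {z : ℂ} (hz : ‖z‖ < 1) : 1 - z ≠ 0 := by
  intro h
  rw [← sub_eq_zero.1 h] at hz
  simp at hz

theorem one_add_ne_zero_of_norm_lt_one {z : ℂ} (hz : ‖z‖ < 1) : 1 + z ≠ 0 := by
  have := one_sub_ne_zero_of_norm_lt_one (z := -z) (by rwa [norm_neg])
  rwa [sub_neg_eq_add] at this

theorem term_prime_pow (f : ℕ → ℂ) (s : ℂ) {p : ℕ} (hp : p.Prime) (r : ℕ) :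
    LSeries.term f s (p ^ r) = f (p ^ r) * ((p : ℂ) ^ (-s)) ^ r := by
  rw [LSeries.term_of_ne_zero (pow_ne_zero r hp.ne_zero), natCast_pow_cpow, Complex.cpow_neg,
    inv_pow, div_eq_mul_inv]

/-- With x = p^(-s), the geometric series gives 1 + (p + 1)x/(1 - px) = (1 + x)/(1 - px) for odd p;
at 2 only the term r = 0 survives. -/
theorem IsCubic.tsum_prime_pow {Γ : AddSubgroup (Fin 3 → ℝ)} (hΓ : IsCubic Γ) {s : ℂ}
    (hs : 2 < s.re) {p : ℕ} (hp : p.Prime) :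
    ∑' r, LSeries.term (fun n => (c Γ n : ℂ)) s (p ^ r)
      = if p = 2 then 1 else (1 + (p : ℂ) ^ (-s)) / (1 - (p : ℂ) ^ (1 - s)) := by
  have h1 : ∀ r, LSeries.term (fun n => (c Γ n : ℂ)) s (p ^ r)
      = (c Γ (p ^ r) : ℂ) * ((p : ℂ) ^ (-s)) ^ r := fun r => term_prime_pow _ s hp r
  by_cases hp2 : p = 2
  · rw [if_pos hp2, tsum_eq_single 0]
    · rw [h1, pow_zero, pow_zero, hΓ.c_one]
      simp
    · intro r hr
      rw [h1, hp2, hΓ.c_two_pow (Nat.one_le_iff_ne_zero.2 hr)]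
      simp
  · rw [if_neg hp2]
    have hx := norm_prime_cpow_one_sub_lt_one hp (s := s) (by linarith)
    have hx1 := one_sub_ne_zero_of_norm_lt_one hx
    have hp0 : (p : ℂ) ≠ 0 := by exact_mod_cast hp.ne_zero
    have hsucc : ∀ r, LSeries.term (fun n => (c Γ n : ℂ)) s (p ^ (r + 1))
        = (p + 1) * (p : ℂ) ^ (-s) * ((p : ℂ) ^ (1 - s)) ^ r := fun r => by
      rw [h1, hΓ.c_prime_pow hp hp2 (by omega), Nat.add_sub_cancel, prime_cpow_one_sub hp]
      push_cast
      ring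
    have hsum := ((hasSum_geometric_of_norm_lt_one hx).mul_left ((p + 1) * (p : ℂ) ^ (-s)))
    simp only [← hsucc] at hsum
    have h0 := (hasSum_nat_add_iff (f := fun r => LSeries.term (fun n => (c Γ n : ℂ)) s (p ^ r))
      1).1 hsum
    rw [h0.tsum_eq, Finset.sum_range_one, h1, pow_zero, pow_zero, hΓ.c_one]
    rw [prime_cpow_one_sub hp] at hx1 ⊢
    field_simp
    push_cast
    ring

theorem IsCubic.hasProd_primes {Γ : AddSubgroup (Fin 3 → ℝ)} (hΓ : IsCubic Γ) {s : ℂ}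
    (hs : 2 < s.re) :
    HasProd (fun p : Nat.Primes => if (p : ℕ) = 2 then (1 : ℂ) else
      (1 + ((p : ℕ) : ℂ) ^ (-s)) / (1 - ((p : ℕ) : ℂ) ^ (1 - s)))
      (LSeries (fun n => (c Γ n : ℂ)) s) := by
  have h := EulerProduct.eulerProduct_hasProd (f := LSeries.term (fun n => (c Γ n : ℂ)) s)
    (by rw [LSeries.term_of_ne_zero one_ne_zero, hΓ.c_one]; simp)
    (fun {m n} hmn => by
      rcases eq_or_ne m 0 with rfl | hm
      · simp
      rcases eq_or_ne n 0 with rfl | hn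
      · simp
      rw [LSeries.term_of_ne_zero hm, LSeries.term_of_ne_zero hn,
        LSeries.term_of_ne_zero (mul_ne_zero hm hn), hΓ.c_mul hmn, Nat.cast_mul, Nat.cast_mul,
        Complex.natCast_mul_natCast_cpow, mul_div_mul_comm])
    (hΓ.lseriesSummable_c hs).norm (LSeries.term_zero _ _)
  simp only [fun p : Nat.Primes => hΓ.tsum_prime_pow hs p.2] at h
  exact h

theorem IsCubic.hasProd_odd_primes {Γ : AddSubgroup (Fin 3 → ℝ)} (hΓ : IsCubic Γ) {s : ℂ}
    (hs : 2 < s.re) :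
    HasProd (fun p : {p : Nat.Primes // (p : ℕ) ≠ 2} =>
      (1 + ((p : ℕ) : ℂ) ^ (-s)) / (1 - ((p : ℕ) : ℂ) ^ (1 - s)))
      (LSeries (fun n => (c Γ n : ℂ)) s) := by
  have h := hΓ.hasProd_primes hs
  rw [← hasProd_subtype_iff_of_mulSupport_subset (s := {p : Nat.Primes | (p : ℕ) ≠ 2})] at h
  · have hfun : (fun p : {p : Nat.Primes // (p : ℕ) ≠ 2} =>
        (1 + ((p : ℕ) : ℂ) ^ (-s)) / (1 - ((p : ℕ) : ℂ) ^ (1 - s)))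
        = (fun p : Nat.Primes => if (p : ℕ) = 2 then (1 : ℂ) else
          (1 + ((p : ℕ) : ℂ) ^ (-s)) / (1 - ((p : ℕ) : ℂ) ^ (1 - s))) ∘ Subtype.val :=
      funext fun p => (if_neg p.2).symm
    rw [hfun]
    exact h
  · intro p hp
    by_contra h2
    simp only [Set.mem_ofPred_eq, not_not] at h2
    exact hp (if_pos h2)

/-- Euler factors are compared. With x = p^(-s), for odd p one has (1 + x)/((1 - px)(1 - x²)) =
1/((1 - x)(1 - px)). -/
theorem IsCubic.lseries_c_mul_zeta {Γ : AddSubgroup (Fin 3 → ℝ)} (hΓ : IsCubic Γ) {s : ℂ}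
    (hs : 2 < s.re) :
    LSeries (fun n => (c Γ n : ℂ)) s * riemannZeta (2 * s)
      = (1 - (2 : ℂ) ^ (1 - s)) / (1 + (2 : ℂ) ^ (-s)) *
        (riemannZeta s * riemannZeta (s - 1)) := by
  have h1 := riemannZeta_eulerProduct_hasProd (s := s) (by linarith)
  have h2 := riemannZeta_eulerProduct_hasProd (s := s - 1) (by
    rw [Complex.sub_re, Complex.one_re]; linarith)
  have h3 := riemannZeta_eulerProduct_hasProd (s := 2 * s) (by
    simp only [Complex.mul_re, Complex.re_ofNat, Complex.im_ofNat, zero_mul, sub_zero]; linarith)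
  -- A product with one nontrivial factor, which corrects the prime 2, where the Euler factor of c
  -- is 1.
  have h4 := hasProd_ite_eq (⟨2, Nat.prime_two⟩ : Nat.Primes)
    ((1 - (2 : ℂ) ^ (1 - s)) / (1 + (2 : ℂ) ^ (-s)))
  have hl := (hΓ.hasProd_primes hs).mul h3
  have hr := h4.mul (h1.mul h2)
  refine hl.unique (hr.congr_fun fun p => ?_)
  have hp := p.2
  have hx := norm_prime_cpow_lt_one hp (s := s) (by linarith)
  have hy := norm_prime_cpow_one_sub_lt_one hp (s := s) (by linarith)
  have hx1 := one_sub_ne_zero_of_norm_lt_one hx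
  have hx2 := one_add_ne_zero_of_norm_lt_one hx
  have hy1 := one_sub_ne_zero_of_norm_lt_one hy
  have hsq : ((p : ℕ) : ℂ) ^ (-(2 * s)) = (((p : ℕ) : ℂ) ^ (-s)) ^ 2 := by
    rw [← Complex.cpow_nat_mul]
    congr 1
    push_cast
    ring
  have hfac : (1 : ℂ) - (((p : ℕ) : ℂ) ^ (-s)) ^ 2
      = (1 - ((p : ℕ) : ℂ) ^ (-s)) * (1 + ((p : ℕ) : ℂ) ^ (-s)) := by ring
  rw [neg_sub, hsq, hfac]
  by_cases hp2 : (p : ℕ) = 2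
  · have hpeq : p = ⟨2, Nat.prime_two⟩ := Subtype.ext hp2
    rw [if_pos hp2, if_pos hpeq]
    rw [hp2] at hx1 hx2 hy1 ⊢
    push_cast at hx1 hx2 hy1 ⊢
    field_simp
  · have hpne : p ≠ ⟨2, Nat.prime_two⟩ := fun h => hp2 (congrArg Subtype.val h)
    rw [if_neg hp2, if_neg hpne]
    field_simp

/-! ### The index of a principal left ideal -/

/-- The Hurwitz quaternion with coordinates `a` in the basis `(1 + i + j + k) / 2, i, j, k`. -/
def hurwitzOfCoords : (Fin 4 → ℤ) →+ hurwitz where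
  toFun a := ⟨quat (a 0 / 2) (a 0 / 2 + a 1) (a 0 / 2 + a 2) (a 0 / 2 + a 3), by
    obtain ⟨k, hk | hk⟩ := Int.even_or_odd' (a 0)
    · refine Or.inl ⟨k, k + a 1, k + a 2, k + a 3, ?_, ?_, ?_, ?_⟩ <;> simp [hk]
    · refine Or.inr ⟨k, k + a 1, k + a 2, k + a 3, ?_, ?_, ?_, ?_⟩ <;> simp [hk] <;> ring⟩
  map_zero' := by
    apply Subtype.ext
    ext <;> simp
  map_add' a b := by
    apply Subtype.ext
    ext <;> simp <;> ring

theorem hurwitzOfCoords_bijective : Function.Bijective hurwitzOfCoords := by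
  constructor
  · intro a b h
    have h' := congrArg Subtype.val h
    have h0 : (a 0 / 2 : ℝ) = b 0 / 2 := congrArg QuaternionAlgebra.re h'
    have h1 : (a 0 / 2 + a 1 : ℝ) = b 0 / 2 + b 1 := congrArg QuaternionAlgebra.imI h'
    have h2 : (a 0 / 2 + a 2 : ℝ) = b 0 / 2 + b 2 := congrArg QuaternionAlgebra.imJ h'
    have h3 : (a 0 / 2 + a 3 : ℝ) = b 0 / 2 + b 3 := congrArg QuaternionAlgebra.imK h'
    have k0 : (a 0 : ℝ) = b 0 := by linarith
    have k1 : (a 1 : ℝ) = b 1 := by linarith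
    have k2 : (a 2 : ℝ) = b 2 := by linarith
    have k3 : (a 3 : ℝ) = b 3 := by linarith
    ext i
    fin_cases i
    exacts [Int.cast_injective k0, Int.cast_injective k1, Int.cast_injective k2,
      Int.cast_injective k3]
  · rintro ⟨q, ⟨a, b, e, f, h0, h1, h2, h3⟩ | ⟨a, b, e, f, h0, h1, h2, h3⟩⟩
    · refine ⟨![2 * a, b - a, e - a, f - a], Subtype.ext ?_⟩
      ext <;> simp [hurwitzOfCoords, h0, h1, h2, h3]
    · refine ⟨![2 * a + 1, b - a, e - a, f - a], Subtype.ext ?_⟩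
      ext <;> simp [hurwitzOfCoords, h0, h1, h2, h3] <;> ring

/-- The `ℤ`-basis `(1 + i + j + k) / 2, i, j, k` of the Hurwitz ring. -/
def hurwitzBasis : Module.Basis (Fin 4) ℤ hurwitz :=
  Module.Basis.ofEquivFun (AddEquiv.ofBijective _ hurwitzOfCoords_bijective).symm.toIntLinearEquiv

theorem hurwitzBasis_apply (i : Fin 4) : hurwitzBasis i = hurwitzOfCoords (Pi.single i 1) := by
  rw [hurwitzBasis, Module.Basis.coe_ofEquivFun]
  rfl

/-- The components of a Hurwitz quaternion. -/
def components : hurwitz →ₗ[ℤ] (Fin 4 → ℝ) :=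
  AddMonoidHom.toIntLinearMap
    { toFun := fun q => ![q.1.re, q.1.imI, q.1.imJ, q.1.imK]
      map_zero' := by
        ext i
        fin_cases i <;> simp
      map_add' := fun a b => by
        ext i
        fin_cases i <;> simp }

/-- Right multiplication as a `ℤ`-linear map of the Hurwitz ring. -/
def mulRightHom (x : hurwitz) : hurwitz →ₗ[ℤ] hurwitz := LinearMap.mulRight ℤ x

/-- Right multiplication by a quaternion in the basis `1, i, j, k`. -/
def mulRightMatrix (x : ℍ[ℝ]) : Matrix (Fin 4) (Fin 4) ℝ :=
  !![x.re, -x.imI, -x.imJ, -x.imK;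
    x.imI, x.re, x.imK, -x.imJ;
    x.imJ, -x.imK, x.re, x.imI;
    x.imK, x.imJ, -x.imI, x.re]

theorem det_mulRightMatrix (x : ℍ[ℝ]) :
    (mulRightMatrix x).det = Quaternion.normSq x ^ 2 := by
  rw [Quaternion.normSq_def', mulRightMatrix, Matrix.det_succ_row_zero]
  simp [Fin.sum_univ_succ, Matrix.det_fin_three, Fin.succAbove, Matrix.submatrix]
  ring

theorem components_mul (q x : hurwitz) :
    components (q * x) = mulRightMatrix x.1 *ᵥ components q := by
  ext i
  fin_cases i <;> simp [components, mulRightMatrix] <;> ring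

/-- The determinant is explicit in the real basis 1, i, j, k; the invertible matrix P carries it
over to the ℤ-basis of J. -/
theorem det_mulRightHom (x : hurwitz) :
    ((LinearMap.det (mulRightHom x) : ℤ) : ℝ) = Quaternion.normSq x.1 ^ 2 := by
  let P : Matrix (Fin 4) (Fin 4) ℝ := Matrix.of fun i j => components (hurwitzBasis j) i
  let M := LinearMap.toMatrix hurwitzBasis hurwitzBasis (mulRightHom x)
  have hP : P.det ≠ 0 := by
    have : P = !![1 / 2, 0, 0, 0; 1 / 2, 1, 0, 0; 1 / 2, 0, 1, 0; 1 / 2, 0, 0, 1] := by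
      ext i j
      change components (hurwitzBasis j) i = _
      rw [hurwitzBasis_apply]
      fin_cases i <;> fin_cases j <;> simp [components, hurwitzOfCoords]
    rw [this, Matrix.det_succ_row_zero]
    simp [Fin.sum_univ_succ, Matrix.det_fin_three, Fin.succAbove, Matrix.submatrix]
  have hPM : mulRightMatrix x.1 * P = P * M.map (Int.castRingHom ℝ) := by
    ext i j
    have h1 : components (hurwitzBasis j * x) i = (mulRightMatrix x.1 * P) i j := by
      rw [components_mul]
      rfl
    have h2 : hurwitzBasis j * x = ∑ k, M k j • hurwitzBasis k := by
      have h := hurwitzBasis.sum_repr (mulRightHom x (hurwitzBasis j))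
      simp only [M, LinearMap.toMatrix_apply]
      rw [h]
      rfl
    rw [← h1, h2, map_sum, Finset.sum_apply, Matrix.mul_apply]
    refine Finset.sum_congr rfl fun k _ => ?_
    rw [map_smul, Pi.smul_apply, zsmul_eq_mul, mul_comm]
    rfl
  have h := congrArg Matrix.det hPM
  rw [Matrix.det_mul, Matrix.det_mul, mul_comm, ← RingHom.mapMatrix_apply, ← RingHom.map_det,
    LinearMap.det_toMatrix, det_mulRightMatrix] at h
  exact (mul_left_cancel₀ hP h).symm

theorem mem_span_singleton_iff {x y : hurwitz} :
    y ∈ Submodule.span hurwitz {x} ↔ ∃ a : hurwitz, y = a * x := by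
  rw [Submodule.mem_span_singleton]
  exact exists_congr fun a => eq_comm

/-- Jx is the image of the injective ℤ-linear map a ↦ ax of J, so its index is the absolute value of
the determinant. -/
theorem index_span_singleton {x : hurwitz} (hx : x ≠ 0) {N : ℕ}
    (hN : Quaternion.normSq x.1 = N) :
    (Submodule.span hurwitz {x}).toAddSubgroup.index = N ^ 2 := by
  have : Module.Free ℤ hurwitz := Module.Free.of_basis hurwitzBasis
  have : Module.Finite ℤ hurwitz := Module.Finite.of_basis hurwitzBasis
  let L : Submodule ℤ hurwitz := AddSubgroup.toIntSubmodule (Submodule.span hurwitz {x}).toAddSubgroup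
  let e : hurwitz ≃+ L := AddEquiv.ofBijective
    (AddMonoidHom.mk' (fun a => (⟨a * x, mem_span_singleton_iff.2 ⟨a, rfl⟩⟩ : L))
      fun a b => Subtype.ext (add_mul a b x))
    ⟨fun a b h => mul_right_cancel₀ hx (congrArg Subtype.val h), fun y => by
      obtain ⟨a, ha⟩ := mem_span_singleton_iff.1 y.2
      exact ⟨a, Subtype.ext ha.symm⟩⟩
  have h := Submodule.natAbs_det_equiv L e
  have h' : (L.subtype ∘ₗ AddMonoidHom.toIntLinearMap (e : hurwitz →+ L)) = mulRightHom x :=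
    LinearMap.ext fun a => rfl
  rw [h'] at h
  have hdet : LinearMap.det (mulRightHom x) = ((N ^ 2 : ℕ) : ℤ) := by
    have := det_mulRightHom x
    rw [hN] at this
    exact_mod_cast this
  rw [hdet, Int.natAbs_natCast] at h
  rw [h]
  rfl

/-! ### Classification of the left ideals of the Hurwitz ring -/

/-- Conjugation exchanges left and right ideals. -/
theorem exists_generator_of_left_ideal (I : Submodule hurwitz hurwitz) (hI : I ≠ ⊥) :
    ∃ x : hurwitz, x ≠ 0 ∧ I = Submodule.span hurwitz {x} := by
  let K : AddSubgroup ℍ[ℝ] :=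
    { carrier := {y | ∃ x ∈ I, y = star x.1}
      zero_mem' := ⟨0, I.zero_mem, by simp⟩
      add_mem' := by
        rintro _ _ ⟨x, hx, rfl⟩ ⟨y, hy, rfl⟩
        exact ⟨x + y, I.add_mem hx hy, by simp⟩
      neg_mem' := by
        rintro _ ⟨x, hx, rfl⟩
        exact ⟨-x, I.neg_mem hx, by simp⟩ }
  obtain ⟨x0, hx0, hne⟩ := Submodule.exists_mem_ne_zero_of_ne_bot hI
  obtain ⟨q, ⟨x, hx, rfl⟩, hq0, hgen⟩ := exists_generator_of_right_ideal K
    (by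
      rintro _ ⟨x, -, rfl⟩
      exact star_mem_hurwitz x.2)
    (by
      rintro _ ⟨x, hx, rfl⟩ y hy
      exact ⟨⟨star y, star_mem_hurwitz hy⟩ * x, I.smul_mem _ hx, by simp⟩)
    ⟨star x0.1, ⟨x0, hx0, rfl⟩, by simpa using hne⟩
  refine ⟨x, by rintro rfl; simp at hq0, le_antisymm (fun y hy => ?_) ?_⟩
  · obtain ⟨z, hz, hyz⟩ := hgen (star y.1) ⟨y, hy, rfl⟩
    refine mem_span_singleton_iff.2 ⟨⟨star z, star_mem_hurwitz hz⟩, Subtype.ext ?_⟩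
    change y.1 = star z * x.1
    rw [← star_star y.1, hyz, star_mul, star_star]
  · rw [Submodule.span_singleton_le_iff_mem]
    exact hx

theorem span_eq_span_iff {x y : hurwitz} (hx : x ≠ 0) :
    Submodule.span hurwitz {x} = Submodule.span hurwitz {y} ↔
      ∃ u : hurwitz, Quaternion.normSq u.1 = 1 ∧ y = u * x := by
  have key : ∀ {u : hurwitz} {x y : hurwitz}, Quaternion.normSq u.1 = 1 → y = u * x →
      Submodule.span hurwitz {y} ≤ Submodule.span hurwitz {x} := by
    rintro u x y - rfl
    rw [Submodule.span_singleton_le_iff_mem]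
    exact mem_span_singleton_iff.2 ⟨u, rfl⟩
  constructor
  · intro h
    obtain ⟨u, hu⟩ := mem_span_singleton_iff.1 (h ▸ Submodule.mem_span_singleton_self y)
    obtain ⟨w, hw⟩ := mem_span_singleton_iff.1 (h ▸ Submodule.mem_span_singleton_self x)
    refine ⟨u, ?_, hu⟩
    have hwu : w * u = 1 := by
      apply mul_right_cancel₀ hx
      rw [mul_assoc, ← hu, ← hw, one_mul]
    obtain ⟨U, hU⟩ := exists_normSq_eq_natCast u.2
    obtain ⟨W, hW⟩ := exists_normSq_eq_natCast w.2
    have h1 : Quaternion.normSq w.1 * Quaternion.normSq u.1 = 1 := by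
      rw [← map_mul]
      have : w.1 * u.1 = 1 := congrArg Subtype.val hwu
      rw [this, map_one]
    rw [hU, hW] at h1
    have h2 : W * U = 1 := by exact_mod_cast h1
    rw [hU, Nat.eq_one_of_mul_eq_one_left h2, Nat.cast_one]
  · rintro ⟨u, hu, h⟩
    refine le_antisymm ?_ (key hu h)
    refine key (u := ⟨star u.1, star_mem_hurwitz u.2⟩) (by simpa using hu) ?_
    apply Subtype.ext
    change x.1 = star u.1 * y.1
    rw [h]
    change x.1 = star u.1 * (u.1 * x.1)
    rw [star_mul_of_normSq_eq (n := 1) (by simpa using hu)]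
    simp

theorem IsPrimitive.star {q : ℍ[ℝ]} (hq : IsPrimitive q) : IsPrimitive (star q) :=
  ⟨star_mem_hurwitz hq.1, fun k hk h => hq.2 k hk (by
    rw [← star_mem_hurwitz_iff, Quaternion.star_smul]
    exact h)⟩

theorem IsPrimitive.mul_unit {q u : ℍ[ℝ]} (hq : IsPrimitive q) (hu : u ∈ hurwitz)
    (hN : Quaternion.normSq u = 1) : IsPrimitive (q * u) :=
  ⟨mul_mem hq.1 hu, fun k hk h => hq.2 k hk (by
    have := mul_mem h (star_mem_hurwitz hu)
    rwa [smul_mul_assoc, mul_assoc, mul_star_of_unit hN, mul_one] at this)⟩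

/-- With a' and b' the coprime parts of a and b, a'p = b'q and xa' + yb' = 1 give p/b' = xq + yp in
J, so b' = 1. -/
theorem IsPrimitive.dvd_of_smul_eq {p q : ℍ[ℝ]} (hp : IsPrimitive p) (hq : q ∈ hurwitz) {a b : ℕ}
    (hb : 0 < b) (h : (a : ℝ) • p = (b : ℝ) • q) : b ∣ a := by
  obtain ⟨g, a', b', hg, hcop, rfl, rfl⟩ : ∃ g a' b', 0 < g ∧ Nat.Coprime a' b' ∧
      a = a' * g ∧ b = b' * g := by
    obtain ⟨a', b', hcop, ha, hb'⟩ := Nat.exists_coprime a b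
    exact ⟨_, a', b', Nat.gcd_pos_of_pos_right a hb, hcop, ha, hb'⟩
  have hgR : (g : ℝ) ≠ 0 := by positivity
  have hb' : 0 < b' := Nat.pos_of_ne_zero (by rintro rfl; simp at hb)
  have hbR : (b' : ℝ) ≠ 0 := by positivity
  have h1 : (a' : ℝ) • p = (b' : ℝ) • q := by
    rw [mul_comm a', mul_comm b', Nat.cast_mul, Nat.cast_mul, mul_smul, mul_smul] at h
    exact smul_right_injective ℍ[ℝ] hgR h
  obtain ⟨x, y, hxy⟩ := Nat.isCoprime_iff_coprime.2 hcop
  have hxyR : (x : ℝ) * a' + y * b' = 1 := by exact_mod_cast hxy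
  have h2 : (b' : ℝ)⁻¹ • p = (x : ℝ) • q + (y : ℝ) • p := by
    rw [inv_smul_eq_iff₀ hbR]
    calc p = ((x : ℝ) * a' + y * b') • p := by rw [hxyR, one_smul]
      _ = (x : ℝ) • ((a' : ℝ) • p) + ((y : ℝ) * b') • p := by rw [add_smul, mul_smul]
      _ = _ := by
        rw [h1]
        module
  have h3 := hp.2 b' hb' (by
    rw [h2]
    exact add_mem (intCast_smul_mem_hurwitz x hq) (intCast_smul_mem_hurwitz y hp.1))
  rw [h3, one_mul]
  exact dvd_mul_left _ _

theorem IsPrimitive.eq_of_smul_eq {p q : ℍ[ℝ]} (hp : IsPrimitive p) (hq : IsPrimitive q) {a b : ℕ}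
    (ha : 0 < a) (hb : 0 < b) (h : (a : ℝ) • p = (b : ℝ) • q) : a = b ∧ p = q := by
  have hab := Nat.dvd_antisymm (hq.dvd_of_smul_eq hp.1 ha h.symm) (hp.dvd_of_smul_eq hq.1 hb h)
  subst hab
  exact ⟨rfl, smul_right_injective ℍ[ℝ] (by positivity : (a : ℝ) ≠ 0) h⟩

theorem IsPrimitive.exists_unit_of_csl_eq {q r : ℍ[ℝ]} (hq : IsPrimitive q) (hr : IsPrimitive r)
    {n m : ℕ} (hqN : Quaternion.normSq q = n) (hrN : Quaternion.normSq r = m) (hn : Odd n)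
    (hm : Odd m) (h : csl pc (rotation q hq.ne_zero) = csl pc (rotation r hr.ne_zero)) :
    ∃ u ∈ hurwitz, Quaternion.normSq u = 1 ∧ r = q * u := by
  have hnm : n = m := by
    rw [← isCubic_pc.coincidenceIndex_rotation hq hqN hn,
      ← isCubic_pc.coincidenceIndex_rotation hr hrN hm, coincidenceIndex, coincidenceIndex, h]
  subst hnm
  obtain ⟨v, hv, hqv⟩ := hq.exists_conic hqN hn
  obtain ⟨w, hw, hrw⟩ := hr.exists_conic hrN hn
  rw [hqv.csl_eq isCubic_pc hn hv, hrw.csl_eq isCubic_pc hn hw] at h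
  obtain ⟨t, ht⟩ := hv.exists_smul_of_le isCubic_pc hn h.le
  exact hqv.exists_unit hn.pos hrw ht

/-- The coincidence site lattices of `ℤ³`. -/
abbrev PrimitiveCSL : Type := {Λ : AddSubgroup (Fin 3 → ℝ) // ∃ R ∈ OC pc, Λ = csl pc R}

/-- The index of a coincidence site lattice of `ℤ³`. -/
def PrimitiveCSL.index (Λ : PrimitiveCSL) : ℕ := Λ.1.relIndex pc

theorem PrimitiveCSL.exists_quaternion (Λ : PrimitiveCSL) :
    ∃ (q : ℍ[ℝ]) (hq : IsPrimitive q), Quaternion.normSq q = Λ.index ∧ Odd Λ.index ∧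
      csl pc (rotation q hq.ne_zero) = Λ.1 := by
  obtain ⟨_, R, hR, rfl⟩ := Λ
  obtain ⟨q, hq, v, hv, hodd, hqv, hcsl, -⟩ := isCubic_pc.exists_odd_of_mem_OC hR
  refine ⟨q, hq, hqv.normSq_eq, hodd, ?_⟩
  rw [hqv.csl_eq isCubic_pc hodd hv]
  exact hcsl.symm

/-- A quaternion that gives the coincidence site lattice. -/
def PrimitiveCSL.quaternion (Λ : PrimitiveCSL) : ℍ[ℝ] := Λ.exists_quaternion.choose

theorem PrimitiveCSL.isPrimitive (Λ : PrimitiveCSL) : IsPrimitive Λ.quaternion :=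
  Λ.exists_quaternion.choose_spec.choose

theorem PrimitiveCSL.normSq_quaternion (Λ : PrimitiveCSL) :
    Quaternion.normSq Λ.quaternion = Λ.index :=
  Λ.exists_quaternion.choose_spec.choose_spec.1

theorem PrimitiveCSL.odd_index (Λ : PrimitiveCSL) : Odd Λ.index :=
  Λ.exists_quaternion.choose_spec.choose_spec.2.1

theorem PrimitiveCSL.csl_quaternion (Λ : PrimitiveCSL) :
    csl pc (rotation Λ.quaternion Λ.isPrimitive.ne_zero) = Λ.1 :=
  Λ.exists_quaternion.choose_spec.choose_spec.2.2

/-- The generators `(2 k + 1) q̄ (1 + i)^ℓ` of the nonzero left ideals. -/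
def idealGenerator (i : ℕ × ℕ × PrimitiveCSL) : hurwitz :=
  ⟨((2 * i.2.1 + 1 : ℕ) : ℝ) • (star i.2.2.quaternion * oneAddI ^ i.1),
    natCast_smul_mem_hurwitz _ (mul_mem (star_mem_hurwitz i.2.2.isPrimitive.1)
      (pow_mem oneAddI_mem_hurwitz _))⟩

theorem normSq_idealGenerator (i : ℕ × ℕ × PrimitiveCSL) :
    Quaternion.normSq (idealGenerator i).1
      = (2 ^ i.1 * ((2 * i.2.1 + 1) ^ 2 * i.2.2.index) : ℕ) := by
  rw [idealGenerator, Quaternion.normSq_smul, map_mul, map_pow, Quaternion.normSq_star,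
    i.2.2.normSq_quaternion, normSq_oneAddI]
  push_cast
  ring

theorem idealGenerator_ne_zero (i : ℕ × ℕ × PrimitiveCSL) : idealGenerator i ≠ 0 := by
  intro h
  have h1 := normSq_idealGenerator i
  rw [h] at h1
  have h2 : 2 ^ i.1 * ((2 * i.2.1 + 1) ^ 2 * i.2.2.index) = 0 := by
    have h3 : Quaternion.normSq ((0 : hurwitz) : ℍ[ℝ]) = 0 := by simp
    rw [h3] at h1
    exact_mod_cast h1.symm
  have := i.2.2.odd_index.pos
  exact absurd h2 (by positivity)

/-- The nonzero left ideals, by their generators. -/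
def idealOfIndex (i : ℕ × ℕ × PrimitiveCSL) : {I : Submodule hurwitz hurwitz // I ≠ ⊥} :=
  ⟨Submodule.span hurwitz {idealGenerator i}, by
    rw [Ne, Submodule.span_singleton_eq_bot]
    exact idealGenerator_ne_zero i⟩

theorem eq_of_two_pow_mul_odd_eq {a b m n : ℕ} (hm : Odd m) (hn : Odd n)
    (h : 2 ^ a * m = 2 ^ b * n) : a = b := by
  have h1 : 2 ^ a ∣ 2 ^ b :=
    (Nat.Coprime.pow_left a hn.coprime_two_left).dvd_of_dvd_mul_right ⟨m, h.symm⟩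
  have h2 : 2 ^ b ∣ 2 ^ a :=
    (Nat.Coprime.pow_left b hm.coprime_two_left).dvd_of_dvd_mul_right ⟨n, h⟩
  exact Nat.pow_right_injective le_rfl (Nat.dvd_antisymm h1 h2)

/-- The norms determine ℓ as an exponent of 2. After cancelling (1 + i)^ℓ and conjugating, two odd
multiples of primitive quaternions agree up to a unit on the right. So the multipliers agree, and
the quaternions have the same CSL. -/
theorem idealOfIndex_injective : Function.Injective idealOfIndex := by
  rintro i j h
  obtain ⟨u, hu, hji⟩ := (span_eq_span_iff (idealGenerator_ne_zero i)).1 (congrArg Subtype.val h)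
  have hval : (idealGenerator j).1 = u.1 * (idealGenerator i).1 := congrArg Subtype.val hji
  have hN := congrArg Quaternion.normSq hval
  rw [map_mul, hu, one_mul, normSq_idealGenerator, normSq_idealGenerator] at hN
  have hN' := Nat.cast_injective hN
  have hodd : ∀ i : ℕ × ℕ × PrimitiveCSL, Odd ((2 * i.2.1 + 1) ^ 2 * i.2.2.index) :=
    fun i => ((odd_two_mul_add_one _).pow).mul i.2.2.odd_index
  have hℓ : i.1 = j.1 := (eq_of_two_pow_mul_odd_eq (hodd j) (hodd i) hN').symm
  have hval' : ((2 * j.2.1 + 1 : ℕ) : ℝ) • j.2.2.quaternion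
      = ((2 * i.2.1 + 1 : ℕ) : ℝ) • (i.2.2.quaternion * star u.1) := by
    simp only [idealGenerator] at hval
    rw [← hℓ, ← smul_mul_assoc, mul_smul_comm, ← mul_assoc, ← smul_mul_assoc] at hval
    have h1 := mul_right_cancel₀ (pow_ne_zero _ oneAddI_ne_zero) hval
    have h2 := congrArg Star.star h1
    simpa only [Quaternion.star_smul, star_mul, star_star] using h2
  have hu' : Quaternion.normSq (star u.1) = 1 := by rw [Quaternion.normSq_star, hu]
  obtain ⟨hk, hq⟩ := j.2.2.isPrimitive.eq_of_smul_eq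
    (i.2.2.isPrimitive.mul_unit (star_mem_hurwitz u.2) hu') (Nat.succ_pos _) (Nat.succ_pos _) hval'
  have hk' : i.2.1 = j.2.1 := by omega
  have hu0 : star u.1 ≠ 0 := by
    rw [← Quaternion.normSq_ne_zero, hu']
    exact one_ne_zero
  have hΛ : i.2.2 = j.2.2 := by
    apply Subtype.ext
    rw [← i.2.2.csl_quaternion, ← j.2.2.csl_quaternion]
    have hrot : rotation j.2.2.quaternion j.2.2.isPrimitive.ne_zero
        = rotation i.2.2.quaternion i.2.2.isPrimitive.ne_zero * rotation (star u.1) hu0 := by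
      apply Subtype.ext
      change cayleyMatrix _ = cayleyMatrix _ * cayleyMatrix _
      rw [hq, cayleyMatrix_mul]
    rw [hrot, csl_mul_symmetry
      (isCubic_pc.rotation_unit_mem (star_mem_hurwitz u.2) hu' hu0)]
  exact Prod.ext hℓ (Prod.ext hk' hΛ)

/-- A generator is x = d r (1 + i)^ℓ with d odd and r primitive of odd norm. The conjugate of r
differs by a unit on the right from the quaternion chosen for its CSL, so x differs from the listed
generator by a unit on the left. -/
theorem idealOfIndex_surjective : Function.Surjective idealOfIndex := by
  rintro ⟨I, hI⟩
  obtain ⟨x, hx, rfl⟩ := exists_generator_of_left_ideal I hI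
  have hx0 : x.1 ≠ 0 := fun h => hx (Subtype.ext h)
  obtain ⟨ℓ, y, N, hy, hxy, hN, hodd⟩ := exists_odd_mul_oneAddI_pow x.2 hx0
  have hy0 : y ≠ 0 := by
    rintro rfl
    exact hx0 (by rw [hxy, zero_mul])
  obtain ⟨d, r, hd, hr, rfl⟩ := exists_primitive_smul hy hy0
  obtain ⟨n, hn⟩ := exists_normSq_eq_natCast hr.1
  have hNd : N = d ^ 2 * n := by
    rw [Quaternion.normSq_smul, hn] at hN
    exact_mod_cast hN.symm
  rw [hNd, Nat.odd_mul] at hodd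
  obtain ⟨k, hk⟩ := (Nat.odd_pow_iff two_ne_zero).1 hodd.1
  subst hk
  let Λ : PrimitiveCSL := ⟨csl pc (rotation (star r) hr.star.ne_zero), _,
    isCubic_pc.rational_subset_OC (rotation_mem_rationalOrthogonal hr.star.1 hr.star.ne_zero), rfl⟩
  obtain ⟨u, hu, hu1, hru⟩ := Λ.isPrimitive.exists_unit_of_csl_eq hr.star Λ.normSq_quaternion
    (by rw [Quaternion.normSq_star, hn]) Λ.odd_index hodd.2 Λ.csl_quaternion
  refine ⟨(ℓ, k, Λ), Subtype.ext ?_⟩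
  refine (span_eq_span_iff (idealGenerator_ne_zero _)).2
    ⟨⟨star u, star_mem_hurwitz hu⟩, by simpa using hu1, Subtype.ext ?_⟩
  change x.1 = star u * (((2 * k + 1 : ℕ) : ℝ) • (star Λ.quaternion * oneAddI ^ ℓ))
  rw [hxy, mul_smul_comm, ← mul_assoc, ← star_mul, ← hru, star_star, smul_mul_assoc]

/-! ### The zeta function of the Hurwitz ring -/

/-- The index is the square of the norm of the generator, so at s/2 the term is that norm to the
power -s, and the norm is multiplicative. -/
theorem zetaHurwitzTerm_idealOfIndex (s : ℂ) (i : ℕ × ℕ × PrimitiveCSL) :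
    zetaHurwitzTerm (s / 2) (idealOfIndex i) = ((2 : ℂ) ^ (-s)) ^ i.1 *
      (((2 * i.2.1 + 1 : ℕ) : ℂ) ^ (-(2 * s)) * (i.2.2.index : ℂ) ^ (-s)) := by
  have hsq : ∀ (m : ℕ) (w : ℂ), ((m ^ 2 : ℕ) : ℂ) ^ w = (m : ℂ) ^ (2 * w) := fun m w => by
    rw [natCast_pow_cpow, ← Complex.cpow_nat_mul]
    push_cast
    rfl
  rw [zetaHurwitzTerm, idealOfIndex, index_span_singleton (idealGenerator_ne_zero i)
    (normSq_idealGenerator i), hsq, show 2 * -(s / 2) = -s by ring, Nat.cast_mul,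
    Complex.natCast_mul_natCast_cpow, Nat.cast_mul, Complex.natCast_mul_natCast_cpow, hsq,
    natCast_pow_cpow, mul_neg]
  push_cast
  rfl

theorem finite_fiber_index (n : ℕ) : Finite {Λ : PrimitiveCSL // Λ.index = n} := by
  have := (isCubic_pc.finite_cslsOfIndex n).to_subtype
  exact Finite.of_injective (β := cslsOfIndex pc n) (fun Λ => ⟨Λ.1.1, Λ.1.2, Λ.2⟩)
    fun Λ Λ' h => Subtype.ext (Subtype.ext
      (congrArg (fun x : cslsOfIndex pc n => x.1) h : Λ.1.1 = Λ'.1.1))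

theorem card_fiber_index (n : ℕ) : Nat.card {Λ : PrimitiveCSL // Λ.index = n} = c pc n := by
  rw [c, ← Nat.card_coe_set_eq]
  exact Nat.card_congr
    { toFun := fun Λ => ⟨Λ.1.1, Λ.1.2, Λ.2⟩
      invFun := fun Λ => ⟨⟨Λ.1, Λ.2.1⟩, Λ.2.2⟩
      left_inv := fun _ => rfl
      right_inv := fun _ => rfl }

theorem summable_primitiveCSL {s : ℂ} (hs : 2 < s.re) :
    Summable fun Λ : PrimitiveCSL => ‖(Λ.index : ℂ) ^ (-s)‖ := by
  rw [← (Equiv.sigmaFiberEquiv PrimitiveCSL.index).summable_iff]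
  change Summable fun x : Σ n, {Λ : PrimitiveCSL // Λ.index = n} =>
    ‖((Equiv.sigmaFiberEquiv PrimitiveCSL.index x).index : ℂ) ^ (-s)‖
  rw [summable_sigma_of_nonneg fun _ => norm_nonneg _]
  refine ⟨fun n => ?_, ?_⟩
  · have := finite_fiber_index n
    exact Summable.of_finite
  · refine (isCubic_pc.lseriesSummable_c hs).norm.congr fun n => ?_
    have h : ∀ Λ : {Λ : PrimitiveCSL // Λ.index = n},
        ‖((Equiv.sigmaFiberEquiv PrimitiveCSL.index ⟨n, Λ⟩).index : ℂ) ^ (-s)‖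
          = ‖(n : ℂ) ^ (-s)‖ := by
      rintro ⟨Λ, rfl⟩
      rfl
    simp only [h]
    rw [tsum_const, card_fiber_index, nsmul_eq_mul]
    rcases eq_or_ne n 0 with rfl | hn
    · rw [isCubic_pc.c_of_not_odd (by decide)]
      simp
    · rw [LSeries.term_of_ne_zero hn, Complex.cpow_neg, div_eq_mul_inv, norm_mul,
        Complex.norm_natCast]

theorem tsum_primitiveCSL {s : ℂ} (hs : 2 < s.re) :
    ∑' Λ : PrimitiveCSL, (Λ.index : ℂ) ^ (-s) = LSeries (fun n => (c pc n : ℂ)) s := by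
  rw [← (Equiv.sigmaFiberEquiv PrimitiveCSL.index).tsum_eq]
  have hsum : Summable fun x : Σ n, {Λ : PrimitiveCSL // Λ.index = n} =>
      ((Equiv.sigmaFiberEquiv PrimitiveCSL.index x).index : ℂ) ^ (-s) :=
    (Equiv.summable_iff (Equiv.sigmaFiberEquiv PrimitiveCSL.index)
      (f := fun Λ : PrimitiveCSL => (Λ.index : ℂ) ^ (-s))).2 (summable_primitiveCSL hs).of_norm
  rw [hsum.tsum_sigma, LSeries]
  refine tsum_congr fun n => ?_
  have h : ∀ Λ : {Λ : PrimitiveCSL // Λ.index = n},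
      ((Equiv.sigmaFiberEquiv PrimitiveCSL.index ⟨n, Λ⟩).index : ℂ) ^ (-s) = (n : ℂ) ^ (-s) := by
    rintro ⟨Λ, rfl⟩
    rfl
  simp only [h]
  rw [tsum_const, card_fiber_index, nsmul_eq_mul]
  rcases eq_or_ne n 0 with rfl | hn
  · rw [isCubic_pc.c_of_not_odd (by decide)]
    simp
  · rw [LSeries.term_of_ne_zero hn, Complex.cpow_neg, div_eq_mul_inv]

theorem summable_norm_natCast_cpow {w : ℂ} (hw : 1 < w.re) :
    Summable fun n : ℕ => ‖(n : ℂ) ^ (-w)‖ :=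
  summable_riemannZetaSummand hw

theorem summable_odd {w : ℂ} (hw : 1 < w.re) :
    Summable fun k : ℕ => ‖((2 * k + 1 : ℕ) : ℂ) ^ (-w)‖ :=
  (summable_norm_natCast_cpow hw).comp_injective (i := fun k : ℕ => 2 * k + 1)
    fun a b h => by simpa using h

theorem tsum_odd {w : ℂ} (hw : 1 < w.re) :
    ∑' k : ℕ, ((2 * k + 1 : ℕ) : ℂ) ^ (-w) = (1 - (2 : ℂ) ^ (-w)) * riemannZeta w := by
  have hz : ∑' n : ℕ, (n : ℂ) ^ (-w) = riemannZeta w := tsum_riemannZetaSummand hw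
  have hsum := (summable_norm_natCast_cpow hw).of_norm
  have heven : ∀ k : ℕ, ((2 * k : ℕ) : ℂ) ^ (-w) = (2 : ℂ) ^ (-w) * (k : ℂ) ^ (-w) := fun k => by
    rw [Nat.cast_mul, Complex.natCast_mul_natCast_cpow]
    rfl
  have h := tsum_even_add_odd (f := fun n : ℕ => (n : ℂ) ^ (-w))
    (by simp only [heven]; exact hsum.mul_left _) (summable_odd hw).of_norm
  simp only [heven] at h
  rw [tsum_mul_left, hz] at h
  linear_combination h

/-- With x = 2^(-s), the sum over ℓ is 1/(1 - x), the sum over odd multipliers is (1 - x²)ζ(2s), and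
the CSLs contribute the series of c; finally (1 - x²)/(1 - x) = 1 + x. -/
theorem summable_zetaHurwitzTerm {s : ℂ} (hs : 2 < s.re) :
    Summable (zetaHurwitzTerm (s / 2)) ∧ zetaHurwitz (s / 2)
      = (1 + (2 : ℂ) ^ (-s)) * (riemannZeta (2 * s) * LSeries (fun n => (c pc n : ℂ)) s) := by
  have h2s : 1 < (2 * s).re := by
    simp only [Complex.mul_re, Complex.re_ofNat, Complex.im_ofNat, zero_mul, sub_zero]
    linarith
  have hx : ‖(2 : ℂ) ^ (-s)‖ < 1 := by
    exact_mod_cast norm_prime_cpow_lt_one Nat.prime_two (s := s) (by linarith)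
  have hg : Summable fun ℓ : ℕ => ‖((2 : ℂ) ^ (-s)) ^ ℓ‖ := by
    simp only [norm_pow]
    exact summable_geometric_of_lt_one (norm_nonneg _) hx
  have ho := summable_odd h2s
  have hc := summable_primitiveCSL hs
  have hoc := ho.mul_norm hc
  let e := Equiv.ofBijective idealOfIndex ⟨idealOfIndex_injective, idealOfIndex_surjective⟩
  have he : ∀ i, zetaHurwitzTerm (s / 2) (e i) = ((2 : ℂ) ^ (-s)) ^ i.1 *
      (((2 * i.2.1 + 1 : ℕ) : ℂ) ^ (-(2 * s)) * (i.2.2.index : ℂ) ^ (-s)) :=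
    zetaHurwitzTerm_idealOfIndex s
  refine ⟨?_, ?_⟩
  · rw [← e.summable_iff]
    exact (hg.mul_norm hoc).of_norm.congr fun i => (he i).symm
  · rw [zetaHurwitz, ← e.tsum_eq]
    simp only [he]
    rw [← tsum_mul_tsum_of_summable_norm hg hoc, ← tsum_mul_tsum_of_summable_norm ho hc,
      tsum_geometric_of_norm_lt_one hx, tsum_odd h2s, tsum_primitiveCSL hs]
    have hsq : (2 : ℂ) ^ (-(2 * s)) = ((2 : ℂ) ^ (-s)) ^ 2 := by
      rw [← Complex.cpow_nat_mul]
      congr 1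
      push_cast
      ring
    have hx1 := one_sub_ne_zero_of_norm_lt_one hx
    rw [hsq]
    field_simp
    ring

/-! ### The power of 2 in the norm, and the index and denominator of R(q) -/

theorem isGreatest_two_pow_dvd {n : ℕ} (hn : Odd n) (ℓ : ℕ) :
    IsGreatest {k : ℕ | 2 ^ k ∣ n * 2 ^ ℓ} ℓ :=
  ⟨dvd_mul_left _ _, fun k hk => (Nat.pow_dvd_pow_iff_le_right one_lt_two).1
    ((Nat.Coprime.pow_left k hn.coprime_two_left).dvd_of_dvd_mul_left hk)⟩

theorem IsCubic.c_prime {Γ : AddSubgroup (Fin 3 → ℝ)} (hΓ : IsCubic Γ) {p : ℕ} (hp : p.Prime)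
    (hp2 : p ≠ 2) : c Γ p = p + 1 := by
  have h := hΓ.c_prime_pow hp hp2 le_rfl
  rwa [pow_one, Nat.sub_self, pow_zero, mul_one] at h

theorem IsCubic.rotation_properties {Γ : AddSubgroup (Fin 3 → ℝ)} (hΓ : IsCubic Γ) {q : ℍ[ℝ]}
    (hq : IsPrimitive q) :
    ∃ N ℓ : ℕ, Quaternion.normSq q = (N : ℝ) ∧ IsGreatest {k : ℕ | 2 ^ k ∣ N} ℓ ∧
      (coincidenceIndex Γ (rotation q hq.ne_zero) : ℝ) = Quaternion.normSq q / 2 ^ ℓ ∧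
      (coincidenceIndex bcc (rotation q hq.ne_zero) : ℝ) = Quaternion.normSq q / 2 ^ ℓ ∧
      IsDen Γ (rotation q hq.ne_zero) (Quaternion.normSq q / 2 ^ ℓ) := by
  obtain ⟨r, hr, n, ℓ, hN, hn, hqN, S, hS, hqr⟩ := hq.exists_odd
  have hdiv : Quaternion.normSq q / 2 ^ ℓ = (n : ℝ) := by
    rw [hqN]
    push_cast
    exact mul_div_cancel_right₀ _ (by positivity)
  refine ⟨n * 2 ^ ℓ, ℓ, hqN, isGreatest_two_pow_dvd hn ℓ, ?_, ?_, ?_⟩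
  · rw [hdiv, hqr, coincidenceIndex_mul_symmetry (hS Γ hΓ), hΓ.coincidenceIndex_rotation hr hN hn]
  · rw [hdiv, hqr, coincidenceIndex_mul_symmetry (hS bcc isCubic_bcc),
      isCubic_bcc.coincidenceIndex_rotation hr hN hn]
  · rw [hdiv, hqr, isDen_mul_symmetry (hS Γ hΓ)]
    exact hΓ.isDen_rotation hr hN hn

end CSL
end

/-! ### Assembly of the theorem -/

theorem mainTheorem4 (Γ : AddSubgroup (Fin 3 → ℝ))
    (hΓ : Γ = CSL.pc ∨ Γ = CSL.bcc ∨ Γ = CSL.fcc) :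
    -- the groups of coincidence isometries and similarity isometries
    (CSL.OC Γ = CSL.OS Γ ∧ CSL.OS Γ = CSL.OC CSL.bcc ∧
      CSL.OC CSL.bcc = CSL.rationalOrthogonal 3) ∧
    -- the coincidence index and the denominator of `R(q)`
    (∀ (q : Quaternion ℝ) (hq : CSL.IsPrimitive q),
      CSL.rotation q hq.ne_zero ∈ CSL.OC Γ ∧
      ∃ N ℓ : ℕ, Quaternion.normSq q = (N : ℝ) ∧ IsGreatest {k : ℕ | 2 ^ k ∣ N} ℓ ∧
        (CSL.coincidenceIndex Γ (CSL.rotation q hq.ne_zero) : ℝ) = Quaternion.normSq q / 2 ^ ℓ ∧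
        (CSL.coincidenceIndex CSL.bcc (CSL.rotation q hq.ne_zero) : ℝ)
          = Quaternion.normSq q / 2 ^ ℓ ∧
        CSL.IsDen Γ (CSL.rotation q hq.ne_zero) (Quaternion.normSq q / 2 ^ ℓ)) ∧
    -- the counting functions count finite sets and agree
    (∀ n : ℕ, (CSL.cslsOfIndex Γ n).Finite ∧ (CSL.isosOfIndex Γ n).Finite ∧
      CSL.c Γ n = CSL.cIso Γ n ∧ CSL.c Γ n = CSL.c CSL.bcc n) ∧
    -- the values of the counting function
    (CSL.c Γ 1 = 1 ∧
      (∀ m n : ℕ, Nat.Coprime m n → CSL.c Γ (m * n) = CSL.c Γ m * CSL.c Γ n) ∧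
      (∀ r : ℕ, 1 ≤ r → CSL.c Γ (2 ^ r) = 0) ∧
      (∀ p r : ℕ, p.Prime → p ≠ 2 → 1 ≤ r → CSL.c Γ (p ^ r) = (p + 1) * p ^ (r - 1)) ∧
      (∀ n : ℕ, CSL.c Γ n ≠ 0 ↔ Odd n) ∧
      CSL.c Γ 3 = 4 ∧ CSL.c Γ 5 = 6 ∧ CSL.c Γ 7 = 8 ∧ CSL.c Γ 9 = 12 ∧ CSL.c Γ 11 = 12 ∧
      CSL.c Γ 13 = 14 ∧ CSL.c Γ 15 = 24 ∧ CSL.c Γ 17 = 18 ∧ CSL.c Γ 19 = 20 ∧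
      CSL.c Γ 21 = 32) ∧
    -- the Dirichlet series, on their half-plane of absolute convergence
    (∀ s : ℂ, 2 < s.re →
      LSeriesSummable (fun n => (CSL.c Γ n : ℂ)) s ∧
      LSeriesSummable (fun n => (CSL.cIso Γ n : ℂ)) s ∧
      LSeriesSummable (fun n => (CSL.c CSL.bcc n : ℂ)) s ∧
      Summable (CSL.zetaHurwitzTerm (s / 2)) ∧
      LSeries (fun n => (CSL.c Γ n : ℂ)) s = LSeries (fun n => (CSL.cIso Γ n : ℂ)) s ∧
      LSeries (fun n => (CSL.c Γ n : ℂ)) s = LSeries (fun n => (CSL.c CSL.bcc n : ℂ)) s ∧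
      HasProd (fun p : {p : Nat.Primes // (p : ℕ) ≠ 2} =>
          (1 + ((p : ℕ) : ℂ) ^ (-s)) / (1 - ((p : ℕ) : ℂ) ^ (1 - s)))
        (LSeries (fun n => (CSL.c Γ n : ℂ)) s) ∧
      LSeries (fun n => (CSL.c Γ n : ℂ)) s
        = 1 / (1 + (2 : ℂ) ^ (-s)) * (CSL.zetaHurwitz (s / 2) / riemannZeta (2 * s)) ∧
      LSeries (fun n => (CSL.c Γ n : ℂ)) s
        = (1 - (2 : ℂ) ^ (1 - s)) / (1 + (2 : ℂ) ^ (-s)) *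
          (riemannZeta s * riemannZeta (s - 1) / riemannZeta (2 * s))) := by
  have h : CSL.IsCubic Γ := by
    rcases hΓ with rfl | rfl | rfl
    exacts [CSL.isCubic_pc, CSL.isCubic_bcc, CSL.isCubic_fcc]
  have hcIso : CSL.cIso Γ = CSL.c Γ := funext fun n => (h.c_eq_cIso n).symm
  have hbcc : CSL.c CSL.bcc = CSL.c Γ := funext fun n => CSL.isCubic_bcc.c_eq h n
  have hpc : CSL.c CSL.pc = CSL.c Γ := funext fun n => CSL.isCubic_pc.c_eq h n
  refine ⟨⟨h.OC_eq.trans h.OS_eq.symm, h.OS_eq.trans CSL.isCubic_bcc.OC_eq.symm,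
      CSL.isCubic_bcc.OC_eq⟩,
    fun q hq => ⟨h.rational_subset_OC (CSL.rotation_mem_rationalOrthogonal hq.1 hq.ne_zero),
      h.rotation_properties hq⟩,
    fun n => ⟨h.finite_cslsOfIndex n, h.finite_isosOfIndex n, h.c_eq_cIso n,
      h.c_eq CSL.isCubic_bcc n⟩,
    ⟨h.c_one, fun m n => h.c_mul, fun r => h.c_two_pow, fun p r => h.c_prime_pow,
      h.c_ne_zero_iff, ?_⟩, fun s hs => ?_⟩
  · have h3 : CSL.c Γ 3 = 4 := h.c_prime (by norm_num) (by norm_num)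
    have h5 : CSL.c Γ 5 = 6 := h.c_prime (by norm_num) (by norm_num)
    have h7 : CSL.c Γ 7 = 8 := h.c_prime (by norm_num) (by norm_num)
    refine ⟨h3, h5, h7, h.c_prime_pow Nat.prime_three (by norm_num) one_le_two,
      h.c_prime (by norm_num) (by norm_num), h.c_prime (by norm_num) (by norm_num), ?_,
      h.c_prime (by norm_num) (by norm_num), h.c_prime (by norm_num) (by norm_num), ?_⟩
    · rw [show 15 = 3 * 5 from rfl, h.c_mul (by norm_num), h3, h5]
    · rw [show 21 = 3 * 7 from rfl, h.c_mul (by norm_num), h3, h7]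
  · obtain ⟨hsum, hzeta⟩ := CSL.summable_zetaHurwitzTerm hs
    have hL := h.lseriesSummable_c hs
    have hx : ‖(2 : ℂ) ^ (-s)‖ < 1 := by
      exact_mod_cast CSL.norm_prime_cpow_lt_one Nat.prime_two (s := s) (by linarith)
    have hx2 := CSL.one_add_ne_zero_of_norm_lt_one hx
    have hz : riemannZeta (2 * s) ≠ 0 := riemannZeta_ne_zero_of_one_le_re (by
      simp only [Complex.mul_re, Complex.re_ofNat, Complex.im_ofNat, zero_mul, sub_zero]
      linarith)
    rw [hcIso, hbcc]
    refine ⟨hL, hL, hL, hsum, rfl, rfl, h.hasProd_odd_primes hs, ?_, ?_⟩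
    · rw [hzeta, hpc, mul_div_assoc, mul_div_cancel_left₀ _ hz, one_div_mul_eq_div,
        mul_div_cancel_left₀ _ hx2]
    · rw [← mul_div_assoc, eq_div_iff hz, h.lseries_c_mul_zeta hs]
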